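/- Let $n\ge 1$ and let $M$ be a closed (compact, without boundary) smooth manifold of real dimension $2n$ with a smooth $SU(n)$-structure $(g,J,\Psi)$: $g$ is a Riemannian metric, $J$ an almost complex structure with $g(JX,JY)=g(X,Y)$, and $\Psi$ a complex-valued $n$-form of type $(n,0)$ with $\langle\Psi,\Psi\rangle=1$. Let $\nabla$ be the Levi-Civita connection, $R(X,Y)=[\nabla_X,\nabla_Y]-\nabla_{[X,Y]}$, and let $(e_i)$ denote any local orthonormal frame. The $*$-scalar curvature is $$s^*=\sum_{i,j}g(R(e_i,e_j)Je_j,Je_i).$$ For $G=U(n)$ or $SU(n)$, with Lie algebra $\mathfrak g\subset\mathfrak{so}(TM)$ and $\mathfrak g^\perp$ its orthogonal complement in $\mathfrak{so}(TM)$ for the form $(A,B)\mapsto\operatorname{tr}(AB)$, the intrinsic torsion is the unique $(1,2)$-tensor with values $\xi_X\in\mathfrak g^\perp$ such that $\nabla+\xi$ is a $G$-connection (that is, it makes $J$, and for $G=SU(n)$ also $\Psi$, parallel). Write $\xi$ for the intrinsic torsion of the $SU(n)$-structure, $\xi^{U(n)}$ for that of the underlying $U(n)$-structure $(g,J)$,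 and $\chi^{U(n)}=\sum_i\xi^{U(n)}_{e_i}e_i$. Let $\eta$ be the one-form with $$\eta(JX)=-\frac1{2n}\sum_i g(\xi_XJe_i,e_i),$$ so that $\xi_XY=\xi^{U(n)}_XY+\eta(JX)JY$. Let $\xi^{U(n)}=\sum_{k=1}^4\xi^{U(n),k}$ be the decomposition according to the Gray–Hervella splitting $T^*M\otimes\mathfrak u(n)^\perp=\mathcal W_1\oplus\mathcal W_2\oplus\mathcal W_3\oplus\mathcal W_4$, where, inside $T^*M\otimes\mathfrak u(n)^\perp$, - $\mathcal W_1$: $\xi_XY=-\xi_YX$; - $\mathcal W_2$: $g(\xi_XY,Z)+g(\xi_ZX,Y)+g(\xi_YZ,X)=0$; - $\mathcal W_3$: $\xi_XY=\xi_{JX}JY$ and $\sum_i\xi_{e_i}e_i=0$; - $\mathcal W_4$: $-4\xi_XY=\theta(Y)X+\theta(JY)JX-g(X,Y)\theta^\sharp-g(X,JY)J\theta^\sharp$ for some one-form $\theta$. Put $\xi^{U(n),12}=\xi^{U(n),1}+\xi^{U(n),2}$, $\xi^{U(n),34}=\xi^{U(n),3}+\xi^{U(n),4}$, and $|\xi|^2=\sum_{i,j}|\xi_{e_i}e_j|^2$.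 Let $\mathcal W_5$ be the space of tensors of the form $(X,Y)\mapsto\alpha(JX)JY$ with $\alpha$ a one-form. Then $s^*$, $|\xi^{U(n),12}|^2-|\xi^{U(n),34}|^2$ and $\eta(\chi^{U(n)})$ are integrable and $$\int_M s^*\,\mathrm{vol}_M=\int_M\bigl(|\xi^{U(n),12}|^2-|\xi^{U(n),34}|^2\bigr)\,\mathrm{vol}_M+4n\int_M\eta(\chi^{U(n)})\,\mathrm{vol}_M .$$ In particular, if $\xi\in\mathcal W_1\oplus\mathcal W_2\oplus\mathcal W_3\oplus\mathcal W_5$ at every point, then $|\xi^{U(n),1}|^2+|\xi^{U(n),2}|^2-|\xi^{U(n),3}|^2$ is integrable and $$\int_M s^*\,\mathrm{vol}_M=\int_M\bigl(|\xi^{U(n),1}|^2+|\xi^{U(n),2}|^2-|\xi^{U(n),3}|^2\bigr)\,\mathrm{vol}_M .$$ -/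

import Mathlib

open Bundle MeasureTheory
open scoped Manifold ContDiff

noncomputable section

namespace SUGeometry

/-! ## Linear algebra of a Euclidean vector space with a complex structure

`Eu m` is the model vector space; it carries a scalar product `b` (not necessarily the standard
one) and an endomorphism `J`.  Tensors `(X, Y) ↦ ξ_X Y` are of type `Tor m`. -/

/-- The model vector space of dimension `m`. -/
abbrev Eu (m : ℕ) : Type := EuclideanSpace ℝ (Fin m)

/-- Bilinear forms. -/
abbrev Bil (m : ℕ) : Type := Eu m →L[ℝ] Eu m →L[ℝ] ℝ

/-- `(1,2)`-tensors `ξ`, where `ξ X` is the endomorphism `ξ_X`. -/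
abbrev Tor (m : ℕ) : Type := Eu m →ₗ[ℝ] Module.End ℝ (Eu m)

/-- `e` is an orthonormal basis for the scalar product `b`. -/
def IsOrthonormalFrame {m : ℕ} (b : Bil m) (e : Fin m → Eu m) : Prop :=
  ∀ i j, b (e i) (e j) = if i = j then 1 else 0

/-- An orthonormal basis for the scalar product `b`, chosen arbitrarily; all the traces formed
with it below are independent of the choice. -/
def frame {m : ℕ} (b : Bil m) : Fin m → Eu m :=
  Classical.epsilon (IsOrthonormalFrame b)

theorem exists_isOrthonormalFrame {m : ℕ} (b : Bil m) (hs : ∀ v w, b v w = b w v)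
    (hp : ∀ v, v ≠ 0 → 0 < b v v) : ∃ e, IsOrthonormalFrame b e := by
  let B : LinearMap.BilinForm ℝ (Eu m) :=
    LinearMap.mk₂ ℝ (fun v w => b v w) (by simp) (by simp) (by simp) (by simp)
  have hB : ∀ v w, B v w = b v w := fun v w => rfl
  have hsym : LinearMap.IsSymm B := ⟨fun v w => by simp [hB, hs v w]⟩
  obtain ⟨v, hv⟩ := LinearMap.BilinForm.exists_orthogonal_basis hsym
  have hm : Module.finrank ℝ (Eu m) = m := by simp
  let f : Fin m → Eu m := fun i => v (finCongr hm.symm i)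
  have hf0 : ∀ i, 0 < b (f i) (f i) := fun i => hp _ (v.ne_zero _)
  have hf : ∀ i j, i ≠ j → b (f i) (f j) = 0 := by
    intro i j hij
    have := hv (i := finCongr hm.symm i) (j := finCongr hm.symm j)
      (by simpa using hij)
    exact this
  refine ⟨fun i => (Real.sqrt (b (f i) (f i)))⁻¹ • f i, fun i j => ?_⟩
  by_cases h : i = j
  · subst h
    have h1 := Real.mul_self_sqrt (hf0 i).le
    have h2 : Real.sqrt (b (f i) (f i)) ≠ 0 := (Real.sqrt_pos.mpr (hf0 i)).ne'
    simp only [map_smul, smul_apply, smul_eq_mul, if_true]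
    field_simp
    nlinarith
  · simp [h, hf i j h]

theorem isOrthonormalFrame_frame {m : ℕ} (b : Bil m) (hs : ∀ v w, b v w = b w v)
    (hp : ∀ v, v ≠ 0 → 0 < b v v) : IsOrthonormalFrame b (frame b) :=
  Classical.epsilon_spec (exists_isOrthonormalFrame b hs hp)

/-- The Lie algebra `so` of the scalar product `b`. -/
def so {m : ℕ} (b : Bil m) : Submodule ℝ (Module.End ℝ (Eu m)) where
  carrier := {A | ∀ v w, b (A v) w = -b v (A w)}
  add_mem' {A B} hA hB v w := by
    have h1 := hA v w
    have h2 := hB v w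
    simp only [LinearMap.add_apply, map_add, add_apply]
    linarith
  zero_mem' v w := by simp
  smul_mem' c A hA v w := by
    have h1 := hA v w
    simp only [LinearMap.smul_apply, map_smul, smul_apply, smul_eq_mul]
    rw [h1]; ring

/-- The Lie algebra `u = {A ∈ so | A J = J A}`. -/
def u {m : ℕ} (b : Bil m) (J : Module.End ℝ (Eu m)) : Submodule ℝ (Module.End ℝ (Eu m)) where
  carrier := {A | A ∈ so b ∧ A * J = J * A}
  add_mem' {A B} hA hB := ⟨add_mem hA.1 hB.1, by rw [add_mul, mul_add, hA.2, hB.2]⟩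
  zero_mem' := ⟨zero_mem _, by simp⟩
  smul_mem' c A hA := ⟨Submodule.smul_mem _ c hA.1, by
    rw [smul_mul_assoc, mul_smul_comm, hA.2]⟩

/-- The Lie algebra `su = {A ∈ u | tr (A J) = 0}`. -/
def su {m : ℕ} (b : Bil m) (J : Module.End ℝ (Eu m)) : Submodule ℝ (Module.End ℝ (Eu m)) where
  carrier := {A | A ∈ u b J ∧ LinearMap.trace ℝ (Eu m) (A * J) = 0}
  add_mem' {A B} hA hB := ⟨add_mem hA.1 hB.1, by rw [add_mul, map_add, hA.2, hB.2, add_zero]⟩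
  zero_mem' := ⟨zero_mem _, by simp⟩
  smul_mem' c A hA := ⟨Submodule.smul_mem _ c hA.1, by
    rw [smul_mul_assoc, map_smul, hA.2, smul_zero]⟩

/-- The orthogonal complement of `𝔤` in `so`, for the invariant form `(A, B) ↦ tr (A B)`. -/
def perp {m : ℕ} (b : Bil m) (𝔤 : Submodule ℝ (Module.End ℝ (Eu m))) :
    Submodule ℝ (Module.End ℝ (Eu m)) where
  carrier := {B | B ∈ so b ∧ ∀ A ∈ 𝔤, LinearMap.trace ℝ (Eu m) (A * B) = 0}
  add_mem' {A B} hA hB := ⟨add_mem hA.1 hB.1, fun C hC => by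
    rw [mul_add, map_add, hA.2 C hC, hB.2 C hC, add_zero]⟩
  zero_mem' := ⟨zero_mem _, by simp⟩
  smul_mem' c A hA := ⟨Submodule.smul_mem _ c hA.1, fun C hC => by
    rw [mul_smul_comm, map_smul, hA.2 C hC, smul_zero]⟩

/-- The characteristic vector `χ = ∑ i, ξ_{e_i} e_i`. -/
def chi {m : ℕ} (b : Bil m) (ξ : Tor m) : Eu m := ∑ i, ξ (frame b i) (frame b i)

/-- `|ξ|² = ∑ i j, |ξ_{e_i} e_j|²`. -/
def normSq {m : ℕ} (b : Bil m) (ξ : Tor m) : ℝ :=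
  ∑ i, ∑ j, b (ξ (frame b i) (frame b j)) (ξ (frame b i) (frame b j))

/-- The metric dual `θ♯` of a one-form. -/
def sharp {m : ℕ} (b : Bil m) (θ : Eu m →ₗ[ℝ] ℝ) : Eu m := ∑ i, θ (frame b i) • frame b i

/-- The space `T* ⊗ u^⊥` of possible intrinsic torsions of a `U(n)`-structure. -/
def uTorsionSpace {m : ℕ} (b : Bil m) (J : Module.End ℝ (Eu m)) : Submodule ℝ (Tor m) where
  carrier := {ξ | ∀ X, ξ X ∈ perp b (u b J)}
  add_mem' h1 h2 X := add_mem (h1 X) (h2 X)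
  zero_mem' _ := zero_mem _
  smul_mem' c _ h X := Submodule.smul_mem _ c (h X)

/-- The Gray-Hervella class `W₁`: `ξ_X Y = -ξ_Y X`. -/
def W1 {m : ℕ} (b : Bil m) (J : Module.End ℝ (Eu m)) : Submodule ℝ (Tor m) where
  carrier := {ξ | ξ ∈ uTorsionSpace b J ∧ ∀ X Y, ξ X Y = -ξ Y X}
  add_mem' {ξ ζ} h1 h2 := ⟨add_mem h1.1 h2.1, fun X Y => by
    simp only [LinearMap.add_apply]; rw [h1.2 X Y, h2.2 X Y]; abel⟩
  zero_mem' := ⟨zero_mem _, by simp⟩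
  smul_mem' c ξ h := ⟨Submodule.smul_mem _ c h.1, fun X Y => by
    simp only [LinearMap.smul_apply]; rw [h.2 X Y, smul_neg]⟩

/-- The Gray-Hervella class `W₂`: the cyclic sum of `g(ξ_X Y, Z)` vanishes. -/
def W2 {m : ℕ} (b : Bil m) (J : Module.End ℝ (Eu m)) : Submodule ℝ (Tor m) where
  carrier := {ξ | ξ ∈ uTorsionSpace b J ∧
    ∀ X Y Z, b (ξ X Y) Z + b (ξ Z X) Y + b (ξ Y Z) X = 0}
  add_mem' {ξ ζ} h1 h2 := ⟨add_mem h1.1 h2.1, fun X Y Z => by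
    have a1 := h1.2 X Y Z
    have a2 := h2.2 X Y Z
    simp only [LinearMap.add_apply, map_add, add_apply]; linarith⟩
  zero_mem' := ⟨zero_mem _, by simp⟩
  smul_mem' c ξ h := ⟨Submodule.smul_mem _ c h.1, fun X Y Z => by
    have a1 := h.2 X Y Z
    simp only [LinearMap.smul_apply, map_smul, smul_apply, smul_eq_mul]
    rw [← mul_add, ← mul_add, a1, mul_zero]⟩

/-- The Gray-Hervella class `W₃`: `ξ_X Y = ξ_{JX} (JY)` and `χ = 0`. -/
def W3 {m : ℕ} (b : Bil m) (J : Module.End ℝ (Eu m)) : Submodule ℝ (Tor m) where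
  carrier := {ξ | ξ ∈ uTorsionSpace b J ∧ (∀ X Y, ξ X Y = ξ (J X) (J Y)) ∧ chi b ξ = 0}
  add_mem' {ξ ζ} h1 h2 := ⟨add_mem h1.1 h2.1,
    fun X Y => by simp only [LinearMap.add_apply]; rw [h1.2.1 X Y, h2.2.1 X Y],
    by
      have a1 := h1.2.2
      have a2 := h2.2.2
      simp only [chi, LinearMap.add_apply, Finset.sum_add_distrib] at a1 a2 ⊢
      rw [a1, a2, add_zero]⟩
  zero_mem' := ⟨zero_mem _, by simp, by simp [chi]⟩
  smul_mem' c ξ h := ⟨Submodule.smul_mem _ c h.1,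
    fun X Y => by simp only [LinearMap.smul_apply]; rw [h.2.1 X Y],
    by
      have a1 := h.2.2
      simp only [chi, LinearMap.smul_apply, ← Finset.smul_sum] at a1 ⊢
      rw [a1, smul_zero]⟩

/-- The Gray-Hervella class `W₄`, parametrised by the Lee form `θ`:
`-4 ξ_X Y = θ(Y) X + θ(JY) JX - g(X,Y) θ♯ - g(X,JY) Jθ♯`. -/
def W4 {m : ℕ} (b : Bil m) (J : Module.End ℝ (Eu m)) : Submodule ℝ (Tor m) where
  carrier := {ξ | ξ ∈ uTorsionSpace b J ∧ ∃ θ : Eu m →ₗ[ℝ] ℝ, ∀ X Y,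
    (-4 : ℝ) • ξ X Y = θ Y • X + θ (J Y) • J X - b X Y • sharp b θ
      - b X (J Y) • J (sharp b θ)}
  add_mem' {ξ ζ} h1 h2 := ⟨add_mem h1.1 h2.1, by
    obtain ⟨θ, hθ⟩ := h1.2
    obtain ⟨σ, hσ⟩ := h2.2
    have hs : sharp b (θ + σ) = sharp b θ + sharp b σ := by
      simp [sharp, add_smul, Finset.sum_add_distrib]
    refine ⟨θ + σ, fun X Y => ?_⟩
    simp only [LinearMap.add_apply, smul_add, hs, map_add]
    rw [hθ X Y, hσ X Y]
    module⟩
  zero_mem' := ⟨zero_mem _, 0, by simp [sharp]⟩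
  smul_mem' c ξ h := ⟨Submodule.smul_mem _ c h.1, by
    obtain ⟨θ, hθ⟩ := h.2
    have hs : sharp b (c • θ) = c • sharp b θ := by
      simp [sharp, Finset.smul_sum, mul_smul]
    refine ⟨c • θ, fun X Y => ?_⟩
    simp only [LinearMap.smul_apply, hs, map_smul]
    rw [smul_comm, hθ X Y]
    simp only [smul_eq_mul]
    module⟩

/-- The class `W₅`: tensors of the form `ξ_X Y = α(JX) JY` with a one-form `α`. -/
def W5 {m : ℕ} (J : Module.End ℝ (Eu m)) : Submodule ℝ (Tor m) where
  carrier := {ξ | ∃ α : Eu m →ₗ[ℝ] ℝ, ∀ X Y, ξ X Y = α (J X) • J Y}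
  add_mem' {ξ ζ} h1 h2 := by
    obtain ⟨α, hα⟩ := h1
    obtain ⟨β, hβ⟩ := h2
    exact ⟨α + β, fun X Y => by simp [hα, hβ, add_smul]⟩
  zero_mem' := ⟨0, by simp⟩
  smul_mem' c ξ h := by
    obtain ⟨α, hα⟩ := h
    exact ⟨c • α, fun X Y => by simp [hα, mul_smul]⟩

/-- The four Gray-Hervella classes (`W b J 0 = W₁`, …, `W b J 3 = W₄`). -/
def W {m : ℕ} (b : Bil m) (J : Module.End ℝ (Eu m)) : Fin 4 → Submodule ℝ (Tor m) :=
  ![W1 b J, W2 b J, W3 b J, W4 b J]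

/-- `c` is the decomposition `ξ = ξ¹ + ξ² + ξ³ + ξ⁴` with `ξᵏ ∈ Wₖ`. -/
def IsGHDecomposition {m : ℕ} (b : Bil m) (J : Module.End ℝ (Eu m)) (ξ : Tor m)
    (c : Fin 4 → Tor m) : Prop :=
  (∀ k, c k ∈ W b J k) ∧ ∑ k, c k = ξ

/-- The components of `ξ` in the direct sum `T* ⊗ u^⊥ = W₁ ⊕ W₂ ⊕ W₃ ⊕ W₄`; here `0, 1, 2, 3`
index the components `ξ¹, ξ², ξ³, ξ⁴`. -/
def ghComponent {m : ℕ} (b : Bil m) (J : Module.End ℝ (Eu m)) (ξ : Tor m) : Fin 4 → Tor m :=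
  Classical.epsilon (IsGHDecomposition b J ξ)

/-- The one-form `η` of the `W₅`-component of a torsion `ξ`, defined by `η_X Y = η(JX) JY`, where
`η_X Y = -(1/m) (∑ i, g(ξ_X (J e_i), e_i)) JY` and `m = 2n` is the dimension.  In other words
`η(JX) = -(1/m) ∑ i, g(ξ_X (J e_i), e_i)`, evaluated here at `-JX` in place of `X`. -/
def etaForm {m : ℕ} (b : Bil m) (J : Module.End ℝ (Eu m)) (ξ : Tor m) (X : Eu m) : ℝ :=
  -(1 / (m : ℝ)) * ∑ i, b (ξ (-J X) (J (frame b i))) (frame b i)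

/-! ## Local Riemannian geometry in an open set of the model space

`G`, `J`, `Ψ` are the coordinate expressions of a metric, an almost complex structure and a
complex-valued `n`-form; everything is evaluated at a point `p`. -/

/-- The Christoffel operator of the Levi-Civita connection: `∇_v w = Γ(v, w)` for constant fields
`v`, `w`, where `2 g(Γ(v,w), z) = v g(w,z) + w g(v,z) - z g(v,w)`. -/
def christoffel {m : ℕ} (G : Eu m → Bil m) (p : Eu m) (v w : Eu m) : Eu m :=
  ∑ k, ((1 / 2 : ℝ) * (fderiv ℝ G p v w (frame (G p) k) + fderiv ℝ G p w v (frame (G p) k)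
    - fderiv ℝ G p (frame (G p) k) v w)) • frame (G p) k

/-- The curvature `R(x,y) = [∇_x, ∇_y] - ∇_{[x,y]}` of the Levi-Civita connection, evaluated on
constant fields. -/
def curvature {m : ℕ} (G : Eu m → Bil m) (p : Eu m) (x y z : Eu m) : Eu m :=
  fderiv ℝ (fun q => christoffel G q y z) p x - fderiv ℝ (fun q => christoffel G q x z) p y
    + christoffel G p x (christoffel G p y z) - christoffel G p y (christoffel G p x z)

/-- The covariant derivative `(∇_x J) y`. -/
def covJ {m : ℕ} (G : Eu m → Bil m) (J : Eu m → Eu m →L[ℝ] Eu m) (p x y : Eu m) : Eu m :=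
  fderiv ℝ J p x y + christoffel G p x (J p y) - J p (christoffel G p x y)

/-- The covariant derivative `(∇_x Ψ)(v₁, …, vₙ)`. -/
def covForm {m n : ℕ} (G : Eu m → Bil m) (Ψ : Eu m → Eu m [⋀^Fin n]→L[ℝ] ℂ) (p x : Eu m)
    (v : Fin n → Eu m) : ℂ :=
  fderiv ℝ Ψ p x v - ∑ i, Ψ p (Function.update v i (christoffel G p x (v i)))

/-- The `*`-scalar curvature `s* = ∑ i, Ric*(e_i, e_i)`, where
`Ric*(X,Y) = ∑ j, g(R(X,e_j) Je_j, JY)`. -/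
def starScalar {m : ℕ} (G : Eu m → Bil m) (J : Eu m → Eu m →L[ℝ] Eu m) (p : Eu m) : ℝ :=
  ∑ i, ∑ j, G p (curvature G p (frame (G p) i) (frame (G p) j) (J p (frame (G p) j)))
    (J p (frame (G p) i))

/-- `ξ` is the intrinsic torsion at `p` of the `U(n)`-structure `(G, J)`: `ξ_X ∈ u(n)^⊥`, and
`∇ + ξ` is a `U(n)`-connection, i.e. `(∇ + ξ) J = 0`. -/
def IsUTorsion {m : ℕ} (G : Eu m → Bil m) (J : Eu m → Eu m →L[ℝ] Eu m) (p : Eu m)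
    (ξ : Tor m) : Prop :=
  ∀ X, ξ X ∈ perp (G p) (u (G p) (J p)) ∧
    ∀ Y, covJ G J p X Y + (ξ X (J p Y) - J p (ξ X Y)) = 0

/-- `ξ` is the intrinsic torsion at `p` of the `SU(n)`-structure `(G, J, Ψ)`: `ξ_X ∈ su(n)^⊥`, and
`∇ + ξ` is an `SU(n)`-connection, i.e. `(∇ + ξ) J = 0` and `(∇ + ξ) Ψ = 0`. -/
def IsSUTorsion {m n : ℕ} (G : Eu m → Bil m) (J : Eu m → Eu m →L[ℝ] Eu m)
    (Ψ : Eu m → Eu m [⋀^Fin n]→L[ℝ] ℂ) (p : Eu m) (ξ : Tor m) : Prop :=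
  ∀ X, ξ X ∈ perp (G p) (su (G p) (J p)) ∧
    (∀ Y, covJ G J p X Y + (ξ X (J p Y) - J p (ξ X Y)) = 0) ∧
    ∀ v : Fin n → Eu m, covForm G Ψ p X v - ∑ i, Ψ p (Function.update v i (ξ X (v i))) = 0

/-- The intrinsic torsion at `p` of the `U(n)`-structure `(G, J)`. -/
def uTorsionAt {m : ℕ} (G : Eu m → Bil m) (J : Eu m → Eu m →L[ℝ] Eu m) (p : Eu m) : Tor m :=
  Classical.epsilon (IsUTorsion G J p)

/-- The intrinsic torsion at `p` of the `SU(n)`-structure `(G, J, Ψ)`. -/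
def suTorsionAt {m n : ℕ} (G : Eu m → Bil m) (J : Eu m → Eu m →L[ℝ] Eu m)
    (Ψ : Eu m → Eu m [⋀^Fin n]→L[ℝ] ℂ) (p : Eu m) : Tor m :=
  Classical.epsilon (IsSUTorsion G J Ψ p)

/-! ## Manifolds -/

/-- Smooth Riemannian metrics on a manifold of dimension `m`. -/
abbrev Metric (m : ℕ) (M : Type*) [TopologicalSpace M] [ChartedSpace (Eu m) M]
    [IsManifold 𝓘(ℝ, Eu m) ∞ M] : Type _ :=
  ContMDiffRiemannianMetric 𝓘(ℝ, Eu m) ∞ (Eu m) (fun x : M => TangentSpace 𝓘(ℝ, Eu m) x)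

section Manifold

variable {m : ℕ} {M : Type*} [TopologicalSpace M] [ChartedSpace (Eu m) M]

/-- The differential at `y` of the inverse of the preferred chart at `x`. -/
def dChartSymm (x : M) (y : Eu m) :
    Eu m →L[ℝ] TangentSpace 𝓘(ℝ, Eu m) ((extChartAt 𝓘(ℝ, Eu m) x).symm y) :=
  mfderiv 𝓘(ℝ, Eu m) 𝓘(ℝ, Eu m) (extChartAt 𝓘(ℝ, Eu m) x).symm y

/-- The differential of the preferred chart at `x`, at the point with coordinate `y`. -/
def dChart (x : M) (y : Eu m) :
    TangentSpace 𝓘(ℝ, Eu m) ((extChartAt 𝓘(ℝ, Eu m) x).symm y) →L[ℝ] Eu m :=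
  mfderiv 𝓘(ℝ, Eu m) 𝓘(ℝ, Eu m) (extChartAt 𝓘(ℝ, Eu m) x) ((extChartAt 𝓘(ℝ, Eu m) x).symm y)

/-- The coordinate expression of a metric in the preferred chart at `x`. -/
def coordMetric [IsManifold 𝓘(ℝ, Eu m) ∞ M] (g : Metric m M) (x : M) (y : Eu m) : Bil m :=
  (dChartSymm x y).precomp ℝ ∘L g.inner ((extChartAt 𝓘(ℝ, Eu m) x).symm y) ∘L dChartSymm x y

/-- The coordinate expression of an endomorphism field in the preferred chart at `x`. -/
def coordEnd (J : ∀ x : M, TangentSpace 𝓘(ℝ, Eu m) x →L[ℝ] TangentSpace 𝓘(ℝ, Eu m) x)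
    (x : M) (y : Eu m) : Eu m →L[ℝ] Eu m :=
  dChart x y ∘L J ((extChartAt 𝓘(ℝ, Eu m) x).symm y) ∘L dChartSymm x y

/-- The coordinate expression of a complex-valued differential form in the preferred chart
at `x`. -/
def coordForm {n : ℕ} (Ψ : ∀ x : M, TangentSpace 𝓘(ℝ, Eu m) x [⋀^Fin n]→L[ℝ] ℂ)
    (x : M) (y : Eu m) : Eu m [⋀^Fin n]→L[ℝ] ℂ :=
  (Ψ ((extChartAt 𝓘(ℝ, Eu m) x).symm y)).compContinuousLinearMap (dChartSymm x y)

/-- The Riemannian volume of the domain of the preferred chart at `x`: the image under the inverse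
of the chart of the measure `√(det (g_ij)) dy¹ ⋯ dyᵐ`. -/
def chartVolume [IsManifold 𝓘(ℝ, Eu m) ∞ M] [MeasurableSpace M] (g : Metric m M) (x : M) :
    Measure M :=
  Measure.map (extChartAt 𝓘(ℝ, Eu m) x).symm
    ((volume.restrict (extChartAt 𝓘(ℝ, Eu m) x).target).withDensity fun y =>
      ENNReal.ofReal (Real.sqrt (Matrix.det (Matrix.of fun i j : Fin m =>
        coordMetric g x y (EuclideanSpace.single i 1) (EuclideanSpace.single j 1)))))

/-- The Riemannian volume measure: the least measure that dominates the Riemannian volume of each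
chart domain.  (It restricts to `chartVolume g x` on the domain of the chart at `x`.) -/
def volumeMeasure [IsManifold 𝓘(ℝ, Eu m) ∞ M] [MeasurableSpace M] (g : Metric m M) : Measure M :=
  ⨆ x : M, chartVolume g x

end Manifold

/-- A smooth `SU(n)`-structure `(g, J, Ψ)` on a manifold of dimension `2n`: an almost Hermitian
structure with a complex `(n,0)`-form `Ψ` such that `⟨Ψ, Ψ⟩ = 1`.  The Hermitian product of
`n`-forms is the usual one, `⟨Ψ, Ψ⟩ = ∑_{i₁ < ⋯ < iₙ} |Ψ(e_{i₁}, …, e_{iₙ})|²`, written as a sum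
over all the multi-indices, divided by `n!`. -/
structure SUStructure (n : ℕ) (M : Type*) [TopologicalSpace M] [ChartedSpace (Eu (2 * n)) M]
    [IsManifold 𝓘(ℝ, Eu (2 * n)) ∞ M] where
  /-- the metric -/
  g : Metric (2 * n) M
  /-- the almost complex structure -/
  J : ∀ x : M, TangentSpace 𝓘(ℝ, Eu (2 * n)) x →L[ℝ] TangentSpace 𝓘(ℝ, Eu (2 * n)) x
  /-- the complex volume form -/
  Ψ : ∀ x : M, TangentSpace 𝓘(ℝ, Eu (2 * n)) x [⋀^Fin n]→L[ℝ] ℂ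
  smooth_J : ContMDiff 𝓘(ℝ, Eu (2 * n))
    (𝓘(ℝ, Eu (2 * n)).prod 𝓘(ℝ, Eu (2 * n) →L[ℝ] Eu (2 * n))) ∞
    (fun x => TotalSpace.mk' (Eu (2 * n) →L[ℝ] Eu (2 * n))
      (E := fun x : M => TangentSpace 𝓘(ℝ, Eu (2 * n)) x →L[ℝ] TangentSpace 𝓘(ℝ, Eu (2 * n)) x)
      x (J x))
  smooth_Ψ : ∀ x : M, ContDiffOn ℝ ∞ (coordForm Ψ x) (extChartAt 𝓘(ℝ, Eu (2 * n)) x).target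
  J_sq : ∀ (x : M) (v : TangentSpace 𝓘(ℝ, Eu (2 * n)) x), J x (J x v) = -v
  J_isometry : ∀ (x : M) (v w : TangentSpace 𝓘(ℝ, Eu (2 * n)) x),
    g.inner x (J x v) (J x w) = g.inner x v w
  Ψ_type : ∀ (x : M) (v : Fin n → TangentSpace 𝓘(ℝ, Eu (2 * n)) x) (i : Fin n),
    Ψ x (Function.update v i (J x (v i))) = Complex.I * Ψ x v
  Ψ_norm : ∀ (x : M) (e : Fin (2 * n) → TangentSpace 𝓘(ℝ, Eu (2 * n)) x),
    (∀ i j, g.inner x (e i) (e j) = if i = j then 1 else 0) →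
    (1 / (n.factorial : ℝ)) * ∑ f : Fin n → Fin (2 * n), ‖Ψ x (e ∘ f)‖ ^ 2 = 1

namespace SUStructure

variable {n : ℕ} {M : Type*} [TopologicalSpace M] [ChartedSpace (Eu (2 * n)) M]
  [IsManifold 𝓘(ℝ, Eu (2 * n)) ∞ M] (S : SUStructure n M)

/-! The objects below live on the tangent space at `x`.  They are computed in the preferred chart
at `x`, whose differential at `x` is the identity of `TangentSpace 𝓘(ℝ, Eu (2 * n)) x`. -/

/-- The scalar product at `x`. -/
def metricAt (x : M) : Bil (2 * n) := coordMetric S.g x (extChartAt 𝓘(ℝ, Eu (2 * n)) x x)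

/-- The complex structure at `x`. -/
def complexAt (x : M) : Module.End ℝ (Eu (2 * n)) :=
  coordEnd S.J x (extChartAt 𝓘(ℝ, Eu (2 * n)) x x)

/-- The `*`-scalar curvature `s*`. -/
def sStar (x : M) : ℝ :=
  starScalar (coordMetric S.g x) (coordEnd S.J x) (extChartAt 𝓘(ℝ, Eu (2 * n)) x x)

/-- The intrinsic torsion `ξ^{U(n)}` of the underlying `U(n)`-structure. -/
def xiU (x : M) : Tor (2 * n) :=
  uTorsionAt (coordMetric S.g x) (coordEnd S.J x) (extChartAt 𝓘(ℝ, Eu (2 * n)) x x)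

/-- The intrinsic torsion `ξ` of the `SU(n)`-structure. -/
def xi (x : M) : Tor (2 * n) :=
  suTorsionAt (coordMetric S.g x) (coordEnd S.J x) (coordForm S.Ψ x)
    (extChartAt 𝓘(ℝ, Eu (2 * n)) x x)

/-- The component `ξ^{U(n),k+1}` of `ξ^{U(n)}` in the Gray-Hervella class `W_{k+1}`. -/
def xiComp (k : Fin 4) (x : M) : Tor (2 * n) :=
  ghComponent (S.metricAt x) (S.complexAt x) (S.xiU x) k

/-- `|ξ^{U(n),12}|²`, where `ξ^{U(n),12}` is the component in `W₁ ⊕ W₂`. -/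
def normSq12 (x : M) : ℝ := normSq (S.metricAt x) (S.xiComp 0 x + S.xiComp 1 x)

/-- `|ξ^{U(n),34}|²`, where `ξ^{U(n),34}` is the component in `W₃ ⊕ W₄`. -/
def normSq34 (x : M) : ℝ := normSq (S.metricAt x) (S.xiComp 2 x + S.xiComp 3 x)

/-- `η(χ^{U(n)})`: the one-form of the `W₅`-component of `ξ`, evaluated on the characteristic
vector field of the underlying `U(n)`-structure. -/
def etaChi (x : M) : ℝ :=
  etaForm (S.metricAt x) (S.complexAt x) (S.xi x) (chi (S.metricAt x) (S.xiU x))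

/-- The `SU(n)`-structure is of type `W₁ ⊕ W₂ ⊕ W₃ ⊕ W₅`. -/
def IsType1235 : Prop :=
  ∀ x, S.xi x ∈ W1 (S.metricAt x) (S.complexAt x) ⊔ W2 (S.metricAt x) (S.complexAt x) ⊔
    W3 (S.metricAt x) (S.complexAt x) ⊔ W5 (S.complexAt x)

end SUStructure

end SUGeometry

end

/-! Let ∇' = ∇ + ξ be the SU(n)-connection and put μ(X) = η(JX), so that ξ = ξ^{U(n)} + μ ⊗ J. The
curvature R' of ∇' takes values in su(n), hence tr(R'(X,Y) J) = 0. Expanding R' and using that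
ξ^{U(n)}_X anticommutes with J, one gets tr(R(X,Y) J) = 2n dμ(X,Y) + 2 tr(ξ^{U(n)}_X ξ^{U(n)}_Y J)
(`IsSUOn.ctrace_curvature`). By the first Bianchi identity, s* = ½ ∑ tr(R(e_i, Je_i) J)
(`IsHermitianOn.starScalar_eq`), so this identity is needed only for Y = JX, summed over a frame.

The quadratic term gives the norms: ξ ↦ ξ_{JX} JY is -1 on W₁ ⊕ W₂ and +1 on W₃ ⊕ W₄, and tr(A²) =
-|A|² on so, whence ∑ tr(ξ_{e_i} ξ_{Je_i} J) = |ξ¹²|² - |ξ³⁴|² (`normSq12_sub_normSq34`). The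
derivative term is a divergence up to the derivative of J: since ∑ (∇_{e_i} J) e_i = 2Jχ, one has ∑
dμ(e_i, Je_i) = -2 div η♯ + 4 η(χ) (`IsSUOn.divAt_etaField`). Together (`IsSUOn.starScalar_eq`), s*
= |ξ¹²|² - |ξ³⁴|² + 4n η(χ) - 2n div η♯, and the divergence theorem
(`SUStructure.integral_divField`) removes the last term. For type W₁ ⊕ W₂ ⊕ W₃ ⊕ W₅, χ and the
W₄-component vanish, and W₁ is orthogonal to W₂.

All calculations are made in a chart, with ∇ = d + Γ. The frames, torsions and Gray-Hervella
components are arbitrary choices; the torsions are pinned down by uniqueness, and frame sums are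
rewritten through the inverse metric, which is smooth. Changes of coordinates are isometries that
carry each ingredient of the formula to itself, so the local expressions define continuous functions
on the manifold. -/

noncomputable section

namespace SUGeometry

set_option maxSynthPendingDepth 3

/-! ## Orthonormal frames and traces -/

section Frames

variable {m : ℕ} {b : Bil m} {e : Fin m → Eu m}

/-- An orthonormal frame, as a basis. -/
def IsOrthonormalFrame.basis (he : IsOrthonormalFrame b e) : Module.Basis (Fin m) ℝ (Eu m) :=
  basisOfLinearIndependentOfCardEqFinrank' (ι := Fin m) (b := e)
    (by
      rw [Fintype.linearIndependent_iff]
      intro c hc i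
      have h := congrArg (fun v => b v (e i)) hc
      simpa [map_sum, sum_apply, he _ _] using h) (by simp)

theorem IsOrthonormalFrame.coe_basis (he : IsOrthonormalFrame b e) : ⇑he.basis = e := by
  simp [IsOrthonormalFrame.basis]

theorem IsOrthonormalFrame.repr (he : IsOrthonormalFrame b e) (v : Eu m) (i : Fin m) :
    he.basis.repr v i = b v (e i) := by
  conv_rhs => rw [← he.basis.sum_repr v]
  simp [map_sum, sum_apply, he.coe_basis, he _ _]

theorem IsOrthonormalFrame.sum_smul (he : IsOrthonormalFrame b e) (v : Eu m) :
    ∑ i, b v (e i) • e i = v := by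
  conv_rhs => rw [← he.basis.sum_repr v]
  simp [he.coe_basis, he.repr]

theorem IsOrthonormalFrame.trace_eq (he : IsOrthonormalFrame b e) (A : Module.End ℝ (Eu m)) :
    LinearMap.trace ℝ (Eu m) A = ∑ i, b (A (e i)) (e i) := by
  rw [LinearMap.trace_eq_matrix_trace ℝ he.basis, Matrix.trace]
  simp [LinearMap.toMatrix_apply, he.repr, he.coe_basis]

/-- The trace of a bilinear map does not depend on the frame. Two uses recur: with the frame `J
e_i`, to produce a sum equal to its own negative, and with the image of a frame under an isometry.
-/
theorem IsOrthonormalFrame.sum_congr {e' : Fin m → Eu m} {V : Type*} [AddCommGroup V] [Module ℝ V]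
    (hs : ∀ v w, b v w = b w v)
    (he : IsOrthonormalFrame b e) (he' : IsOrthonormalFrame b e') (β : Eu m →ₗ[ℝ] Eu m →ₗ[ℝ] V) :
    ∑ k, β (e' k) (e' k) = ∑ k, β (e k) (e k) := by
  have h1 : ∀ k, β (e' k) (e' k) =
      ∑ i, ∑ j, (b (e i) (e' k) * b (e j) (e' k)) • β (e i) (e j) := by
    intro k
    conv_lhs => rw [← he.sum_smul (e' k)]
    simp only [map_sum, map_smul, LinearMap.sum_apply, LinearMap.smul_apply, Finset.smul_sum,
      smul_smul, hs (e' k)]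
    rw [Finset.sum_comm]
    refine Finset.sum_congr rfl fun i _ => Finset.sum_congr rfl fun j _ => ?_
    rw [mul_comm]
  have h2 : ∀ i j, ∑ k, b (e i) (e' k) * b (e j) (e' k) = b (e i) (e j) := by
    intro i j
    conv_rhs => rw [← he'.sum_smul (e j)]
    simp [mul_comm]
  simp_rw [h1]
  rw [Finset.sum_comm]
  refine Finset.sum_congr rfl fun i _ => ?_
  rw [Finset.sum_comm]
  simp_rw [← Finset.sum_smul, h2, he _ _]
  simp

end Frames

/-- `b` is a scalar product and `J` is a complex structure that is orthogonal for `b`. -/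
structure IsAlmostHermitian {m : ℕ} (b : Bil m) (J : Module.End ℝ (Eu m)) : Prop where
  symm : ∀ v w, b v w = b w v
  pos : ∀ v, v ≠ 0 → 0 < b v v
  sq : ∀ v, J (J v) = -v
  iso : ∀ v w, b (J v) (J w) = b v w

/-! ### Linear algebra of a Hermitian vector space: u and its orthogonal complement -/

section Hermitian

variable {m : ℕ} {b : Bil m} {J : Module.End ℝ (Eu m)}

theorem trace_mul_J_of_anticomm {A : Module.End ℝ (Eu m)} (hA : A * J = -(J * A)) :
    LinearMap.trace ℝ (Eu m) (A * J) = 0 := by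
  have h : LinearMap.trace ℝ (Eu m) (A * J) = -LinearMap.trace ℝ (Eu m) (A * J) := by
    conv_lhs => rw [hA, map_neg, LinearMap.trace_mul_comm]
  linarith

/-- `tr (A A) = -|A|²` on `so`. -/
theorem trace_sq_of_mem_so {A : Module.End ℝ (Eu m)} (hA : A ∈ so b) {e : Fin m → Eu m}
    (he : IsOrthonormalFrame b e) :
    LinearMap.trace ℝ (Eu m) (A * A) = -∑ i, b (A (e i)) (A (e i)) := by
  rw [he.trace_eq, ← Finset.sum_neg_distrib]
  exact Finset.sum_congr rfl fun i _ => hA _ _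

theorem perp_u_le_perp_su : perp b (u b J) ≤ perp b (su b J) :=
  fun _ hA => ⟨hA.1, fun C hC => hA.2 C hC.1⟩

namespace IsAlmostHermitian

variable (H : IsAlmostHermitian b J)
include H

theorem frame : IsOrthonormalFrame b (frame b) := isOrthonormalFrame_frame b H.symm H.pos

theorem nonneg (v : Eu m) : 0 ≤ b v v := by
  by_cases h : v = 0
  · simp [h]
  · exact (H.pos v h).le

theorem eq_zero {v : Eu m} (h : b v v = 0) : v = 0 := by
  by_contra hv
  exact (H.pos v hv).ne' h

theorem ext {v w : Eu m} (h : ∀ z, b v z = b w z) : v = w := by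
  have : b (v - w) (v - w) = 0 := by simp [h]
  exact sub_eq_zero.mp (H.eq_zero this)

theorem mul_self : J * J = -1 := by
  ext1 v; simpa using H.sq v

theorem J_left (v w : Eu m) : b (J v) w = -b v (J w) := by
  rw [← H.iso v (J w), H.sq]; simp

theorem J_frame {e : Fin m → Eu m} (he : IsOrthonormalFrame b e) :
    IsOrthonormalFrame b (fun i => J (e i)) := fun i j => by rw [H.iso, he]

theorem J_mem_so : J ∈ so b := fun v w => H.J_left v w

theorem J_mem_u : J ∈ u b J := ⟨H.J_mem_so, rfl⟩

theorem trace_J_mul_J : LinearMap.trace ℝ (Eu m) (J * J) = -m := by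
  rw [H.mul_self]; simp

/-- The trace form is negative definite on so. Every uniqueness argument for the torsion rests on
this. -/
theorem eq_zero_of_trace_sq {A : Module.End ℝ (Eu m)} (hA : A ∈ so b)
    (h : LinearMap.trace ℝ (Eu m) (A * A) = 0) : A = 0 := by
  rw [trace_sq_of_mem_so hA H.frame, neg_eq_zero, Finset.sum_eq_zero_iff_of_nonneg
    (fun i _ => H.nonneg _)] at h
  refine H.frame.basis.ext fun i => ?_
  rw [H.frame.coe_basis]
  simpa using H.eq_zero (h i (Finset.mem_univ _))

/-- Conjugation by J splits so into the part commuting with J, which is u, and the anticommuting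
part. The map A ↦ A - JAJ is twice the projection to u, so for A in the complement its image is
orthogonal to A, hence to itself, and vanishes by definiteness. -/
theorem mem_perp_u_iff {A : Module.End ℝ (Eu m)} :
    A ∈ perp b (u b J) ↔ A ∈ so b ∧ A * J = -(J * A) := by
  constructor
  · rintro ⟨hA, h⟩
    refine ⟨hA, ?_⟩
    have hJ2 := H.mul_self
    have hC1 : A - J * A * J ∈ so b := by
      intro v w
      have h1 := hA v w
      have h2 : b (J (A (J v))) w = -b v (J (A (J w))) := by
        rw [H.J_left, hA, neg_neg, H.J_left]
      simp only [LinearMap.sub_apply, Module.End.mul_apply, map_sub, sub_apply]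
      linarith
    have hC : A - J * A * J ∈ u b J := by
      refine ⟨hC1, ?_⟩
      have e1 : J * A * J * J = J * A * (J * J) := by simp only [mul_assoc]
      have e2 : J * (J * A * J) = (J * J) * A * J := by simp only [mul_assoc]
      rw [sub_mul, mul_sub, e1, e2, hJ2]
      simp only [mul_neg, mul_one, neg_mul, one_mul]
      abel
    have h0 := h _ hC
    have h1 : LinearMap.trace ℝ (Eu m) ((A - J * A * J) * (A - J * A * J)) = 0 := by
      have hT : LinearMap.trace ℝ (Eu m) ((A - J * A * J) * (J * A * J))
          = -LinearMap.trace ℝ (Eu m) ((A - J * A * J) * A) := by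
        have e3 : (A - J * A * J) * (J * A * J) = J * ((A - J * A * J) * A * J) := by
          rw [← mul_assoc, ← mul_assoc, hC.2]
          simp only [mul_assoc]
        have e4 : ((A - J * A * J) * A * J) * J = -((A - J * A * J) * A) := by
          rw [mul_assoc, hJ2]; simp
        rw [e3, LinearMap.trace_mul_comm, e4, map_neg]
      rw [mul_sub, map_sub, hT, h0]; simp
    have h2 := H.eq_zero_of_trace_sq hC1 h1
    have h3 : A * J = (J * A * J) * J := by rw [← sub_eq_zero, ← sub_mul, h2, zero_mul]
    rw [h3, mul_assoc, hJ2]; simp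
  · rintro ⟨hA, h⟩
    refine ⟨hA, fun C hC => ?_⟩
    have h1 : C * A = -(C * A * (J * J)) := by rw [H.mul_self]; simp
    have h2 : LinearMap.trace ℝ (Eu m) (C * A * (J * J)) = LinearMap.trace ℝ (Eu m) (C * A) := by
      rw [← mul_assoc, LinearMap.trace_mul_comm]
      have e : J * (C * A * J) = C * A := by
        rw [mul_assoc, h, ← mul_assoc, ← hC.2, mul_assoc, mul_neg, ← mul_assoc J, H.mul_self]
        simp
      rw [e]
    have h3 := congrArg (LinearMap.trace ℝ (Eu m)) h1
    rw [map_neg, h2] at h3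
    linarith

theorem J_mem_perp_su : J ∈ perp b (su b J) := ⟨H.J_mem_so, fun _ hA => hA.2⟩

end IsAlmostHermitian

end Hermitian

/-! ## The Gray-Hervella decomposition -/

section GrayHervella

variable {m : ℕ} {b : Bil m} {J : Module.End ℝ (Eu m)} {ξ : Tor m}

theorem bil_neg_left (b : Bil m) (v w : Eu m) : b (-v) w = -b v w := by simp

theorem bil_neg_right (b : Bil m) (v w : Eu m) : b v (-w) = -b v w := by simp

namespace IsAlmostHermitian

variable (H : IsAlmostHermitian b J)
include H

theorem mem_uTorsionSpace_iff : ξ ∈ uTorsionSpace b J ↔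
    (∀ X Y Z, b (ξ X Y) Z = -b Y (ξ X Z)) ∧ ∀ X Y, ξ X (J Y) = -J (ξ X Y) := by
  constructor
  · intro h
    refine ⟨fun X => (H.mem_perp_u_iff.mp (h X)).1, fun X Y => ?_⟩
    simpa using LinearMap.congr_fun (H.mem_perp_u_iff.mp (h X)).2 Y
  · rintro ⟨h1, h2⟩ X
    exact H.mem_perp_u_iff.mpr ⟨h1 X, LinearMap.ext fun Y => by simpa using h2 X Y⟩

/-- In the form `φ(X, Y, Z) = g(ξ_X Y, Z)`, the complex structure may be moved from the second
argument to the third. -/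
theorem torsion_J (h : ξ ∈ uTorsionSpace b J) (X Y Z : Eu m) :
    b (ξ X (J Y)) Z = b (ξ X Y) (J Z) := by
  rw [(H.mem_uTorsionSpace_iff.mp h).2, map_neg, neg_apply, H.J_left, neg_neg]

theorem torsion_skew (h : ξ ∈ uTorsionSpace b J) (X Y Z : Eu m) :
    b (ξ X Y) Z = -b (ξ X Z) Y := by
  rw [(H.mem_uTorsionSpace_iff.mp h).1, H.symm]

/-- J is carried around by alternating two moves: from the second to the third argument of g(ξ_X Y,
Z), and exchanging the first two arguments up to sign. -/
theorem W1_type (h : ξ ∈ W1 b J) (X Y : Eu m) : ξ (J X) (J Y) = -ξ X Y := by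
  refine H.ext fun Z => ?_
  have hu := h.1
  have e1 := H.torsion_J hu (J X) Y Z
  have e2 := congrArg (fun v => b v (J Z)) (h.2 (J X) Y)
  have e3 := H.torsion_J hu Y X (J Z)
  have e4 := congrArg (fun v => b v Z) (h.2 X Y)
  simp only [map_neg, neg_apply, H.sq] at e1 e2 e3 e4 ⊢
  linarith

theorem W2_type (h : ξ ∈ W2 b J) (X Y : Eu m) : ξ (J X) (J Y) = -ξ X Y := by
  have hu := h.1
  -- For S(X,Y,Z) = g(ξ_X Y + ξ_{JX} JY, Z) this says S(X,Y,Z) = -S(Y,Z,X). Three cyclic shifts give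
  -- S = -S, so S = 0.
  have key : ∀ X Y Z, (b (ξ X Y) Z + b (ξ (J X) (J Y)) Z)
      + (b (ξ Y Z) X + b (ξ (J Y) (J Z)) X) = 0 := by
    intro X Y Z
    have c1 := h.2 X Y Z
    have c2 := h.2 (J X) (J Y) Z
    have e1 := H.torsion_J hu Z X (J Y)
    have e2 := H.torsion_J hu (J Y) Z X
    simp only [map_neg, H.sq] at e1
    linarith
  refine H.ext fun Z => ?_
  have a1 := key X Y Z
  have a2 := key Y Z X
  have a3 := key Z X Y
  rw [bil_neg_left]
  linarith

theorem W4_type (h : ξ ∈ W4 b J) (X Y : Eu m) : ξ (J X) (J Y) = ξ X Y := by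
  obtain ⟨θ, hθ⟩ := h.2
  have h1 := hθ (J X) (J Y)
  rw [H.sq, H.sq, H.iso, map_neg, bil_neg_right, H.J_left] at h1
  have h2 := hθ X Y
  have h3 : (-4 : ℝ) • ξ (J X) (J Y) = (-4 : ℝ) • ξ X Y := by
    rw [h1, h2]; module
  exact smul_right_injective _ (by norm_num : (-4 : ℝ) ≠ 0) h3

/-- The difference of the two parts `ξ¹²` and `ξ³⁴` in the square norm is a trace. -/
theorem normSq_sub_normSq {α β : Tor m} (hα : α ∈ uTorsionSpace b J) (hβ : β ∈ uTorsionSpace b J)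
    (h12 : ∀ X Y, α (J X) (J Y) = -α X Y) (h34 : ∀ X Y, β (J X) (J Y) = β X Y) :
    normSq b α - normSq b β = ∑ i, LinearMap.trace ℝ (Eu m)
      ((α + β) (SUGeometry.frame b i) * (α + β) (J (SUGeometry.frame b i)) * J) := by
  rw [normSq, normSq, ← Finset.sum_sub_distrib]
  refine Finset.sum_congr rfl fun i _ => ?_
  set e := SUGeometry.frame b i
  have h1 : (α + β) (J e) * J = -α e + β e := LinearMap.ext fun Y => by
    simp [h12, h34]
  have h2 := trace_sq_of_mem_so (hα e).1 H.frame
  have h3 := trace_sq_of_mem_so (hβ e).1 H.frame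
  have h4 := LinearMap.trace_mul_comm ℝ (α e) (β e)
  rw [mul_assoc, h1]
  simp only [LinearMap.add_apply, add_mul, mul_add, mul_neg, map_add, map_neg]
  linarith

/-- Computing χ in the frame `J e_i` changes its sign. -/
theorem chi_eq_zero_of_type (h : ∀ X Y, ξ (J X) (J Y) = -ξ X Y) : chi b ξ = 0 := by
  have h1 := H.frame.sum_congr H.symm (H.J_frame H.frame) ξ
  simp only [h, Finset.sum_neg_distrib] at h1
  have h2 : (2 : ℝ) • chi b ξ = 0 := by rw [two_smul]; nth_rewrite 1 [chi]; rw [← h1]; simp [chi]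
  exact (smul_eq_zero.mp h2).resolve_left two_ne_zero

theorem sharp_spec (θ : Eu m →ₗ[ℝ] ℝ) (v : Eu m) : b (sharp b θ) v = θ v := by
  conv_rhs => rw [← H.frame.sum_smul v]
  simp [sharp, H.symm v, mul_comm]

/-- The Lee form is determined by χ unless m = 2. That case must be treated separately wherever this
is inverted. -/
theorem chi_W4 {θ : Eu m →ₗ[ℝ] ℝ} (hθ : ∀ X Y,
    (-4 : ℝ) • ξ X Y = θ Y • X + θ (J Y) • J X - b X Y • sharp b θ
      - b X (J Y) • J (sharp b θ)) :
    (-4 : ℝ) • chi b ξ = (2 - m : ℝ) • sharp b θ := by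
  have h0 := H.frame.sum_congr H.symm (H.J_frame H.frame)
    (LinearMap.mk₂ ℝ (fun X Y : Eu m => θ Y • X) (by intros; simp)
      (by intros; simp [smul_smul, mul_comm])
      (by intros; simp [add_smul]) (by intros; simp [mul_smul]))
  simp only [LinearMap.mk₂_apply] at h0
  have h1 : ∀ v, b v (J v) = 0 := fun v => by
    have := H.J_left v v
    rw [H.symm] at this
    linarith
  rw [chi, Finset.smul_sum]
  simp only [hθ, Finset.sum_add_distrib, Finset.sum_sub_distrib, h0, h1, H.frame _ _]
  simp only [if_true, one_smul, zero_smul, Finset.sum_const_zero, Finset.sum_const,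
    Finset.card_univ, Fintype.card_fin, ← Nat.cast_smul_eq_nsmul ℝ]
  change sharp b θ + sharp b θ - _ - _ = _
  module

/-- In dimension 2, u is all of so: A v is orthogonal to both v and J v, which form a basis. This
covers the dimension in which the factor 2 - m of `chi_W4` vanishes. -/
theorem perp_u_two (hm : m = 2) {A : Module.End ℝ (Eu m)} (hA : A ∈ perp b (u b J)) : A = 0 := by
  subst hm
  obtain ⟨h1, h2⟩ := H.mem_perp_u_iff.mp hA
  have hJ : ∀ v, b v (J v) = 0 := fun v => by
    have := H.J_left v v
    rw [H.symm] at this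
    linarith
  refine H.frame.basis.ext fun i => ?_
  rw [H.frame.coe_basis]
  set v := SUGeometry.frame b i
  have hv : b v v = 1 := by simpa using H.frame i i
  have hf : IsOrthonormalFrame b ![v, J v] := by
    intro i j
    fin_cases i <;> fin_cases j <;> simp [hv, hJ, H.iso, H.J_left]
  have a1 : b (A v) v = 0 := by
    have := h1 v v
    rw [H.symm v] at this
    linarith
  have a2 : b (A v) (J v) = 0 := by
    have e1 := h1 v (J v)
    have e2 := LinearMap.congr_fun h2 v
    simp only [Module.End.mul_apply, LinearMap.neg_apply] at e2
    rw [e2, map_neg, H.symm v, H.J_left] at e1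
    linarith
  rw [← hf.sum_smul (A v)]
  simp [a1, a2]

/-- The W₁-part is the total antisymmetrization of g(ξ_X Y, Z). As this form is already skew in Y
and Z, one third of its cyclic sum does it, and the remainder has vanishing cyclic sum. -/
theorem exists_decomposition12 (h : ξ ∈ uTorsionSpace b J)
    (ht : ∀ X Y, ξ (J X) (J Y) = -ξ X Y) : ∃ α ∈ W1 b J, ∃ β ∈ W2 b J, α + β = ξ := by
  -- `S` is the tensor with g(S_X Y, Z) = g(ξ_Z X, Y); it turns a cyclic rotation of the trilinear
  -- form back into a vector-valued tensor.
  let S : Tor m := LinearMap.mk₂ ℝ (fun X Y => sharp b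
      (LinearMap.mk₂ ℝ (fun Z W : Eu m => b (ξ Z X) W) (by intros; simp) (by intros; simp)
        (by intros; simp) (by intros; simp) |>.flip Y))
    (by intros; refine H.ext fun Z => ?_; simp [H.sharp_spec])
    (by intros; refine H.ext fun Z => ?_; simp [H.sharp_spec])
    (by intros; refine H.ext fun Z => ?_; simp [H.sharp_spec])
    (by intros; refine H.ext fun Z => ?_; simp [H.sharp_spec])
  have hS : ∀ X Y Z, b (S X Y) Z = b (ξ Z X) Y := fun X Y Z => by simp [S, H.sharp_spec]
  have hJ1 : ∀ X Y, ξ (J X) Y = ξ X (J Y) := fun X Y => by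
    have := ht X (J Y)
    rwa [H.sq, map_neg, neg_inj] at this
  let α : Tor m := (1 / 3 : ℝ) • (ξ - ξ.flip + S)
  have hα : ∀ X Y Z, b (α X Y) Z = (1 / 3) * (b (ξ X Y) Z + b (ξ Y Z) X + b (ξ Z X) Y) := by
    intro X Y Z
    have := H.torsion_skew h Y X Z
    simp only [α, LinearMap.smul_apply, LinearMap.add_apply, LinearMap.sub_apply,
      LinearMap.flip_apply, map_smul, map_add, map_sub, smul_apply, add_apply, sub_apply, hS,
      smul_eq_mul]
    rw [this]; ring
  have hαu : α ∈ uTorsionSpace b J := by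
    rw [H.mem_uTorsionSpace_iff]
    refine ⟨fun X Y Z => ?_, fun X Y => H.ext fun Z => ?_⟩
    · rw [H.symm Y, hα, hα, H.torsion_skew h X Z Y, H.torsion_skew h Z Y X,
        H.torsion_skew h Y X Z]
      ring
    · rw [bil_neg_left, H.J_left, neg_neg, hα, hα, hJ1, hJ1, H.torsion_J h X, H.torsion_J h Z]
  have hα1 : α ∈ W1 b J := ⟨hαu, fun X Y => H.ext fun Z => by
    rw [bil_neg_left, hα, hα, H.torsion_skew h X Y, H.torsion_skew h Z Y X,
        H.torsion_skew h Y X Z]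
    ring⟩
  refine ⟨α, hα1, ξ - α, ⟨sub_mem h hαu, fun X Y Z => ?_⟩, by abel⟩
  simp only [LinearMap.sub_apply, map_sub, sub_apply, hα]
  ring

/-- The W₄-tensor with the same χ as ξ is subtracted; what remains has χ = 0 and lies in W₃. -/
theorem exists_decomposition34 (h : ξ ∈ uTorsionSpace b J)
    (ht : ∀ X Y, ξ (J X) (J Y) = ξ X Y) : ∃ α ∈ W3 b J, ∃ β ∈ W4 b J, α + β = ξ := by
  by_cases hm : m = 2
  · refine ⟨0, zero_mem _, 0, zero_mem _, ?_⟩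
    ext1 X
    simp [H.perp_u_two hm (h X)]
  have hm' : (2 - m : ℝ) ≠ 0 := by
    rw [sub_ne_zero]; exact_mod_cast Ne.symm hm
  -- This is the vector θ♯ obtained by solving the equation of `chi_W4` for a prescribed χ.
  let T : Eu m := (-4 / (2 - m) : ℝ) • chi b ξ
  let θ : Eu m →ₗ[ℝ] ℝ := (b T : Eu m →ₗ[ℝ] ℝ)
  have hθ : ∀ v, θ v = b T v := fun v => rfl
  have hT : sharp b θ = T := H.ext fun Z => by rw [H.sharp_spec, hθ]
  let β : Tor m := LinearMap.mk₂ ℝ (fun X Y => (-1 / 4 : ℝ) • (θ Y • X + θ (J Y) • J X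
      - b X Y • T - b X (J Y) • J T))
    (by intros; simp only [map_add, add_apply]; module)
    (by intros; simp only [map_smul, smul_apply, smul_eq_mul]; module)
    (by intros; simp only [map_add]; module)
    (by intros; simp only [map_smul, smul_eq_mul]; module)
  have hβ : ∀ X Y, β X Y = (-1 / 4 : ℝ) • (θ Y • X + θ (J Y) • J X
      - b X Y • T - b X (J Y) • J T) := fun X Y => rfl
  have hβ4 : ∀ X Y, (-4 : ℝ) • β X Y = θ Y • X + θ (J Y) • J X - b X Y • sharp b θ
      - b X (J Y) • J (sharp b θ) := fun X Y => by
    rw [hβ, hT, smul_smul]; norm_num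
  have hβu : β ∈ uTorsionSpace b J := by
    rw [H.mem_uTorsionSpace_iff]
    refine ⟨fun X Y Z => ?_, fun X Y => ?_⟩
    · rw [H.symm Y]
      simp only [hβ, hθ, map_smul, smul_apply, map_sub, sub_apply, map_add, add_apply,
        smul_eq_mul, H.J_left]
      ring
    · simp only [hβ, map_smul, map_sub, map_add, H.sq, map_neg]
      module
  have hβ4' : β ∈ W4 b J := ⟨hβu, θ, hβ4⟩
  have hχ : chi b β = chi b ξ := by
    have h1 := H.chi_W4 hβ4
    rw [hT] at h1
    have h2 : (-4 : ℝ) • chi b β = (-4 : ℝ) • chi b ξ := by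
      rw [h1, smul_smul]; congr 1; field_simp
    exact smul_right_injective _ (by norm_num : (-4 : ℝ) ≠ 0) h2
  refine ⟨ξ - β, ⟨sub_mem h hβu, fun X Y => ?_, ?_⟩, β, hβ4', by abel⟩
  · simp [ht, H.W4_type hβ4']
  · simp only [chi, LinearMap.sub_apply, Finset.sum_sub_distrib] at hχ ⊢
    rw [hχ, sub_self]

/-- The involution ξ ↦ ξ_{J·} J· preserves the torsion space. Its -1 eigenspace is split into W₁ and
W₂, its +1 eigenspace into W₃ and W₄. -/
theorem exists_decomposition (h : ξ ∈ uTorsionSpace b J) : ∃ c, IsGHDecomposition b J ξ c := by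
  obtain ⟨h1, h2⟩ := H.mem_uTorsionSpace_iff.mp h
  have hζ : ξ.compl₁₂ J J ∈ uTorsionSpace b J := by
    rw [H.mem_uTorsionSpace_iff]
    refine ⟨fun X Y Z => ?_, fun X Y => by simp [h2]⟩
    simp only [LinearMap.compl₁₂_apply]
    rw [h1, h2, bil_neg_right, H.J_left]
  obtain ⟨α, hα, β, hβ, e1⟩ := H.exists_decomposition12
    (ξ := (1 / 2 : ℝ) • (ξ - ξ.compl₁₂ J J)) (Submodule.smul_mem _ _ (sub_mem h hζ))
    (fun X Y => by simp [H.sq]; module)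
  obtain ⟨γ, hγ, δ, hδ, e2⟩ := H.exists_decomposition34
    (ξ := (1 / 2 : ℝ) • (ξ + ξ.compl₁₂ J J)) (Submodule.smul_mem _ _ (add_mem h hζ))
    (fun X Y => by simp [H.sq]; module)
  refine ⟨![α, β, γ, δ], fun k => ?_, ?_⟩
  · fin_cases k
    exacts [hα, hβ, hγ, hδ]
  · simp only [Fin.sum_univ_four]
    change α + β + γ + δ = ξ
    rw [add_assoc, e1, e2]
    module

theorem ghComponent_spec (h : ξ ∈ uTorsionSpace b J) :
    IsGHDecomposition b J ξ (ghComponent b J ξ) :=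
  Classical.epsilon_spec (H.exists_decomposition h)

/-- `|ξ¹²|² - |ξ³⁴|²` as a trace. -/
theorem normSq12_sub_normSq34 (h : ξ ∈ uTorsionSpace b J) :
    normSq b (ghComponent b J ξ 0 + ghComponent b J ξ 1)
      - normSq b (ghComponent b J ξ 2 + ghComponent b J ξ 3) =
    ∑ i, LinearMap.trace ℝ (Eu m)
      (ξ (SUGeometry.frame b i) * ξ (J (SUGeometry.frame b i)) * J) := by
  obtain ⟨h1, h2⟩ := H.ghComponent_spec h
  have m1 : ghComponent b J ξ 0 ∈ W1 b J := h1 0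
  have m2 : ghComponent b J ξ 1 ∈ W2 b J := h1 1
  have m3 : ghComponent b J ξ 2 ∈ W3 b J := h1 2
  have m4 : ghComponent b J ξ 3 ∈ W4 b J := h1 3
  rw [H.normSq_sub_normSq (add_mem m1.1 m2.1) (add_mem m3.1 m4.1)
    (fun X Y => by simp only [LinearMap.add_apply, H.W1_type m1, H.W2_type m2]; abel)
    (fun X Y => by simp only [LinearMap.add_apply, ← m3.2.1 X Y, H.W4_type m4])]
  rw [Fin.sum_univ_four, add_assoc] at h2
  rw [h2]

/-- An element of W₁ is totally antisymmetric as a trilinear form, hence invariant under cyclic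
rotation, while the cyclic sum of an element of W₂ is zero. So the terms `Q` of the scalar product
cancel over each cyclic orbit of indices. -/
theorem normSq_add_of_mem_W1_W2 {α β : Tor m} (hα : α ∈ W1 b J) (hβ : β ∈ W2 b J) :
    normSq b (α + β) = normSq b α + normSq b β := by
  set e := SUGeometry.frame b
  let Q : Fin m → Fin m → Fin m → ℝ := fun i j k =>
    b (α (e i) (e j)) (e k) * b (β (e i) (e j)) (e k)
  have hQ : ∑ i, ∑ j, b (α (e i) (e j)) (β (e i) (e j)) = ∑ i, ∑ j, ∑ k, Q i j k := by
    refine Finset.sum_congr rfl fun i _ => Finset.sum_congr rfl fun j _ => ?_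
    conv_lhs => rw [← H.frame.sum_smul (β (e i) (e j))]
    simp only [map_sum, map_smul, smul_eq_mul, Q]
    exact Finset.sum_congr rfl fun k _ => mul_comm _ _
  have hc : ∀ i j k, Q i j k + Q k i j + Q j k i = 0 := by
    intro i j k
    have t1 : b (α (e k) (e i)) (e j) = b (α (e i) (e j)) (e k) := by
      rw [hα.2, map_neg, neg_apply, H.torsion_skew hα.1, neg_neg]
    have t2 : b (α (e j) (e k)) (e i) = b (α (e i) (e j)) (e k) := by
      rw [H.torsion_skew hα.1, hα.2, map_neg, neg_apply, neg_neg]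
    have := hβ.2 (e i) (e j) (e k)
    simp only [Q, t1, t2]
    rw [← mul_add, ← mul_add, this, mul_zero]
  have r1 : ∑ i, ∑ j, ∑ k, Q k i j = ∑ i, ∑ j, ∑ k, Q i j k := by
    conv_lhs => enter [2, i]; rw [Finset.sum_comm]
    rw [Finset.sum_comm]
  have r2 : ∑ i, ∑ j, ∑ k, Q j k i = ∑ i, ∑ j, ∑ k, Q i j k := by
    rw [Finset.sum_comm]
    refine Finset.sum_congr rfl fun i _ => ?_
    rw [Finset.sum_comm]
  have hQ0 : ∑ i, ∑ j, ∑ k, Q i j k = 0 := by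
    have h3 : ∑ i, ∑ j, ∑ k, (Q i j k + Q k i j + Q j k i) = 0 := by simp [hc]
    simp only [Finset.sum_add_distrib, r1, r2] at h3
    linarith
  have hx : ∀ i j, b ((α + β) (e i) (e j)) ((α + β) (e i) (e j)) = b (α (e i) (e j)) (α (e i) (e j))
      + b (β (e i) (e j)) (β (e i) (e j)) + 2 * b (α (e i) (e j)) (β (e i) (e j)) := by
    intro i j
    simp only [LinearMap.add_apply, map_add, add_apply, H.symm (β _ _) (α _ _)]
    ring
  rw [normSq, normSq, normSq]
  simp only [hx, e, Finset.sum_add_distrib, ← Finset.mul_sum]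
  rw [hQ, hQ0]; ring

/-- The components of a torsion of type `W₁ ⊕ W₂ ⊕ W₃`. -/
theorem normSq_of_mem_W123 (h : ξ ∈ W1 b J ⊔ W2 b J ⊔ W3 b J) : chi b ξ = 0 ∧
    normSq b (ghComponent b J ξ 0) + normSq b (ghComponent b J ξ 1)
      - normSq b (ghComponent b J ξ 2) =
    normSq b (ghComponent b J ξ 0 + ghComponent b J ξ 1)
      - normSq b (ghComponent b J ξ 2 + ghComponent b J ξ 3) := by
  obtain ⟨a12, h12, a3, h3, rfl⟩ := Submodule.mem_sup.mp h
  obtain ⟨a1, h1, a2, h2, rfl⟩ := Submodule.mem_sup.mp h12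
  have hu : a1 + a2 + a3 ∈ uTorsionSpace b J := add_mem (add_mem h1.1 h2.1) h3.1
  set ξ := a1 + a2 + a3 with hξ
  obtain ⟨hc1, hc2⟩ := H.ghComponent_spec hu
  have m1 : ghComponent b J ξ 0 ∈ W1 b J := hc1 0
  have m2 : ghComponent b J ξ 1 ∈ W2 b J := hc1 1
  have m3 : ghComponent b J ξ 2 ∈ W3 b J := hc1 2
  have m4 : ghComponent b J ξ 3 ∈ W4 b J := hc1 3
  rw [Fin.sum_univ_four] at hc2
  have chi_add : ∀ α β : Tor m, chi b (α + β) = chi b α + chi b β := fun α β => by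
    simp [chi, Finset.sum_add_distrib]
  -- Adding ξ_X Y and ξ_{JX} JY kills the W₁ and W₂ parts and doubles the others, so the sums of the
  -- W₃ and W₄ parts agree in both decompositions.
  have h34 : ghComponent b J ξ 2 + ghComponent b J ξ 3 = a3 := by
    have e : ∀ X Y, (2 : ℝ) • (ghComponent b J ξ 2 + ghComponent b J ξ 3) X Y
        = (2 : ℝ) • a3 X Y := by
      intro X Y
      have e1 := LinearMap.congr_fun (LinearMap.congr_fun hc2 X) Y
      have e2 := LinearMap.congr_fun (LinearMap.congr_fun hc2 (J X)) (J Y)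
      simp only [hξ, LinearMap.add_apply] at e1 e2 ⊢
      rw [H.W1_type m1, H.W2_type m2, ← m3.2.1, H.W4_type m4, H.W1_type h1, H.W2_type h2,
        ← h3.2.1] at e2
      linear_combination (norm := module) e1 + e2
    ext1 X; ext1 Y
    exact smul_right_injective _ (by norm_num : (2 : ℝ) ≠ 0) (e X Y)
  have hχ4 : chi b (ghComponent b J ξ 3) = 0 := by
    have := chi_add (ghComponent b J ξ 2) (ghComponent b J ξ 3)
    rw [h34, h3.2.2, m3.2.2, zero_add] at this
    exact this.symm
  -- The W₄-component has χ = 0, so its Lee form vanishes by `chi_W4`.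
  have h4 : ghComponent b J ξ 3 = 0 := by
    by_cases hm : m = 2
    · ext1 X
      exact H.perp_u_two hm (m4.1 X)
    have hm' : (2 - m : ℝ) ≠ 0 := by
      rw [sub_ne_zero]; exact_mod_cast Ne.symm hm
    obtain ⟨θ, hθ⟩ := m4.2
    have e1 := H.chi_W4 hθ
    rw [hχ4, smul_zero] at e1
    have e2 : sharp b θ = 0 := (smul_eq_zero.mp e1.symm).resolve_left hm'
    have e3 : ∀ v, θ v = 0 := fun v => by rw [← H.sharp_spec, e2]; simp
    ext1 X; ext1 Y
    have := hθ X Y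
    simp only [e2, e3, zero_smul, smul_zero, map_zero, add_zero, sub_zero] at this
    exact (smul_eq_zero.mp this).resolve_left (by norm_num)
  refine ⟨?_, ?_⟩
  · rw [chi_add, chi_add, h3.2.2, H.chi_eq_zero_of_type (H.W1_type h1),
      H.chi_eq_zero_of_type (H.W2_type h2)]
    simp
  · rw [h4, add_zero, H.normSq_add_of_mem_W1_W2 m1 m2]

/-- The `U(n)`-part of a torsion of type `W₁ ⊕ W₂ ⊕ W₃ ⊕ W₅`. -/
theorem mem_W123 (hm : m ≠ 0) {μ : Eu m →ₗ[ℝ] ℝ} {ζ : Tor m} (hξ : ξ ∈ uTorsionSpace b J)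
    (hζ : ∀ X, ζ X = ξ X + μ X • J)
    (h : ζ ∈ W1 b J ⊔ W2 b J ⊔ W3 b J ⊔ W5 J) : ξ ∈ W1 b J ⊔ W2 b J ⊔ W3 b J := by
  obtain ⟨a, ha, c, ⟨α, hc⟩, rfl⟩ := Submodule.mem_sup.mp h
  have hau : a ∈ uTorsionSpace b J := by
    have : W1 b J ⊔ W2 b J ⊔ W3 b J ≤ uTorsionSpace b J :=
      sup_le (sup_le (fun _ h => h.1) (fun _ h => h.1)) (fun _ h => h.1)
    exact this ha
  have hd : ∀ X, (ξ - a) X = (α (J X) - μ X) • J := fun X => by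
    ext1 Y
    have e1 := LinearMap.congr_fun (hζ X) Y
    simp only [LinearMap.add_apply, LinearMap.smul_apply, LinearMap.sub_apply, hc] at e1 ⊢
    rw [sub_smul, sub_eq_sub_iff_add_eq_add, ← e1]
    abel
  -- The difference is a multiple of J at each X and also lies in u^⊥, to which J is orthogonal,
  -- with tr(J²) = -m ≠ 0.
  have h0 : ξ - a = 0 := by
    ext1 X
    have h1 := (sub_mem hξ hau X).2 J H.J_mem_u
    rw [hd, mul_smul_comm, map_smul, H.trace_J_mul_J, smul_eq_mul] at h1
    have h2 : (m : ℝ) ≠ 0 := by exact_mod_cast hm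
    have h3 : α (J X) - μ X = 0 := by
      rcases mul_eq_zero.mp h1 with h | h
      · exact h
      · exact absurd (neg_eq_zero.mp h) h2
    rw [hd, h3, zero_smul]; rfl
  rw [sub_eq_zero.mp h0]
  exact ha

end IsAlmostHermitian

end GrayHervella

/-! ## Forms of type `(n, 0)` -/

section ComplexForms

open Function

variable {n : ℕ} {V : Type*} [AddCommGroup V]

/-- The derivation of alternating complex forms induced by an endomorphism is the multiplication
by its trace. -/
theorem sum_update_eq_trace_mul [Module ℂ V] (f : V [⋀^Fin n]→ₗ[ℂ] ℂ)
    (e : Module.Basis (Fin n) ℂ V) (A : V →ₗ[ℂ] V) :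
    ∑ i, f (update e i (A (e i))) = (∑ i, e.repr (A (e i)) i) * f e := by
  rw [Finset.sum_mul]
  refine Finset.sum_congr rfl fun i _ => ?_
  conv_lhs => rw [← e.sum_repr (A (e i))]
  rw [f.map_update_sum]
  rw [Finset.sum_eq_single i]
  · rw [f.map_update_smul, update_eq_self, smul_eq_mul]
  · intro j _ hj
    rw [f.map_update_smul, f.map_update_self _ hj.symm, smul_zero]
  · simp

variable [Module ℝ V]

/-- A real multilinear alternating form on a complex vector space that is compatible with the
multiplication by `i` is complex multilinear. -/
def complexAlternating [Module ℂ V] [IsScalarTower ℝ ℂ V] (f : V [⋀^Fin n]→ₗ[ℝ] ℂ)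
    (hf : ∀ v i, f (update v i (Complex.I • v i)) = Complex.I * f v) : V [⋀^Fin n]→ₗ[ℂ] ℂ where
  toFun := f
  map_update_add' {inst} v i x y := by
    cases Subsingleton.elim inst (instDecidableEqFin n)
    exact f.map_update_add v i x y
  map_update_smul' {inst} v i c x := by
    cases Subsingleton.elim inst (instDecidableEqFin n)
    have h1 : c • x = c.re • x + c.im • (Complex.I • x) := by
      conv_lhs => rw [← Complex.re_add_im c, add_smul, mul_smul]
      rw [← Complex.coe_algebraMap, algebraMap_smul, algebraMap_smul]
    have h2 := hf (update v i x) i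
    rw [update_idem, update_self] at h2
    rw [h1, f.map_update_add, f.map_update_smul, f.map_update_smul, h2]
    conv_rhs => rw [← Complex.re_add_im c]
    simp only [Complex.real_smul, smul_eq_mul]
    ring
  map_eq_zero_of_eq' v i j h hij := f.map_eq_zero_of_eq v h hij

/-- The real trace of a complex linear map is twice the real part of its complex trace; for iA with
tr A = 0 this vanishes. The trace is read off in the real basis e_k, i e_k. -/
theorem trace_mul_I_eq_zero [Module ℂ V] [IsScalarTower ℝ ℂ V] (e : Module.Basis (Fin n) ℂ V)
    (A : V →ₗ[ℂ] V) (hA : ∑ i, e.repr (A (e i)) i = 0) {F : Module.End ℝ V}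
    (hF : ∀ v, F v = A (Complex.I • v)) : LinearMap.trace ℝ V F = 0 := by
  rw [LinearMap.trace_eq_matrix_trace ℝ (Complex.basisOneI.smulTower e), Matrix.trace,
    Fintype.sum_prod_type]
  simp only [Matrix.diag_apply, LinearMap.toMatrix_apply, Module.Basis.smulTower_repr,
    Module.Basis.smulTower_apply, hF, Fin.sum_univ_two, Complex.coe_basisOneI,
    Complex.coe_basisOneI_repr]
  have h := congrArg Complex.im hA
  simp only [Complex.im_sum, Complex.zero_im] at h
  simp [smul_smul, h]

/-- The complex structure defined by an endomorphism of square `-1`. -/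
abbrev complexModule (J : Module.End ℝ V) (hJ : J * J = -1) : Module ℂ V :=
  Module.compHom V (Complex.lift ⟨J, hJ⟩ : ℂ →ₐ[ℝ] Module.End ℝ V).toRingHom

theorem complexModule_I_smul (J : Module.End ℝ V) (hJ : J * J = -1) (v : V) :
    letI := complexModule J hJ
    Complex.I • v = J v := by
  change (Complex.lift ⟨J, hJ⟩ : ℂ →ₐ[ℝ] Module.End ℝ V) Complex.I v = J v
  simp

theorem complexModule_isScalarTower (J : Module.End ℝ V) (hJ : J * J = -1) :
    letI := complexModule J hJ
    IsScalarTower ℝ ℂ V := by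
  let _ := complexModule J hJ
  refine ⟨fun r c v => ?_⟩
  change (Complex.lift ⟨J, hJ⟩ : ℂ →ₐ[ℝ] Module.End ℝ V) (r • c) v
    = r • (Complex.lift ⟨J, hJ⟩ : ℂ →ₐ[ℝ] Module.End ℝ V) c v
  rw [map_smul]; rfl

theorem exists_complex_basis [Module ℂ V] [IsScalarTower ℝ ℂ V] [FiniteDimensional ℝ V]
    (hV : Module.finrank ℝ V = 2 * n) : Nonempty (Module.Basis (Fin n) ℂ V) := by
  have h1 := Module.finrank_mul_finrank ℝ ℂ V
  rw [Complex.finrank_real_complex, hV] at h1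
  have : FiniteDimensional ℂ V := FiniteDimensional.right ℝ ℂ V
  exact ⟨Module.finBasisOfFinrankEq ℂ V (by omega)⟩

/-- The space of forms of type `(n, 0)` is a complex line. -/
theorem exists_eq_mul_of_type [FiniteDimensional ℝ V] (hV : Module.finrank ℝ V = 2 * n)
    {J : Module.End ℝ V} (hJ : J * J = -1) {f g : V [⋀^Fin n]→ₗ[ℝ] ℂ}
    (hf : ∀ v i, f (update v i (J (v i))) = Complex.I * f v)
    (hg : ∀ v i, g (update v i (J (v i))) = Complex.I * g v) (hf0 : ∃ v, f v ≠ 0) :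
    ∃ c : ℂ, ∀ v, g v = c * f v := by
  let _ := complexModule J hJ
  have := complexModule_isScalarTower J hJ
  obtain ⟨e⟩ := exists_complex_basis (n := n) hV
  let f' := complexAlternating f fun v i => by rw [complexModule_I_smul, hf]
  let g' := complexAlternating g fun v i => by rw [complexModule_I_smul, hg]
  have h1 : ∀ v, f v = f' e * e.det v := fun v =>
    DFunLike.congr_fun (f'.eq_smul_basis_det e) v
  have h2 : ∀ v, g v = g' e * e.det v := fun v =>
    DFunLike.congr_fun (g'.eq_smul_basis_det e) v
  have h3 : f' e ≠ 0 := by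
    obtain ⟨v, hv⟩ := hf0
    rw [h1] at hv
    exact left_ne_zero_of_mul hv
  refine ⟨g' e / f' e, fun v => ?_⟩
  rw [h1, h2]; field_simp

/-- A complex linear endomorphism that annihilates a form of type `(n, 0)` is in `sl`. -/
theorem trace_mul_eq_zero_of_type [FiniteDimensional ℝ V] (hV : Module.finrank ℝ V = 2 * n)
    {J : Module.End ℝ V} (hJ : J * J = -1) {f : V [⋀^Fin n]→ₗ[ℝ] ℂ}
    (hf : ∀ v i, f (update v i (J (v i))) = Complex.I * f v) (hf0 : ∃ v, f v ≠ 0)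
    {A : Module.End ℝ V} (hA : A * J = J * A) (h : ∀ v, ∑ i, f (update v i (A (v i))) = 0) :
    LinearMap.trace ℝ V (A * J) = 0 := by
  let _ := complexModule J hJ
  have := complexModule_isScalarTower J hJ
  obtain ⟨e⟩ := exists_complex_basis (n := n) hV
  let f' := complexAlternating f fun v i => by rw [complexModule_I_smul, hf]
  have h1 : ∀ v, f v = f' e * e.det v := fun v =>
    DFunLike.congr_fun (f'.eq_smul_basis_det e) v
  have h3 : f' e ≠ 0 := by
    obtain ⟨v, hv⟩ := hf0
    rw [h1] at hv
    exact left_ne_zero_of_mul hv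
  have hAI : ∀ v, A (Complex.I • v) = Complex.I • A v := fun v => by
    rw [complexModule_I_smul, complexModule_I_smul]
    exact LinearMap.congr_fun hA v
  let A' : V →ₗ[ℂ] V :=
    { toFun := A
      map_add' := map_add A
      map_smul' := fun c v => by
        have hc : ∀ w : V, c • w = c.re • w + c.im • (Complex.I • w) := fun w => by
          conv_lhs => rw [← Complex.re_add_im c, add_smul, mul_smul]
          rw [← Complex.coe_algebraMap, algebraMap_smul, algebraMap_smul]
        rw [hc, map_add, map_smul, map_smul, hAI, RingHom.id_apply, hc] }
  have h4 : ∑ i, f' (update e i (A' (e i))) = 0 := h e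
  rw [sum_update_eq_trace_mul] at h4
  exact trace_mul_I_eq_zero e A' ((mul_eq_zero.mp h4).resolve_right h3) fun v => by
    rw [complexModule_I_smul]; rfl

end ComplexForms

/-! ## The Levi-Civita connection in coordinates -/

section Metric

variable {m : ℕ}

theorem finrank_dual : Module.finrank ℝ (Eu m →L[ℝ] ℝ) = m := by
  rw [← (LinearMap.toContinuousLinearMap (𝕜 := ℝ) (E := Eu m) (F' := ℝ)).finrank_eq]
  change Module.finrank ℝ (Module.Dual ℝ (Eu m)) = m
  rw [Subspace.dual_finrank_eq]; simp

theorem isInvertible_bil {b : Bil m} (hp : ∀ v, v ≠ 0 → 0 < b v v) : b.IsInvertible := by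
  have hinj : Function.Injective (b : Eu m →ₗ[ℝ] (Eu m →L[ℝ] ℝ)) := by
    rw [← LinearMap.ker_eq_bot, LinearMap.ker_eq_bot']
    intro v hv
    by_contra h
    have h1 := hp v h
    have h2 : b v = 0 := hv
    simp [h2] at h1
  let e := (LinearMap.linearEquivOfInjective (b : Eu m →ₗ[ℝ] (Eu m →L[ℝ] ℝ)) hinj
    (by rw [finrank_dual]; simp)).toContinuousLinearEquiv
  exact ⟨e, by ext; rfl⟩

theorem bil_inverse_apply {b : Bil m} (hp : ∀ v, v ≠ 0 → 0 < b v v) (φ : Eu m →L[ℝ] ℝ) :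
    b (b.inverse φ) = φ := by
  obtain ⟨e, rfl⟩ := isInvertible_bil hp
  simp

/-- A bilinear vector-valued map, made continuous. -/
def mkCLM₂ {V : Type*} [NormedAddCommGroup V] [NormedSpace ℝ V]
    (f : Eu m →ₗ[ℝ] Eu m →ₗ[ℝ] V) : Eu m →L[ℝ] Eu m →L[ℝ] V :=
  LinearMap.toContinuousLinearMap
    ((LinearMap.toContinuousLinearMap (𝕜 := ℝ) (E := Eu m) (F' := V)).toLinearMap ∘ₗ f)

/-- The Christoffel operator as a continuous bilinear map. -/
def christoffelCLM (G : Eu m → Bil m) (p : Eu m) : Eu m →L[ℝ] Eu m →L[ℝ] Eu m :=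
  mkCLM₂ (LinearMap.mk₂ ℝ (christoffel G p)
    (by
      intros; simp only [christoffel, map_add, add_apply, ← Finset.sum_add_distrib, ← add_smul]
      refine Finset.sum_congr rfl fun k _ => ?_
      congr 1; ring)
    (by
      intros; simp only [christoffel, map_smul, smul_apply, Finset.smul_sum, smul_smul, smul_eq_mul]
      refine Finset.sum_congr rfl fun k _ => ?_
      congr 1; ring)
    (by
      intros; simp only [christoffel, map_add, add_apply, ← Finset.sum_add_distrib, ← add_smul]
      refine Finset.sum_congr rfl fun k _ => ?_
      congr 1; ring)
    (by
      intros; simp only [christoffel, map_smul, smul_apply, Finset.smul_sum, smul_smul, smul_eq_mul]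
      refine Finset.sum_congr rfl fun k _ => ?_
      congr 1; ring))

theorem christoffelCLM_apply (G : Eu m → Bil m) (p v w : Eu m) :
    christoffelCLM G p v w = christoffel G p v w := rfl

/-- A smooth Riemannian metric in an open subset of the model space. -/
structure IsMetricOn (U : Set (Eu m)) (G : Eu m → Bil m) : Prop where
  isOpen : IsOpen U
  smooth : ContDiffOn ℝ ∞ G U
  symm : ∀ p ∈ U, ∀ v w, G p v w = G p w v
  pos : ∀ p ∈ U, ∀ v, v ≠ 0 → 0 < G p v v

namespace IsMetricOn

variable {U : Set (Eu m)} {G : Eu m → Bil m} (hG : IsMetricOn U G) {p : Eu m} (hp : p ∈ U)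
include hG hp

theorem contDiffAt : ContDiffAt ℝ ∞ G p := hG.smooth.contDiffAt (hG.isOpen.mem_nhds hp)

theorem differentiableAt : DifferentiableAt ℝ G p :=
  (hG.contDiffAt hp).differentiableAt (by simp)

theorem frame : IsOrthonormalFrame (G p) (frame (G p)) :=
  isOrthonormalFrame_frame _ (hG.symm p hp) (hG.pos p hp)

theorem ext {v w : Eu m} (h : ∀ z, G p v z = G p w z) : v = w := by
  by_contra hvw
  have h1 := hG.pos p hp (v - w) (sub_ne_zero.mpr hvw)
  simp [h] at h1

theorem fderiv_apply₂ (x v w : Eu m) :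
    fderiv ℝ (fun q => G q v w) p x = fderiv ℝ G p x v w := by
  have h := ((hG.differentiableAt hp).hasFDerivAt.clm_apply (hasFDerivAt_const v p)).clm_apply
    (hasFDerivAt_const w p)
  rw [h.fderiv]; simp

theorem fderiv_symm (x v w : Eu m) : fderiv ℝ G p x v w = fderiv ℝ G p x w v := by
  rw [← hG.fderiv_apply₂ hp, ← hG.fderiv_apply₂ hp]
  have : (fun q => G q v w) =ᶠ[nhds p] fun q => G q w v := by
    filter_upwards [hG.isOpen.mem_nhds hp] with q hq using hG.symm q hq v w
  rw [this.fderiv_eq]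

theorem two_mul_christoffel (v w z : Eu m) : 2 * G p (christoffel G p v w) z =
    fderiv ℝ G p v w z + fderiv ℝ G p w v z - fderiv ℝ G p z v w := by
  conv_rhs => rw [← (hG.frame hp).sum_smul z]
  simp only [christoffel, map_sum, sum_apply, map_smul, smul_apply, smul_eq_mul, Finset.mul_sum,
    ← Finset.sum_add_distrib, ← Finset.sum_sub_distrib]
  refine Finset.sum_congr rfl fun k _ => ?_
  rw [hG.symm p hp z]; ring

theorem christoffel_symm (v w : Eu m) : christoffel G p v w = christoffel G p w v := by
  refine hG.ext hp fun z => ?_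
  have h1 := hG.two_mul_christoffel hp v w z
  have h2 := hG.two_mul_christoffel hp w v z
  have h3 := hG.fderiv_symm hp z v w
  linarith

/-- Metric compatibility of the Levi-Civita connection in coordinates: adding two instances of the
Koszul formula leaves only the derivative of the metric. -/
theorem fderiv_eq (x v w : Eu m) : fderiv ℝ G p x v w =
    G p (christoffel G p x v) w + G p v (christoffel G p x w) := by
  have h1 := hG.two_mul_christoffel hp x v w
  have h2 := hG.two_mul_christoffel hp x w v
  rw [hG.symm p hp v]
  have h3 := hG.fderiv_symm hp x v w
  have h4 := hG.fderiv_symm hp v x w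
  have h5 := hG.fderiv_symm hp w x v
  linarith

omit hp in
theorem contDiffOn_inverse : ContDiffOn ℝ ∞ (fun q => (G q).inverse) U := by
  intro q hq
  obtain ⟨e, he⟩ := isInvertible_bil (hG.pos q hq)
  have h1 := contDiffAt_map_inverse (𝕜 := ℝ) (n := ∞) e
  rw [he] at h1
  exact (h1.comp q (hG.contDiffAt hq)).contDiffWithinAt

/-- The definition of Γ uses a frame chosen separately at every point, so its smoothness is not
visible there. This frame-free form makes it evident. -/
theorem christoffel_eq_inverse (v w : Eu m) : christoffel G p v w =
    (G p).inverse ((1 / 2 : ℝ) • (fderiv ℝ G p v w + fderiv ℝ G p w v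
      - ((fderiv ℝ G p).flip v).flip w)) := by
  refine hG.ext hp fun z => ?_
  rw [bil_inverse_apply (hG.pos p hp)]
  have h := hG.two_mul_christoffel hp v w z
  simp only [smul_apply, sub_apply, add_apply, ContinuousLinearMap.flip_apply, smul_eq_mul]
  linarith

omit hp in
theorem contDiffOn_fderiv : ContDiffOn ℝ ∞ (fderiv ℝ G) U :=
  hG.smooth.fderiv_of_isOpen hG.isOpen (by simp)

omit hp in
theorem contDiffOn_christoffel : ContDiffOn ℝ ∞ (christoffelCLM G) U := by
  have hD := hG.contDiffOn_fderiv
  rw [contDiffOn_clm_apply]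
  intro v
  rw [contDiffOn_clm_apply]
  intro w
  have h1 : ContDiffOn ℝ ∞ (fun q => (G q).inverse ((1 / 2 : ℝ) • (fderiv ℝ G q v w
      + fderiv ℝ G q w v - ((fderiv ℝ G q).flip v).flip w))) U := by
    refine hG.contDiffOn_inverse.clm_apply ?_
    rw [contDiffOn_clm_apply]
    intro z
    simp only [smul_apply, sub_apply, add_apply, ContinuousLinearMap.flip_apply]
    have h : ∀ x y z : Eu m, ContDiffOn ℝ ∞ (fun q => fderiv ℝ G q x y z) U := fun x y z =>
      ((hD.clm_apply contDiffOn_const).clm_apply contDiffOn_const).clm_apply contDiffOn_const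
    exact (((h v w z).add (h w v z)).sub (h z v w)).const_smul _
  exact h1.congr fun q hq => hG.christoffel_eq_inverse hq v w

theorem christoffel_differentiableAt : DifferentiableAt ℝ (christoffelCLM G) p :=
  (hG.contDiffOn_christoffel.contDiffAt (hG.isOpen.mem_nhds hp)).differentiableAt (by simp)

end IsMetricOn

end Metric

/-! ## The intrinsic torsion of an almost Hermitian structure -/

section UTorsion

variable {m : ℕ}

/-- A continuous bilinear map as a tensor. -/
def toTor (A : Eu m →L[ℝ] Eu m →L[ℝ] Eu m) : Tor m := ContinuousLinearMap.coeLM ℝ ∘ₗ A.toLinearMap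

@[simp] theorem toTor_apply (A : Eu m →L[ℝ] Eu m →L[ℝ] Eu m) (X Y : Eu m) :
    toTor A X Y = A X Y := rfl

/-- A smooth almost Hermitian structure in an open subset of the model space. -/
structure IsHermitianOn (U : Set (Eu m)) (G : Eu m → Bil m) (J : Eu m → Eu m →L[ℝ] Eu m) : Prop
    where
  isMetricOn : IsMetricOn U G
  smooth_J : ContDiffOn ℝ ∞ J U
  herm : ∀ p ∈ U, IsAlmostHermitian (G p) (J p)

/-- The covariant derivative of `J` as a continuous bilinear map. -/
def covJCLM (G : Eu m → Bil m) (J : Eu m → Eu m →L[ℝ] Eu m) (p : Eu m) :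
    Eu m →L[ℝ] Eu m →L[ℝ] Eu m :=
  fderiv ℝ J p + (ContinuousLinearMap.compL ℝ (Eu m) (Eu m) (Eu m)).flip (J p) ∘L christoffelCLM G p
    - ContinuousLinearMap.compL ℝ (Eu m) (Eu m) (Eu m) (J p) ∘L christoffelCLM G p

/-- The intrinsic torsion `-½ J ∇J`. -/
def uTor (G : Eu m → Bil m) (J : Eu m → Eu m →L[ℝ] Eu m) (p : Eu m) :
    Eu m →L[ℝ] Eu m →L[ℝ] Eu m :=
  (-1 / 2 : ℝ) • (ContinuousLinearMap.compL ℝ (Eu m) (Eu m) (Eu m) (J p) ∘L covJCLM G J p)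

theorem uTor_apply (G : Eu m → Bil m) (J : Eu m → Eu m →L[ℝ] Eu m) (p X Y : Eu m) :
    uTor G J p X Y = (-1 / 2 : ℝ) • J p (covJ G J p X Y) := rfl

namespace IsHermitianOn

variable {U : Set (Eu m)} {G : Eu m → Bil m} {J : Eu m → Eu m →L[ℝ] Eu m}
  (hS : IsHermitianOn U G J) {p : Eu m} (hp : p ∈ U)
include hS

theorem isOpen : IsOpen U := hS.isMetricOn.isOpen

theorem contDiffOn_covJ : ContDiffOn ℝ ∞ (covJCLM G J) U := by
  have h1 : ContDiffOn ℝ ∞ (fderiv ℝ J) U := hS.smooth_J.fderiv_of_isOpen hS.isOpen (by simp)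
  have h2 := hS.isMetricOn.contDiffOn_christoffel
  refine (h1.add ?_).sub ?_
  · exact (contDiffOn_const.clm_apply hS.smooth_J).clm_comp h2
  · exact (contDiffOn_const.clm_apply hS.smooth_J).clm_comp h2

theorem contDiffOn_uTor : ContDiffOn ℝ ∞ (uTor G J) U :=
  ((contDiffOn_const.clm_apply hS.smooth_J).clm_comp hS.contDiffOn_covJ).const_smul _

include hp

theorem J_differentiableAt : DifferentiableAt ℝ J p :=
  (hS.smooth_J.contDiffAt (hS.isOpen.mem_nhds hp)).differentiableAt (by simp)

theorem uTor_differentiableAt : DifferentiableAt ℝ (uTor G J) p :=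
  (hS.contDiffOn_uTor.contDiffAt (hS.isOpen.mem_nhds hp)).differentiableAt (by simp)

theorem J_sq (v : Eu m) : J p (J p v) = -v := (hS.herm p hp).sq v

/-- The derivative of J² = -1. -/
theorem fderiv_J_anticomm (X Y : Eu m) :
    fderiv ℝ J p X (J p Y) + J p (fderiv ℝ J p X Y) = 0 := by
  have hJ := (hS.J_differentiableAt hp).hasFDerivAt
  have h1 := hJ.clm_apply (hJ.clm_apply (hasFDerivAt_const Y p))
  have h2 : (fun q => J q (J q Y)) =ᶠ[nhds p] fun _ => -Y := by
    filter_upwards [hS.isOpen.mem_nhds hp] with q hq using hS.J_sq hq Y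
  have h3 := h1.fderiv
  rw [h2.fderiv_eq] at h3
  have h4 := DFunLike.congr_fun h3 X
  simp at h4
  rw [add_comm]; exact h4.symm

theorem covJ_anticomm (X Y : Eu m) : covJ G J p X (J p Y) = -J p (covJ G J p X Y) := by
  have h1 := hS.fderiv_J_anticomm hp X Y
  simp only [covJ, map_add, map_sub, hS.J_sq hp, ← christoffelCLM_apply, map_neg]
  rw [eq_neg_of_add_eq_zero_left h1]
  module

/-- The derivative of g(JY, Z) + g(Y, JZ) = 0, in which metric compatibility replaces the derivative
of g by Christoffel terms. -/
theorem covJ_skew (X Y Z : Eu m) :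
    G p (covJ G J p X Y) Z = -G p Y (covJ G J p X Z) := by
  have hJ := (hS.J_differentiableAt hp).hasFDerivAt
  have hG := (hS.isMetricOn.differentiableAt hp).hasFDerivAt
  have h1 := (hG.clm_apply (hJ.clm_apply (hasFDerivAt_const Y p))).clm_apply (hasFDerivAt_const Z p)
  have h2 := (hG.clm_apply (hasFDerivAt_const Y p)).clm_apply (hJ.clm_apply (hasFDerivAt_const Z p))
  have h3 : (fun q => G q (J q Y) Z + G q Y (J q Z)) =ᶠ[nhds p] fun _ => (0 : ℝ) := by
    filter_upwards [hS.isOpen.mem_nhds hp] with q hq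
    have := (hS.herm q hq).J_left Y Z
    simp only [ContinuousLinearMap.coe_coe] at this
    rw [this]; simp
  have h4 := (h1.add h2).fderiv
  rw [show (fun q => G q (J q Y) Z) + (fun q => G q Y (J q Z)) =
    fun q => G q (J q Y) Z + G q Y (J q Z) from rfl, h3.fderiv_eq] at h4
  have h5 := DFunLike.congr_fun h4 X
  simp [hS.isMetricOn.fderiv_eq hp] at h5
  have h6 := (hS.herm p hp).J_left (christoffel G p X Y) Z
  have h7 := (hS.herm p hp).J_left Y (christoffel G p X Z)
  simp only [ContinuousLinearMap.coe_coe] at h6 h7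
  simp only [covJ, map_add, map_sub, add_apply, sub_apply]
  linarith

theorem uTor_mem : toTor (uTor G J p) ∈ uTorsionSpace (G p) (J p) := by
  have H := hS.herm p hp
  rw [H.mem_uTorsionSpace_iff]
  refine ⟨fun X Y Z => ?_, fun X Y => ?_⟩
  · have h1 := hS.covJ_skew hp X Y (J p Z)
    have h2 := H.J_left (covJ G J p X Y) Z
    simp only [ContinuousLinearMap.coe_coe] at h2
    simp only [toTor_apply, uTor_apply, map_smul, smul_apply, h2, h1, hS.covJ_anticomm hp,
      smul_eq_mul, map_neg]
    ring
  · simp only [toTor_apply, uTor_apply, ContinuousLinearMap.coe_coe, hS.covJ_anticomm hp, map_smul,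
      map_neg, smul_neg]

theorem uTor_anticomm (X Y : Eu m) : uTor G J p X (J p Y) = -J p (uTor G J p X Y) :=
  ((hS.herm p hp).mem_uTorsionSpace_iff.mp (hS.uTor_mem hp)).2 X Y

theorem two_smul_J_uTor (X Y : Eu m) : (2 : ℝ) • J p (uTor G J p X Y) = covJ G J p X Y := by
  rw [uTor_apply, map_smul, hS.J_sq hp]; module

/-- For ξ_X anticommuting with J, the equation (∇ + ξ) J = 0 reads ∇J = 2Jξ, whose only solution is
ξ = -½ J ∇J. -/
theorem isUTorsion_iff (ξ : Tor m) : IsUTorsion G J p ξ ↔ ξ = toTor (uTor G J p) := by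
  have H := hS.herm p hp
  constructor
  · intro h
    ext1 X; ext1 Y
    have h1 := (H.mem_uTorsionSpace_iff.mp (fun X => (h X).1)).2 X Y
    have h2 := (h X).2 Y
    have h3 : covJ G J p X Y = (2 : ℝ) • J p (ξ X Y) := by
      simp only [ContinuousLinearMap.coe_coe] at h1
      rw [h1] at h2
      linear_combination (norm := module) h2
    rw [toTor_apply, uTor_apply, h3, map_smul, hS.J_sq hp]
    module
  · rintro rfl X
    refine ⟨hS.uTor_mem hp X, fun Y => ?_⟩
    rw [toTor_apply, toTor_apply, hS.uTor_anticomm hp, ← hS.two_smul_J_uTor hp]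
    module

theorem uTorsionAt_eq : uTorsionAt G J p = toTor (uTor G J p) :=
  (hS.isUTorsion_iff hp _).mp (Classical.epsilon_spec ⟨_, (hS.isUTorsion_iff hp _).mpr rfl⟩)

/-- In coordinates, the connection `∇ + ξ` of an almost Hermitian structure annihilates `J`. -/
theorem fderiv_J (X Y : Eu m) : fderiv ℝ J p X Y =
    J p (christoffel G p X Y + uTor G J p X Y)
      - (christoffel G p X (J p Y) + uTor G J p X (J p Y)) := by
  have h := hS.two_smul_J_uTor hp X Y
  rw [hS.uTor_anticomm hp, map_add]
  rw [covJ] at h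
  linear_combination (norm := module) -h

end IsHermitianOn

end UTorsion

/-! ## The norm of alternating forms -/

section FormNorm

variable {m n : ℕ}

/-- The coefficients of the inverse of a scalar product with respect to the standard basis. -/
def bilInv (b : Bil m) (k l : Fin m) : ℝ := b.inverse (EuclideanSpace.proj k) l

theorem bilInv_eq {b : Bil m} (hs : ∀ v w, b v w = b w v) (hp : ∀ v, v ≠ 0 → 0 < b v v)
    {e : Fin m → Eu m} (he : IsOrthonormalFrame b e) (k l : Fin m) :
    bilInv b k l = ∑ i, e i k * e i l := by
  have h : b.inverse (EuclideanSpace.proj k) = ∑ i, e i k • e i := by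
    obtain ⟨E, hE⟩ := isInvertible_bil hp
    rw [← hE, ContinuousLinearMap.inverse_equiv, ContinuousLinearEquiv.coe_coe,
      ContinuousLinearEquiv.symm_apply_eq]
    ext w
    have h1 : E (∑ i, e i k • e i) = b (∑ i, e i k • e i) := by rw [← hE]; rfl
    rw [h1]
    conv_lhs => rw [← he.sum_smul w]
    simp [hs w, mul_comm]
  rw [bilInv, h]
  simp

/-- The inner product of complex-valued forms defined by a scalar product, multiplied by `n!`. -/
def formInner (b : Bil m) (Ψ Φ : Eu m [⋀^Fin n]→L[ℝ] ℂ) : ℝ :=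
  ∑ I : Fin n → Fin m, ∑ K : Fin n → Fin m, (∏ k, bilInv b (I k) (K k)) *
    inner ℝ (Ψ fun k => EuclideanSpace.single (I k) 1) (Φ fun k => EuclideanSpace.single (K k) 1)

/-- This trades frame sums for an expression in the inverse metric and the standard basis, which can
be differentiated without a differentiable choice of frames. -/
theorem formInner_eq {b : Bil m} (hs : ∀ v w, b v w = b w v) (hp : ∀ v, v ≠ 0 → 0 < b v v)
    {e : Fin m → Eu m} (he : IsOrthonormalFrame b e) (Ψ Φ : Eu m [⋀^Fin n]→L[ℝ] ℂ) :
    formInner b Ψ Φ = ∑ f : Fin n → Fin m, inner ℝ (Ψ (e ∘ f)) (Φ (e ∘ f)) := by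
  have h1 : ∀ (Θ : Eu m [⋀^Fin n]→L[ℝ] ℂ) (f : Fin n → Fin m), Θ (e ∘ f) =
      ∑ I : Fin n → Fin m, (∏ k, e (f k) (I k)) • Θ fun k => EuclideanSpace.single (I k) 1 := by
    intro Θ f
    have h2 : e ∘ f = fun k => ∑ i, e (f k) i • (EuclideanSpace.single i 1 : Eu m) := by
      funext k
      have := (EuclideanSpace.basisFun (Fin m) ℝ).sum_repr (e (f k))
      simpa using this.symm
    rw [h2, ContinuousAlternatingMap.map_sum]
    exact Finset.sum_congr rfl fun I _ => Θ.map_smul_univ _ _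
  simp only [h1, sum_inner, inner_sum, real_inner_smul_left, real_inner_smul_right]
  rw [Finset.sum_comm, formInner, Finset.sum_comm]
  refine Finset.sum_congr rfl fun K _ => ?_
  rw [Finset.sum_comm]
  refine Finset.sum_congr rfl fun I _ => ?_
  simp only [← mul_assoc, ← Finset.sum_mul, ← Finset.prod_mul_distrib]
  congr 1
  simp only [bilInv_eq hs hp he, Finset.prod_univ_sum, Fintype.piFinset_univ]
  exact Finset.sum_congr rfl fun f _ => Finset.prod_congr rfl fun k _ => mul_comm _ _

/-- The derivation of forms induced by an endomorphism. -/
def formDer (Ψ : Eu m [⋀^Fin n]→L[ℝ] ℂ) : (Eu m →L[ℝ] Eu m) →L[ℝ] Eu m [⋀^Fin n]→L[ℝ] ℂ :=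
  Ψ.fderivCompContinuousLinearMap (ContinuousLinearMap.id ℝ (Eu m))

theorem formDer_apply (Ψ : Eu m [⋀^Fin n]→L[ℝ] ℂ) (A : Eu m →L[ℝ] Eu m) (v : Fin n → Eu m) :
    formDer Ψ A v = ∑ i, Ψ (Function.update v i (A (v i))) := by
  rw [formDer, ContinuousAlternatingMap.fderivCompContinuousLinearMap_apply]
  refine Finset.sum_congr rfl fun i _ => ?_
  congr 1
  funext j
  by_cases h : j = i
  · subst h; simp
  · simp [h]

/-- If a curve of scalar products has vanishing derivative, then the derivative of the norm of a
curve of forms is the usual one. -/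
theorem hasDerivAt_formInner {b : ℝ → Bil m} {Ψ : ℝ → Eu m [⋀^Fin n]→L[ℝ] ℂ}
    {Θ : Eu m [⋀^Fin n]→L[ℝ] ℂ} {t : ℝ} (hp : ∀ v, v ≠ 0 → 0 < b t v v) (hb : HasDerivAt b 0 t)
    (hΨ : HasDerivAt Ψ Θ t) :
    HasDerivAt (fun s => formInner (b s) (Ψ s) (Ψ s))
      (formInner (b t) (Ψ t) Θ + formInner (b t) Θ (Ψ t)) t := by
  have h1 : ∀ k l, HasDerivAt (fun s => bilInv (b s) k l) 0 t := by
    intro k l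
    obtain ⟨e, he⟩ := isInvertible_bil hp
    have d1 := (contDiffAt_map_inverse (𝕜 := ℝ) (n := 1) e).differentiableAt (by simp)
    rw [he] at d1
    have d2 := d1.hasFDerivAt.comp_hasDerivAt t hb
    have d3 := ((d2.clm_apply (hasDerivAt_const t (EuclideanSpace.proj k : Eu m →L[ℝ] ℝ))))
    have d4 := (EuclideanSpace.proj l : Eu m →L[ℝ] ℝ).hasFDerivAt.comp_hasDerivAt t d3
    exact HasDerivAt.congr_deriv (f := fun s => bilInv (b s) k l) d4 (by simp)
  have h2 : ∀ I K : Fin n → Fin m,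
      HasDerivAt (fun s => ∏ k, bilInv (b s) (I k) (K k)) 0 t := by
    intro I K
    have := HasDerivAt.fun_finsetProd (u := Finset.univ)
      (f := fun k s => bilInv (b s) (I k) (K k)) (f' := fun _ => 0) (x := t) fun k _ => h1 _ _
    simpa using this
  have h3 : ∀ v, HasDerivAt (fun s => Ψ s v) (Θ v) t := fun v => by
    simpa using (hΨ.hasFDerivAt.continuousAlternatingMap_apply_const v).hasDerivAt
  have h4 := HasDerivAt.fun_sum (u := Finset.univ) fun I (_ : I ∈ Finset.univ) =>
    HasDerivAt.fun_sum (u := Finset.univ) fun K (_ : K ∈ Finset.univ) => (h2 I K).mul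
      ((h3 fun k => EuclideanSpace.single (I k) 1).inner ℝ
        (h3 fun k => EuclideanSpace.single (K k) 1))
  refine HasDerivAt.congr_deriv (f := fun s => formInner (b s) (Ψ s) (Ψ s)) h4 ?_
  simp only [formInner, ← Finset.sum_add_distrib, zero_mul, zero_add, mul_add]

end FormNorm

/-! ## The intrinsic torsion of a special almost Hermitian structure -/

section SUTorsion

open Function

/-- A smooth special almost Hermitian structure in an open subset of the model space. -/
structure IsSUOn {n : ℕ} (U : Set (Eu (2 * n))) (G : Eu (2 * n) → Bil (2 * n))
    (J : Eu (2 * n) → Eu (2 * n) →L[ℝ] Eu (2 * n))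
    (Ψ : Eu (2 * n) → Eu (2 * n) [⋀^Fin n]→L[ℝ] ℂ) : Prop where
  isHermitianOn : IsHermitianOn U G J
  smooth_Ψ : ContDiffOn ℝ ∞ Ψ U
  type : ∀ p ∈ U, ∀ v i, Ψ p (update v i (J p (v i))) = Complex.I * Ψ p v
  norm : ∀ p ∈ U, ∀ e, IsOrthonormalFrame (G p) e →
    (1 / (n.factorial : ℝ)) * ∑ f : Fin n → Fin (2 * n), ‖Ψ p (e ∘ f)‖ ^ 2 = 1

/-- The connection form of `∇ + ξ`, where `ξ` is the torsion of an almost Hermitian structure. -/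
def uConn {m : ℕ} (G : Eu m → Bil m) (J : Eu m → Eu m →L[ℝ] Eu m) (p : Eu m) :
    Eu m →L[ℝ] Eu m →L[ℝ] Eu m :=
  christoffelCLM G p + uTor G J p

theorem uConn_apply {m : ℕ} (G : Eu m → Bil m) (J : Eu m → Eu m →L[ℝ] Eu m) (p X Y : Eu m) :
    uConn G J p X Y = christoffel G p X Y + uTor G J p X Y := rfl

/-- The covariant derivative of a form for the connection `∇ + ξ`. -/
def uCovForm {m n : ℕ} (G : Eu m → Bil m) (J : Eu m → Eu m →L[ℝ] Eu m)
    (Ψ : Eu m → Eu m [⋀^Fin n]→L[ℝ] ℂ) (p : Eu m) : Eu m →L[ℝ] Eu m [⋀^Fin n]→L[ℝ] ℂ :=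
  fderiv ℝ Ψ p - formDer (Ψ p) ∘L uConn G J p

theorem uCovForm_apply {m n : ℕ} (G : Eu m → Bil m) (J : Eu m → Eu m →L[ℝ] Eu m)
    (Ψ : Eu m → Eu m [⋀^Fin n]→L[ℝ] ℂ) (p X : Eu m) (v : Fin n → Eu m) :
    uCovForm G J Ψ p X v = fderiv ℝ Ψ p X v - ∑ i, Ψ p (update v i (uConn G J p X (v i))) := by
  simp [uCovForm, formDer_apply]

/-- ∇ + ξ is again metric because ξ_X is skew. -/
theorem IsHermitianOn.fderiv_metric {m : ℕ} {U : Set (Eu m)} {G : Eu m → Bil m}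
    {J : Eu m → Eu m →L[ℝ] Eu m} (hS : IsHermitianOn U G J) {p : Eu m} (hp : p ∈ U)
    (X v w : Eu m) :
    fderiv ℝ G p X v w = G p (uConn G J p X v) w + G p v (uConn G J p X w) := by
  rw [hS.isMetricOn.fderiv_eq hp]
  have h := ((hS.herm p hp).mem_uTorsionSpace_iff.mp (hS.uTor_mem hp)).1 X v w
  simp only [toTor_apply] at h
  simp only [uConn_apply, map_add, add_apply]
  linarith

/-! ### The connection ∇ + ξ^{U(n)} on the complex volume form -/

namespace IsSUOn

variable {n : ℕ} {U : Set (Eu (2 * n))} {G : Eu (2 * n) → Bil (2 * n)}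
    {J : Eu (2 * n) → Eu (2 * n) →L[ℝ] Eu (2 * n)}
    {Ψ : Eu (2 * n) → Eu (2 * n) [⋀^Fin n]→L[ℝ] ℂ} (hS : IsSUOn U G J Ψ)
include hS

theorem isOpen : IsOpen U := hS.isHermitianOn.isOpen

variable {p : Eu (2 * n)} (hp : p ∈ U)
include hp

theorem differentiableAt : DifferentiableAt ℝ Ψ p :=
  (hS.smooth_Ψ.contDiffAt (hS.isOpen.mem_nhds hp)).differentiableAt (by simp)

theorem J_mul_J : (J p : Module.End ℝ (Eu (2 * n))) * (J p : Module.End ℝ (Eu (2 * n))) = -1 :=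
  (hS.isHermitianOn.herm p hp).mul_self

theorem formInner_self : formInner (G p) (Ψ p) (Ψ p) = n.factorial := by
  have hM := hS.isHermitianOn.isMetricOn
  rw [formInner_eq (hM.symm p hp) (hM.pos p hp) (hM.frame hp)]
  have h := hS.norm p hp _ (hM.frame hp)
  have h1 : (n.factorial : ℝ) ≠ 0 := by exact_mod_cast n.factorial_ne_zero
  field_simp at h
  simp only [real_inner_self_eq_norm_sq]
  exact h

theorem exists_ne_zero : ∃ v, Ψ p v ≠ 0 := by
  by_contra! h
  have h1 := hS.norm p hp _ (hS.isHermitianOn.isMetricOn.frame hp)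
  simp [h] at h1

/-- The connection `∇ + ξ^{U(n)}` preserves the type of forms. -/
theorem uCovForm_type (X : Eu (2 * n)) (v : Fin n → Eu (2 * n)) (i : Fin n) :
    uCovForm G J Ψ p X (update v i (J p (v i))) = Complex.I * uCovForm G J Ψ p X v := by
  have hJ := (hS.isHermitianOn.J_differentiableAt hp).hasFDerivAt
  -- The derivative of the type condition along X has an extra term in the derivative of J. The
  -- connection terms `hs` produce the same term at the slot k = i, and the two agree because ∇ +
  -- ξ^{U(n)} annihilates J.
  have hd : fderiv ℝ Ψ p X (update v i (J p (v i))) + Ψ p (update v i (fderiv ℝ J p X (v i)))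
      = Complex.I * fderiv ℝ Ψ p X v := by
    have h1 := (hS.differentiableAt hp).hasFDerivAt.continuousAlternatingMap_apply
      (g := fun k q => update v i (J q (v i)) k)
      (g' := fun k => if k = i then (fderiv ℝ J p).flip (v i) else 0) (fun k => by
        by_cases hk : k = i
        · subst hk
          simpa using hJ.clm_apply (hasFDerivAt_const (v k) p)
        · simp only [update_of_ne hk, hk, if_false]
          exact hasFDerivAt_const (v k) p)
    have h2 := ((hS.differentiableAt hp).hasFDerivAt.continuousAlternatingMap_apply_const v
      ).const_mul Complex.I
    have h3 : (fun q => Ψ q (fun k => update v i (J q (v i)) k)) =ᶠ[nhds p]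
        fun q => Complex.I * Ψ q v := by
      filter_upwards [hS.isOpen.mem_nhds hp] with q hq using hS.type q hq v i
    have h4 := h1.fderiv
    rw [h3.fderiv_eq, h2.fderiv] at h4
    have h5 := DFunLike.congr_fun h4 X
    simp only [add_apply, sum_apply, ContinuousLinearMap.comp_apply, smul_apply] at h5
    rw [Finset.sum_eq_single i (by intro k _ hk; simp [hk]) (by simp)] at h5
    simpa using h5.symm
  have hs : ∀ k, Ψ p (update (update v i (J p (v i))) k
      (uConn G J p X (update v i (J p (v i)) k))) =
      Complex.I * Ψ p (update v k (uConn G J p X (v k))) -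
      if k = i then Ψ p (update v i (J p (uConn G J p X (v i)) - uConn G J p X (J p (v i))))
      else 0 := by
    intro k
    by_cases hk : k = i
    · subst hk
      have h1 := hS.type p hp (update v k (uConn G J p X (v k))) k
      simp only [update_idem, update_self] at h1
      simp [← h1, ContinuousAlternatingMap.map_update_sub]
    · have h1 := hS.type p hp (update v k (uConn G J p X (v k))) i
      rw [update_of_ne (Ne.symm hk)] at h1
      rw [update_of_ne hk, if_neg hk, sub_zero, ← h1, update_comm (Ne.symm hk)]
  have hB : fderiv ℝ J p X (v i) = J p (uConn G J p X (v i)) - uConn G J p X (J p (v i)) :=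
    hS.isHermitianOn.fderiv_J hp X (v i)
  rw [hB] at hd
  rw [uCovForm_apply, uCovForm_apply, mul_sub, ← hd, Finset.sum_congr rfl fun k _ => hs k,
    Finset.sum_sub_distrib, Finset.sum_ite_eq' Finset.univ i, if_pos (Finset.mem_univ i),
    Finset.mul_sum]
  ring

/-- The connection `∇ + ξ^{U(n)}` preserves the norm of forms. -/
theorem formInner_uCovForm (X : Eu (2 * n)) :
    formInner (G p) (Ψ p) (uCovForm G J Ψ p X)
      + formInner (G p) (uCovForm G J Ψ p X) (Ψ p) = 0 := by
  have hM := hS.isHermitianOn.isMetricOn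
  set B := uConn G J p X with hB
  -- To first order, `T t` is parallel transport for ∇ + ξ^{U(n)} along the line `γ`. Pulling the
  -- structure back by it makes the derivative of the metric zero and that of the form equal to the
  -- covariant derivative, while the norm of the form stays constant.
  let γ : ℝ → Eu (2 * n) := fun t => p + t • X
  let T : ℝ → Eu (2 * n) →L[ℝ] Eu (2 * n) := fun t => ContinuousLinearMap.id ℝ _ - t • B
  have hγ0 : γ 0 = p := by simp [γ]
  have hT0 : T 0 = ContinuousLinearMap.id ℝ _ := by simp [T]
  have hγ : HasDerivAt γ X 0 := by
    have h : HasDerivAt γ ((1 : ℝ) • X) 0 := ((hasDerivAt_id (0 : ℝ)).smul_const X).const_add p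
    rwa [one_smul] at h
  have hT : HasDerivAt T (-B) 0 := by
    simpa using ((hasDerivAt_id (0 : ℝ)).smul_const B).const_sub (ContinuousLinearMap.id ℝ _)
  let b : ℝ → Bil (2 * n) := fun t => (T t).precomp ℝ ∘L G (γ t) ∘L T t
  have hb_apply : ∀ t v w, b t v w = G (γ t) (T t v) (T t w) := fun t v w => rfl
  have hb0 : b 0 = G p := by
    ext v w; simp [hb_apply, hγ0, hT0]
  let Φ : ℝ → Eu (2 * n) [⋀^Fin n]→L[ℝ] ℂ := fun t => (Ψ (γ t)).compContinuousLinearMap (T t)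
  have hΦ0 : Φ 0 = Ψ p := by
    ext v; simp [Φ, hγ0, hT0]
  have hGγ : HasDerivAt (fun t => G (γ t)) (fderiv ℝ G p X) 0 := by
    have h := (hM.differentiableAt hp).hasFDerivAt
    rw [← hγ0] at h
    have h2 := h.comp_hasDerivAt (0 : ℝ) hγ
    rwa [hγ0] at h2
  have hΨγ : HasDerivAt (fun t => Ψ (γ t)) (fderiv ℝ Ψ p X) 0 := by
    have h := (hS.differentiableAt hp).hasFDerivAt
    rw [← hγ0] at h
    have h2 := h.comp_hasDerivAt (0 : ℝ) hγ
    rwa [hγ0] at h2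
  have hb : HasDerivAt b 0 0 := by
    have h1 : DifferentiableAt ℝ b 0 := by
      have h2 : DifferentiableAt ℝ (fun t => (T t).precomp ℝ) 0 :=
        (ContinuousLinearMap.compL ℝ (Eu (2 * n)) (Eu (2 * n)) ℝ).flip.differentiableAt.comp 0
          hT.differentiableAt
      exact h2.clm_comp (hGγ.differentiableAt.clm_comp hT.differentiableAt)
    have h3 : deriv b 0 = 0 := by
      ext v w
      have h4 := (h1.hasDerivAt.clm_apply (hasDerivAt_const (0 : ℝ) v)).clm_apply
        (hasDerivAt_const (0 : ℝ) w)
      have h5 := (hGγ.clm_apply (hT.clm_apply (hasDerivAt_const (0 : ℝ) v))).clm_apply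
        (hT.clm_apply (hasDerivAt_const (0 : ℝ) w))
      have h6 := h4.unique h5
      simp [hγ0, hT0, hS.isHermitianOn.fderiv_metric hp, ← hB] at h6
      rw [h6]; simp
    have := h1.hasDerivAt
    rwa [h3] at this
  have hΦ : HasDerivAt Φ (uCovForm G J Ψ p X) 0 := by
    have h1 := (hΨγ.hasFDerivAt.continuousAlternatingMapCompContinuousLinearMap
      hT.hasFDerivAt).hasDerivAt
    refine HasDerivAt.congr_deriv (f := Φ) h1 ?_
    ext v
    simp [hγ0, hT0, uCovForm, formDer, ← hB, sub_eq_add_neg]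
  have hpos : ∀ v, v ≠ 0 → 0 < b 0 v v := by rw [hb0]; exact hM.pos p hp
  have hN := hasDerivAt_formInner hpos hb hΦ
  -- For small t the map `T t` is invertible, so it sends a frame of the pulled-back metric to a
  -- frame at `γ t`, where the norm of Ψ is prescribed.
  have hev : (fun t => formInner (b t) (Φ t) (Φ t)) =ᶠ[nhds 0] fun _ => (n.factorial : ℝ) := by
    have e1 : ∀ᶠ t in nhds (0 : ℝ), γ t ∈ U :=
      hγ.continuousAt.eventually_mem (by rw [hγ0]; exact hS.isOpen.mem_nhds hp)
    have e2 : ∀ᶠ t in nhds (0 : ℝ), IsUnit (T t) := by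
      refine hT.continuousAt.eventually_mem (Units.isOpen.mem_nhds ?_)
      rw [hT0]; exact isUnit_one
    filter_upwards [e1, e2] with t ht1 ht2
    have hinj : Function.Injective (T t) := by
      obtain ⟨u, hu⟩ := ht2
      intro x y hxy
      have h : (↑u⁻¹ : Eu (2 * n) →L[ℝ] Eu (2 * n)) ((↑u : Eu (2 * n) →L[ℝ] Eu (2 * n)) x)
          = (↑u⁻¹ : Eu (2 * n) →L[ℝ] Eu (2 * n)) ((↑u : Eu (2 * n) →L[ℝ] Eu (2 * n)) y) := by
        rw [hu, hxy]
      rw [← mul_apply_eq_comp, ← mul_apply_eq_comp, u.inv_mul] at h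
      simpa using h
    have hs' : ∀ v w, b t v w = b t w v := fun v w => by
      rw [hb_apply, hb_apply, hM.symm _ ht1]
    have hp' : ∀ v, v ≠ 0 → 0 < b t v v := fun v hv => by
      rw [hb_apply]
      exact hM.pos _ ht1 _ fun h => hv (hinj (by rw [h, map_zero]))
    have he := isOrthonormalFrame_frame _ hs' hp'
    have he' : IsOrthonormalFrame (G (γ t)) (fun i => T t (frame (b t) i)) := he
    rw [formInner_eq hs' hp' he, ← hS.formInner_self ht1,
      formInner_eq (hM.symm _ ht1) (hM.pos _ ht1) he']
    rfl
  have h1 := hN.deriv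
  rw [hev.deriv_eq, deriv_const, hb0, hΦ0] at h1
  exact h1.symm

/-- Forms of type (n,0) are a complex line, so the covariant derivative of Ψ is cΨ; preservation of
the norm forces Re c = 0. -/
theorem exists_uCovForm_eq (X : Eu (2 * n)) :
    ∃ r : ℝ, ∀ v, uCovForm G J Ψ p X v = r * Complex.I * Ψ p v := by
  have hM := hS.isHermitianOn.isMetricOn
  obtain ⟨c, hc⟩ := exists_eq_mul_of_type (f := (Ψ p).toAlternatingMap)
    (g := (uCovForm G J Ψ p X).toAlternatingMap) (by simp) (hS.J_mul_J hp)
    (hS.type p hp) (hS.uCovForm_type hp X) (hS.exists_ne_zero hp)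
  have hc' : ∀ v, uCovForm G J Ψ p X v = c * Ψ p v := hc
  have h := hS.formInner_uCovForm hp X
  have h0 := hS.formInner_self hp
  rw [formInner_eq (hM.symm p hp) (hM.pos p hp) (hM.frame hp)] at h0
  rw [formInner_eq (hM.symm p hp) (hM.pos p hp) (hM.frame hp),
    formInner_eq (hM.symm p hp) (hM.pos p hp) (hM.frame hp), ← Finset.sum_add_distrib] at h
  have h1 : ∀ z : ℂ, inner ℝ z (c * z) + inner ℝ (c * z) z = 2 * c.re * inner ℝ z z := fun z => by
    simp only [Complex.inner, Complex.mul_re, Complex.mul_im, Complex.conj_re, Complex.conj_im]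
    ring
  simp only [hc', h1, ← Finset.mul_sum, h0] at h
  have h2 : (n.factorial : ℝ) ≠ 0 := by exact_mod_cast n.factorial_ne_zero
  have h3 : c.re = 0 := by simpa [h2] using h
  refine ⟨c.im, fun v => ?_⟩
  rw [hc']
  congr 1
  apply Complex.ext <;> simp [h3]

end IsSUOn

/-- The one-form `X ↦ η(J X)` of a special almost Hermitian structure, computed with a tuple of
vectors on which the complex volume form does not vanish. -/
def muForm {m n : ℕ} (G : Eu m → Bil m) (J : Eu m → Eu m →L[ℝ] Eu m)
    (Ψ : Eu m → Eu m [⋀^Fin n]→L[ℝ] ℂ) (v : Fin n → Eu m) (p : Eu m) : Eu m →L[ℝ] ℝ :=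
  Complex.imCLM ∘L (ContinuousLinearMap.mul ℝ ℂ (n * Ψ p v)⁻¹ ∘L
    ContinuousAlternatingMap.apply ℝ (Eu m) ℂ v ∘L uCovForm G J Ψ p)

theorem muForm_apply {m n : ℕ} (G : Eu m → Bil m) (J : Eu m → Eu m →L[ℝ] Eu m)
    (Ψ : Eu m → Eu m [⋀^Fin n]→L[ℝ] ℂ) (v : Fin n → Eu m) (p X : Eu m) :
    muForm G J Ψ v p X = ((n * Ψ p v)⁻¹ * uCovForm G J Ψ p X v).im := rfl

/-- The intrinsic torsion `ξ^{U(n)}_X + η(J X) J` of a special almost Hermitian structure. -/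
def suTor {m n : ℕ} (G : Eu m → Bil m) (J : Eu m → Eu m →L[ℝ] Eu m)
    (Ψ : Eu m → Eu m [⋀^Fin n]→L[ℝ] ℂ) (v : Fin n → Eu m) (p : Eu m) :
    Eu m →L[ℝ] Eu m →L[ℝ] Eu m :=
  uTor G J p + (muForm G J Ψ v p).smulRight (J p)

theorem suTor_apply {m n : ℕ} (G : Eu m → Bil m) (J : Eu m → Eu m →L[ℝ] Eu m)
    (Ψ : Eu m → Eu m [⋀^Fin n]→L[ℝ] ℂ) (v : Fin n → Eu m) (p X Y : Eu m) :
    suTor G J Ψ v p X Y = uTor G J p X Y + muForm G J Ψ v p X • J p Y := rfl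

/-! ### Existence, uniqueness and regularity of the SU(n)-torsion -/

namespace IsSUOn

variable {n : ℕ} {U : Set (Eu (2 * n))} {G : Eu (2 * n) → Bil (2 * n)}
    {J : Eu (2 * n) → Eu (2 * n) →L[ℝ] Eu (2 * n)}
    {Ψ : Eu (2 * n) → Eu (2 * n) [⋀^Fin n]→L[ℝ] ℂ} (hS : IsSUOn U G J Ψ)
    {p : Eu (2 * n)} (hp : p ∈ U) {v : Fin n → Eu (2 * n)}
include hS hp

/-- `muForm` is a quotient formed with one tuple `v`, which makes its smoothness manifest; by
proportionality the value is the same for every tuple with Ψ(v) ≠ 0. -/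
theorem uCovForm_eq (hn : n ≠ 0) (hv : Ψ p v ≠ 0) (X : Eu (2 * n)) (w : Fin n → Eu (2 * n)) :
    uCovForm G J Ψ p X w = n * muForm G J Ψ v p X * Complex.I * Ψ p w := by
  obtain ⟨r, hr⟩ := hS.exists_uCovForm_eq hp X
  have hn' : (n : ℂ) ≠ 0 := by exact_mod_cast hn
  have h1 : ((n * Ψ p v)⁻¹ * uCovForm G J Ψ p X v) = ((r / n : ℝ) : ℂ) * Complex.I := by
    rw [hr]; push_cast; field_simp
  have h2 : muForm G J Ψ v p X = r / n := by
    rw [muForm_apply, h1]; simp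
  rw [hr, h2]; push_cast; field_simp

/-- J acts on Ψ as a derivation by the factor n i, so adding μ ⊗ J to ξ^{U(n)} cancels exactly the
remaining derivative n i μ Ψ. -/
theorem isSUTorsion_suTor (hn : n ≠ 0) (hv : Ψ p v ≠ 0) :
    IsSUTorsion G J Ψ p (toTor (suTor G J Ψ v p)) := by
  intro X
  have H := hS.isHermitianOn.herm p hp
  have hX : toTor (suTor G J Ψ v p) X = toTor (uTor G J p) X
      + muForm G J Ψ v p X • (J p : Module.End ℝ (Eu (2 * n))) := rfl
  refine ⟨?_, fun Y => ?_, fun w => ?_⟩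
  · rw [hX]
    exact add_mem (perp_u_le_perp_su (hS.isHermitianOn.uTor_mem hp X))
      (Submodule.smul_mem _ _ H.J_mem_perp_su)
  · have h := (((hS.isHermitianOn.isUTorsion_iff hp _).mpr rfl) X).2 Y
    simp only [toTor_apply, suTor_apply, map_add, map_smul] at h ⊢
    linear_combination (norm := module) h
  · have h := hS.uCovForm_eq hp hn hv X w
    rw [uCovForm_apply] at h
    have h1 : ∀ i, Ψ p (update w i (suTor G J Ψ v p X (w i))) =
        Ψ p (update w i (uConn G J p X (w i))) - Ψ p (update w i (christoffel G p X (w i)))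
          + muForm G J Ψ v p X * (Complex.I * Ψ p w) := by
      intro i
      rw [← hS.type p hp w i, uConn_apply, ContinuousAlternatingMap.map_update_add, suTor_apply,
        ContinuousAlternatingMap.map_update_add, ContinuousAlternatingMap.map_update_smul,
        Complex.real_smul]
      ring
    simp only [toTor_apply, h1, covForm, Finset.sum_add_distrib, Finset.sum_sub_distrib,
      Finset.sum_const, Finset.card_univ, Fintype.card_fin, nsmul_eq_mul]
    linear_combination h

/-- The difference of two solutions commutes with J and annihilates Ψ, so it lies in su; it also
lies in su^⊥, and the trace form is definite. -/
theorem isSUTorsion_unique {ξ ζ : Tor (2 * n)} (hξ : IsSUTorsion G J Ψ p ξ)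
    (hζ : IsSUTorsion G J Ψ p ζ) : ξ = ζ := by
  have H := hS.isHermitianOn.herm p hp
  refine LinearMap.ext fun X => sub_eq_zero.mp ?_
  have h1 := sub_mem (hξ X).1 (hζ X).1
  have h2 : (ξ X - ζ X) * (J p : Module.End ℝ (Eu (2 * n)))
      = (J p : Module.End ℝ (Eu (2 * n))) * (ξ X - ζ X) := by
    ext1 Y
    have a1 := (hξ X).2.1 Y
    have a2 := (hζ X).2.1 Y
    simp only [Module.End.mul_apply, LinearMap.sub_apply, map_sub, ContinuousLinearMap.coe_coe]
    linear_combination (norm := module) a1 - a2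
  have h3 : LinearMap.trace ℝ _ ((ξ X - ζ X) * (J p : Module.End ℝ (Eu (2 * n)))) = 0 := by
    refine trace_mul_eq_zero_of_type (f := (Ψ p).toAlternatingMap) (by simp) (hS.J_mul_J hp)
      (hS.type p hp) (hS.exists_ne_zero hp) h2 fun w => ?_
    have a1 := (hξ X).2.2 w
    have a2 := (hζ X).2.2 w
    have a3 : ∀ i, Ψ p (update w i ((ξ X - ζ X) (w i))) =
        Ψ p (update w i (ξ X (w i))) - Ψ p (update w i (ζ X (w i))) := fun i => by
      rw [LinearMap.sub_apply, ContinuousAlternatingMap.map_update_sub]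
    change ∑ i, Ψ p (update w i ((ξ X - ζ X) (w i))) = 0
    rw [Finset.sum_congr rfl fun i _ => a3 i, Finset.sum_sub_distrib]
    linear_combination a2 - a1
  exact H.eq_zero_of_trace_sq h1.1 (h1.2 _ ⟨⟨h1.1, h2⟩, h3⟩)

theorem suTorsionAt_eq (hn : n ≠ 0) (hv : Ψ p v ≠ 0) :
    suTorsionAt G J Ψ p = toTor (suTor G J Ψ v p) := by
  have h := hS.isSUTorsion_suTor hp hn hv
  exact hS.isSUTorsion_unique hp (Classical.epsilon_spec ⟨_, h⟩) h

omit hp in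
theorem contDiffOn_apply_update {w : Eu (2 * n) → Eu (2 * n)} (hw : ContDiffOn ℝ ∞ w U)
    (v : Fin n → Eu (2 * n)) (i : Fin n) :
    ContDiffOn ℝ ∞ (fun q => Ψ q (update v i (w q))) U := by
  have h : ContDiffOn ℝ ∞
      (fun q => (Ψ q).toContinuousMultilinearMap.toContinuousLinearMap v i) U := by
    rw [contDiffOn_clm_apply]
    exact fun x => (contDiffOn_const (c := ContinuousAlternatingMap.apply ℝ (Eu (2 * n)) ℂ
      (update v i x))).clm_apply hS.smooth_Ψ
  exact h.clm_apply hw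

omit hp in
theorem contDiffOn_uConn : ContDiffOn ℝ ∞ (uConn G J) U :=
  hS.isHermitianOn.isMetricOn.contDiffOn_christoffel.add hS.isHermitianOn.contDiffOn_uTor

theorem contDiffAt_muForm (hn : n ≠ 0) (hv : Ψ p v ≠ 0) : ContDiffAt ℝ ∞ (muForm G J Ψ v) p := by
  have hU := hS.isOpen.mem_nhds hp
  have hn' : (n : ℂ) ≠ 0 := by exact_mod_cast hn
  have h1 : ContDiffOn ℝ ∞ (fderiv ℝ Ψ) U := hS.smooth_Ψ.fderiv_of_isOpen hS.isOpen (by simp)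
  refine (contDiffAt_const (c := (ContinuousLinearMap.compL ℝ (Eu (2 * n)) ℂ ℝ
    Complex.imCLM))).clm_apply ?_
  refine ContDiffAt.clm_comp (contDiffAt_const.clm_apply ?_) ?_
  · refine ContDiffAt.inv (contDiffAt_const.mul ?_) (mul_ne_zero hn' hv)
    exact (contDiffAt_const (c := ContinuousAlternatingMap.apply ℝ (Eu (2 * n)) ℂ v)).clm_apply
      (hS.smooth_Ψ.contDiffAt hU)
  · refine ContDiffOn.contDiffAt ?_ hU
    rw [contDiffOn_clm_apply]
    intro X
    simp only [ContinuousLinearMap.comp_apply, ContinuousAlternatingMap.apply_apply, uCovForm_apply]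
    refine ContDiffOn.sub ?_ (ContDiffOn.sum fun i _ => ?_)
    · exact (contDiffOn_const (c := ContinuousAlternatingMap.apply ℝ (Eu (2 * n)) ℂ v)).clm_apply
        (h1.clm_apply contDiffOn_const)
    · exact hS.contDiffOn_apply_update
        ((hS.contDiffOn_uConn.clm_apply contDiffOn_const).clm_apply contDiffOn_const) v i

end IsSUOn

end SUTorsion

/-! ## The curvature and the covariant derivative of the complex volume form -/

section Curvature

open Function

/-- The J-components of the torsion drop out of tr([ξ_X, ξ_Y] J): their commutators are multiples of
AJ and CJ, whose products with J are traceless because A and C anticommute with J. -/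
theorem trace_commutator_of_anticomm {m : ℕ} {J A C : Module.End ℝ (Eu m)}
    (hA : A * J = -(J * A))
    (hC : C * J = -(J * C)) (s t : ℝ) :
    LinearMap.trace ℝ _ (((A + s • J) * (C + t • J) - (C + t • J) * (A + s • J)) * J) =
      2 * LinearMap.trace ℝ _ (A * C * J) := by
  have h1 : (A + s • J) * (C + t • J) - (C + t • J) * (A + s • J) =
      A * C - C * A + (2 * t) • (A * J) - (2 * s) • (C * J) := by
    have h2 : J * A = -(A * J) := by rw [hA, neg_neg]
    have h3 : J * C = -(C * J) := by rw [hC, neg_neg]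
    simp only [add_mul, mul_add, smul_mul_assoc, mul_smul_comm, h2, h3]
    module
  have h4 : ∀ B : Module.End ℝ (Eu m), B * J = -(J * B) →
      LinearMap.trace ℝ _ (B * J * J) = 0 := fun B hB => by
    have e1 : LinearMap.trace ℝ _ (B * J * J) = -LinearMap.trace ℝ _ (B * J * J) := by
      conv_lhs => rw [hB, neg_mul, map_neg, mul_assoc, LinearMap.trace_mul_comm]
    linarith
  have h5 : LinearMap.trace ℝ _ (C * A * J) = -LinearMap.trace ℝ _ (A * C * J) := by
    rw [mul_assoc, LinearMap.trace_mul_comm, mul_assoc, ← neg_eq_iff_eq_neg.mpr hC, mul_neg,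
      map_neg, mul_assoc]
  rw [h1]
  simp only [sub_mul, add_mul, smul_mul_assoc, map_sub, map_add, map_smul, h4 A hA, h4 C hC, h5,
    smul_eq_mul]
  ring

/-- The terms in which A and C act on different slots are symmetric in A and C and cancel. Forms
being contravariant, the order of composition is reversed. -/
theorem formDer_commutator {m n : ℕ} (Ψ : Eu m [⋀^Fin n]→L[ℝ] ℂ) (A C : Eu m →L[ℝ] Eu m)
    (w : Fin n → Eu m) :
    formDer (formDer Ψ A) C w - formDer (formDer Ψ C) A w = formDer Ψ (A * C - C * A) w := by
  have h : ∀ A C : Eu m →L[ℝ] Eu m, formDer (formDer Ψ A) C w =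
      ∑ i, Ψ (update w i (A (C (w i)))) +
        ∑ i, ∑ j, if j = i then 0 else Ψ (update (update w i (C (w i))) j (A (w j))) := by
    intro A C
    simp only [formDer_apply]
    rw [← Finset.sum_add_distrib]
    refine Finset.sum_congr rfl fun i _ => ?_
    have h1 : ∀ j, Ψ (update (update w i (C (w i))) j (A (update w i (C (w i)) j))) =
        (if j = i then Ψ (update w i (A (C (w i)))) else 0) +
        if j = i then 0 else Ψ (update (update w i (C (w i))) j (A (w j))) := by
      intro j
      by_cases hj : j = i
      · subst hj; simp
      · simp [hj]
    rw [Finset.sum_congr rfl fun j _ => h1 j, Finset.sum_add_distrib]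
    simp
  have h2 : ∑ i, ∑ j, (if j = i then 0 else Ψ (update (update w i (C (w i))) j (A (w j)))) =
      ∑ i, ∑ j, if j = i then 0 else Ψ (update (update w i (A (w i))) j (C (w j))) := by
    rw [Finset.sum_comm]
    refine Finset.sum_congr rfl fun i _ => Finset.sum_congr rfl fun j _ => ?_
    by_cases hj : j = i
    · simp [hj]
    · rw [if_neg hj, if_neg (Ne.symm hj), update_comm (Ne.symm hj)]
  rw [h, h, h2, formDer_apply]
  simp only [sub_apply, mul_apply_eq_comp, ContinuousAlternatingMap.map_update_sub,
    Finset.sum_sub_distrib]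
  ring

theorem hasFDerivAt_apply_update {m n : ℕ} {Ψ : Eu m → Eu m [⋀^Fin n]→L[ℝ] ℂ} {u : Eu m → Eu m}
    {u' : Eu m →L[ℝ] Eu m} {p : Eu m} (hΨ : DifferentiableAt ℝ Ψ p) (hu : HasFDerivAt u u' p)
    (w : Fin n → Eu m) (i : Fin n) : ∃ L : Eu m →L[ℝ] ℂ,
    HasFDerivAt (fun q => Ψ q (update w i (u q))) L p ∧
    ∀ Z, L Z = fderiv ℝ Ψ p Z (update w i (u p)) + Ψ p (update w i (u' Z)) := by
  have h1 := hΨ.hasFDerivAt.continuousAlternatingMap_apply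
      (g := fun k q => update w i (u q) k)
      (g' := fun k => if k = i then u' else 0) (fun k => by
        by_cases hk : k = i
        · subst hk
          simpa using hu
        · simp only [update_of_ne hk, hk, if_false]
          exact hasFDerivAt_const (w k) p)
  refine ⟨_, h1, fun Z => ?_⟩
  simp only [add_apply, sum_apply, ContinuousLinearMap.comp_apply]
  rw [Finset.sum_eq_single i (by intro k _ hk; simp [hk]) (by simp)]
  simp

/-- If the derivatives `g X` of `f` are differentiable, then their derivatives are symmetric. -/
theorem snd_deriv_symm {m : ℕ} {V : Type*} [NormedAddCommGroup V] [NormedSpace ℝ V]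
    {f : Eu m → V} {p : Eu m} (hf : ContDiffAt ℝ ∞ f p) {g : Eu m → Eu m → V}
    (hg : ∀ᶠ q in nhds p, ∀ X, fderiv ℝ f q X = g X q) {X Y : Eu m} {gX gY : Eu m →L[ℝ] V}
    (hX : HasFDerivAt (g X) gX p) (hY : HasFDerivAt (g Y) gY p) : gX Y = gY X := by
  have hd : DifferentiableAt ℝ (fderiv ℝ f) p :=
    (hf.fderiv_right (m := 1) (by norm_cast)).differentiableAt (by simp)
  have key : ∀ (X : Eu m) (gX : Eu m →L[ℝ] V), HasFDerivAt (g X) gX p → ∀ Y,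
      gX Y = fderiv ℝ (fderiv ℝ f) p Y X := by
    intro X gX hX Y
    have h1 : HasFDerivAt (fun q => fderiv ℝ f q X) gX p :=
      hX.congr_of_eventuallyEq (hg.mono fun q hq => hq X)
    have h2 := hd.hasFDerivAt.clm_apply (hasFDerivAt_const X p)
    rw [h1.unique h2]; simp
  rw [key X gX hX, key Y gY hY]
  exact (hf.isSymmSndFDerivAt (by simp; norm_cast)).eq Y X

/-- The connection form of `∇ + ξ` for a special almost Hermitian structure. -/
def suConn {m n : ℕ} (G : Eu m → Bil m) (J : Eu m → Eu m →L[ℝ] Eu m)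
    (Ψ : Eu m → Eu m [⋀^Fin n]→L[ℝ] ℂ) (v : Fin n → Eu m) (p : Eu m) :
    Eu m →L[ℝ] Eu m →L[ℝ] Eu m :=
  christoffelCLM G p + suTor G J Ψ v p

theorem suConn_apply {m n : ℕ} (G : Eu m → Bil m) (J : Eu m → Eu m →L[ℝ] Eu m)
    (Ψ : Eu m → Eu m [⋀^Fin n]→L[ℝ] ℂ) (v : Fin n → Eu m) (p X : Eu m) :
    suConn G J Ψ v p X = christoffelCLM G p X + suTor G J Ψ v p X := rfl

/-- The curvature as a continuous linear map. -/
def curvatureCLM {m : ℕ} (G : Eu m → Bil m) (p X Y : Eu m) : Eu m →L[ℝ] Eu m :=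
  fderiv ℝ (christoffelCLM G) p X Y - fderiv ℝ (christoffelCLM G) p Y X
    + christoffelCLM G p X * christoffelCLM G p Y - christoffelCLM G p Y * christoffelCLM G p X

theorem IsMetricOn.curvatureCLM_apply {m : ℕ} {U : Set (Eu m)} {G : Eu m → Bil m}
    (hG : IsMetricOn U G) {p : Eu m} (hp : p ∈ U) (X Y Z : Eu m) :
    curvatureCLM G p X Y Z = curvature G p X Y Z := by
  have h : ∀ X Y, fderiv ℝ (fun q => christoffel G q Y Z) p X
      = fderiv ℝ (christoffelCLM G) p X Y Z := fun X Y => by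
    have h1 := ((hG.christoffel_differentiableAt hp).hasFDerivAt.clm_apply
      (hasFDerivAt_const Y p)).clm_apply (hasFDerivAt_const Z p)
    have h2 := h1.fderiv
    simp only [christoffelCLM_apply] at h2
    rw [h2]; simp
  rw [curvature, h, h]
  rfl

/-- The trace on continuous endomorphisms. -/
def ctrace {m : ℕ} : (Eu m →L[ℝ] Eu m) →L[ℝ] ℝ :=
  LinearMap.toContinuousLinearMap
    (LinearMap.trace ℝ (Eu m) ∘ₗ ContinuousLinearMap.coeLM ℝ)

theorem ctrace_apply {m : ℕ} (A : Eu m →L[ℝ] Eu m) :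
    ctrace A = LinearMap.trace ℝ (Eu m) (A : Module.End ℝ (Eu m)) := rfl

theorem ctrace_mul_comm {m : ℕ} (A C : Eu m →L[ℝ] Eu m) : ctrace (A * C) = ctrace (C * A) :=
  LinearMap.trace_mul_comm ℝ (A : Module.End ℝ (Eu m)) (C : Module.End ℝ (Eu m))

/-! ### The curvature of the SU(n)-connection and the derivative of μ -/

namespace IsSUOn

variable {n : ℕ} {U : Set (Eu (2 * n))} {G : Eu (2 * n) → Bil (2 * n)}
    {J : Eu (2 * n) → Eu (2 * n) →L[ℝ] Eu (2 * n)}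
    {Ψ : Eu (2 * n) → Eu (2 * n) [⋀^Fin n]→L[ℝ] ℂ} (hS : IsSUOn U G J Ψ)
    {p : Eu (2 * n)} (hp : p ∈ U) {v : Fin n → Eu (2 * n)}
include hS hp

theorem eventually_ne (hv : Ψ p v ≠ 0) : ∀ᶠ q in nhds p, q ∈ U ∧ Ψ q v ≠ 0 := by
  have h : ContinuousAt (fun q => Ψ q v) p :=
    ((hS.differentiableAt hp).hasFDerivAt.continuousAlternatingMap_apply_const v).continuousAt
  filter_upwards [hS.isOpen.mem_nhds hp, h.eventually_ne hv] with q h1 h2 using ⟨h1, h2⟩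

theorem muForm_differentiableAt (hn : n ≠ 0) (hv : Ψ p v ≠ 0) :
    DifferentiableAt ℝ (muForm G J Ψ v) p :=
  (hS.contDiffAt_muForm hp hn hv).differentiableAt (by simp)

theorem suTor_differentiableAt (hn : n ≠ 0) (hv : Ψ p v ≠ 0) :
    DifferentiableAt ℝ (suTor G J Ψ v) p := by
  refine (hS.isHermitianOn.uTor_differentiableAt hp).add ?_
  have h1 : (fun q => (muForm G J Ψ v q).smulRight (J q)) = fun q =>
    ContinuousLinearMap.smulRightL ℝ (Eu (2 * n)) (Eu (2 * n) →L[ℝ] Eu (2 * n))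
      (muForm G J Ψ v q) (J q) := rfl
  rw [h1]
  exact ((differentiableAt_const _).clm_apply (hS.muForm_differentiableAt hp hn hv)).clm_apply
    (hS.isHermitianOn.J_differentiableAt hp)

theorem suConn_differentiableAt (hn : n ≠ 0) (hv : Ψ p v ≠ 0) :
    DifferentiableAt ℝ (suConn G J Ψ v) p :=
  (hS.isHermitianOn.isMetricOn.christoffel_differentiableAt hp).add
    (hS.suTor_differentiableAt hp hn hv)

theorem fderiv_Ψ_eq (hn : n ≠ 0) (hv : Ψ p v ≠ 0) (X : Eu (2 * n)) (w : Fin n → Eu (2 * n)) :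
    fderiv ℝ Ψ p X w = formDer (Ψ p) (suConn G J Ψ v p X) w := by
  have h := (hS.isSUTorsion_suTor hp hn hv X).2.2 w
  rw [covForm] at h
  simp only [formDer_apply, suConn_apply, add_apply, ContinuousAlternatingMap.map_update_add,
    Finset.sum_add_distrib, christoffelCLM_apply]
  simp only [toTor_apply] at h
  linear_combination h

theorem fderiv_J_eq (hn : n ≠ 0) (hv : Ψ p v ≠ 0) (X : Eu (2 * n)) :
    fderiv ℝ J p X = J p * suConn G J Ψ v p X - suConn G J Ψ v p X * J p := by
  ext1 Y
  have h := (hS.isSUTorsion_suTor hp hn hv X).2.1 Y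
  simp only [toTor_apply, covJ] at h
  simp only [suConn_apply, sub_apply, mul_apply_eq_comp, add_apply, map_add, christoffelCLM_apply]
  linear_combination (norm := module) h

/-- The curvature of the connection `∇ + ξ` takes its values in `su`. -/
theorem trace_suCurvature (hn : n ≠ 0) (hv : Ψ p v ≠ 0) (X Y : Eu (2 * n)) :
    ctrace ((fderiv ℝ (suConn G J Ψ v) p X Y - fderiv ℝ (suConn G J Ψ v) p Y X
      + (suConn G J Ψ v p X * suConn G J Ψ v p Y - suConn G J Ψ v p Y * suConn G J Ψ v p X))
      * J p) = 0 := by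
  set B := suConn G J Ψ v with hB
  have hBd := (hS.suConn_differentiableAt hp hn hv).hasFDerivAt
  rw [← hB] at hBd
  have hBX : ∀ X, HasFDerivAt (fun q => B q X) ((fderiv ℝ B p).flip X) p := fun X => by
    simpa using hBd.clm_apply (hasFDerivAt_const X p)
  have hJd := (hS.isHermitianOn.J_differentiableAt hp).hasFDerivAt
  have hU := hS.isOpen.mem_nhds hp
  set F := fderiv ℝ B p X Y - fderiv ℝ B p Y X + (B p X * B p Y - B p Y * B p X) with hF
  -- Symmetry of the second derivatives of J, where dJ = [J, B] for the connection form B.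
  have hJF : F * J p = J p * F := by
    have hsym := snd_deriv_symm (f := J) (hS.isHermitianOn.smooth_J.contDiffAt hU)
      (g := fun X q => J q * B q X - B q X * J q)
      ((hS.eventually_ne hp hv).mono fun q hq X => hS.fderiv_J_eq hq.1 hn hq.2 X)
      ((hJd.mul' (hBX X)).sub ((hBX X).mul' hJd)) ((hJd.mul' (hBX Y)).sub ((hBX Y).mul' hJd))
    simp only [sub_apply, add_apply, smul_apply, ContinuousLinearMap.flip_apply,
      hS.fderiv_J_eq hp hn hv, ← hB, smul_eq_mul, MulOpposite.smul_eq_mul_unop,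
      MulOpposite.unop_op] at hsym
    rw [hF]
    rw [← sub_eq_zero] at hsym ⊢
    rw [← hsym]
    noncomm_ring
  -- The same argument for Ψ: differentiating dΨ = B·Ψ once more and antisymmetrizing shows that the
  -- curvature F annihilates Ψ.
  have hΨF : ∀ w, ∑ i, Ψ p (update w i (F (w i))) = 0 := by
    intro w
    have hL : ∀ X, ∃ L : Eu (2 * n) →L[ℝ] ℂ,
        HasFDerivAt (fun q => formDer (Ψ q) (B q X) w) L p ∧
        ∀ Z, L Z = formDer (formDer (Ψ p) (B p Z)) (B p X) w
          + formDer (Ψ p) (fderiv ℝ B p Z X) w := by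
      intro X
      have h1 : ∀ i, HasFDerivAt (fun q => B q X (w i))
          (((fderiv ℝ B p).flip X).flip (w i)) p := fun i => by
        simpa using (hBX X).clm_apply (hasFDerivAt_const (w i) p)
      choose L hL1 hL2 using fun i =>
        hasFDerivAt_apply_update (hS.differentiableAt hp) (h1 i) w i
      refine ⟨∑ i, L i, ?_, fun Z => ?_⟩
      · simp only [formDer_apply]
        exact HasFDerivAt.fun_sum fun i _ => hL1 i
      · rw [sum_apply, Finset.sum_congr rfl fun i _ => hL2 i Z, Finset.sum_add_distrib]
        rw [formDer_apply (formDer (Ψ p) (B p Z)), formDer_apply (Ψ p) (fderiv ℝ B p Z X)]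
        congr 1
        exact Finset.sum_congr rfl fun i _ => hS.fderiv_Ψ_eq hp hn hv Z _
    obtain ⟨LX, hX1, hX2⟩ := hL X
    obtain ⟨LY, hY1, hY2⟩ := hL Y
    have hsym := snd_deriv_symm (f := fun q => Ψ q w)
      ((contDiffAt_const (c := ContinuousAlternatingMap.apply ℝ (Eu (2 * n)) ℂ w)).clm_apply
        (hS.smooth_Ψ.contDiffAt hU)) (g := fun X q => formDer (Ψ q) (B q X) w)
      ((hS.eventually_ne hp hv).mono fun q hq X => by
        rw [((hS.differentiableAt hq.1).hasFDerivAt.continuousAlternatingMap_apply_const w).fderiv]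
        exact hS.fderiv_Ψ_eq hq.1 hn hq.2 X w) hX1 hY1
    rw [hX2, hY2] at hsym
    have hc := formDer_commutator (Ψ p) (B p X) (B p Y) w
    rw [← formDer_apply, hF, map_add, map_sub, ContinuousAlternatingMap.add_apply, ← hc,
      ContinuousAlternatingMap.sub_apply]
    linear_combination -hsym
  refine trace_mul_eq_zero_of_type (f := (Ψ p).toAlternatingMap) (by simp) (hS.J_mul_J hp)
    (hS.type p hp) (hS.exists_ne_zero hp) ?_ hΨF
  ext1 Z
  exact DFunLike.congr_fun hJF Z

/-- This recovers μ from the torsion as a trace, so that its derivative is expressed by those of ξ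
and J. -/
theorem ctrace_suTor (X : Eu (2 * n)) :
    ctrace (suTor G J Ψ v p X * J p) = -(2 * n) * muForm G J Ψ v p X := by
  have H := hS.isHermitianOn.herm p hp
  have h1 : suTor G J Ψ v p X * J p = uTor G J p X * J p + muForm G J Ψ v p X • (J p * J p) := by
    ext Y; rfl
  have h2 : ctrace (uTor G J p X * J p) = 0 :=
    trace_mul_J_of_anticomm (H.mem_perp_u_iff.mp (hS.isHermitianOn.uTor_mem hp X)).2
  have h3 : ctrace (J p * J p) = -((2 * n : ℕ) : ℝ) := H.trace_J_mul_J
  rw [h1, map_add, map_smul, h2, h3]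
  push_cast; simp; ring

theorem fderiv_muForm (hn : n ≠ 0) (hv : Ψ p v ≠ 0) (X Y : Eu (2 * n)) :
    -(2 * n) * fderiv ℝ (muForm G J Ψ v) p X Y =
      ctrace (fderiv ℝ (suTor G J Ψ v) p X Y * J p)
        + ctrace (suTor G J Ψ v p Y * (J p * suConn G J Ψ v p X - suConn G J Ψ v p X * J p)) := by
  have hξd := hS.suTor_differentiableAt hp hn hv
  have hJd := (hS.isHermitianOn.J_differentiableAt hp).hasFDerivAt
  have h1 := ctrace.hasFDerivAt.comp p
    ((hξd.hasFDerivAt.clm_apply (hasFDerivAt_const Y p)).mul' hJd)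
  have h2 := ((hS.muForm_differentiableAt hp hn hv).hasFDerivAt.clm_apply
    (hasFDerivAt_const Y p)).const_mul (-(2 * n) : ℝ)
  have h3 : (ctrace ∘ fun q => suTor G J Ψ v q Y * J q) =ᶠ[nhds p]
      fun q => -(2 * n) * muForm G J Ψ v q Y := by
    filter_upwards [hS.isOpen.mem_nhds hp] with q hq using hS.ctrace_suTor hq Y
  have h4 := DFunLike.congr_fun ((h2.congr_of_eventuallyEq h3).unique h1) X
  rw [← hS.fderiv_J_eq hp hn hv, add_comm, ← map_add]
  simp only [ContinuousLinearMap.comp_apply, add_apply, smul_apply, smul_eq_mul, zero_apply,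
    MulOpposite.smul_eq_mul_unop, MulOpposite.unop_op, ContinuousLinearMap.flip_apply, map_zero,
    zero_add] at h4
  exact h4

-- Trace bookkeeping only: after expansion, cyclicity matches the mixed Γ-ξ terms of tr(R' J) with
-- those in the derivative of tr(ξJ), and leaves the commutator of ξ. Here `a` and `c` stand for the
-- derivatives of ξ, and `g₁` and `g₂` for those of Γ.
omit hS hp in
theorem ctrace_curvature_algebra {m : ℕ} {M N : ℝ} {g₁ g₂ a c Γx Γy ξx ξy K : Eu m →L[ℝ] Eu m}
    (m1 : M = ctrace (a * K) + ctrace (ξy * (K * (Γx + ξx) - (Γx + ξx) * K)))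
    (m2 : N = ctrace (c * K) + ctrace (ξx * (K * (Γy + ξy) - (Γy + ξy) * K)))
    (h : ctrace ((g₁ + a - (g₂ + c) + ((Γx + ξx) * (Γy + ξy) - (Γy + ξy) * (Γx + ξx))) * K) = 0) :
    ctrace ((g₁ - g₂ + Γx * Γy - Γy * Γx) * K) =
      N - M + ctrace ((ξx * ξy - ξy * ξx) * K) := by
  have c1 := ctrace_mul_comm Γx (ξy * K)
  have c2 := ctrace_mul_comm Γy (ξx * K)
  have c3 := ctrace_mul_comm ξx (ξy * K)
  have c4 := ctrace_mul_comm ξy (ξx * K)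
  simp only [add_mul, mul_add, sub_mul, mul_sub, map_add, map_sub, ← mul_assoc] at *
  linarith

/-- The Ricci form of the Levi-Civita connection in terms of the torsion. -/
theorem ctrace_curvature (hn : n ≠ 0) (hv : Ψ p v ≠ 0) (X Y : Eu (2 * n)) :
    ctrace (curvatureCLM G p X Y * J p) =
      2 * n * (fderiv ℝ (muForm G J Ψ v) p X Y - fderiv ℝ (muForm G J Ψ v) p Y X)
        + 2 * ctrace (uTor G J p X * uTor G J p Y * J p) := by
  have H := hS.isHermitianOn.herm p hp
  have hc := hS.trace_suCurvature hp hn hv X Y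
  have hdB : fderiv ℝ (suConn G J Ψ v) p =
      fderiv ℝ (christoffelCLM G) p + fderiv ℝ (suTor G J Ψ v) p :=
    ((hS.isHermitianOn.isMetricOn.christoffel_differentiableAt hp).hasFDerivAt.add
      (hS.suTor_differentiableAt hp hn hv).hasFDerivAt).fderiv
  have hq : ctrace ((suTor G J Ψ v p X * suTor G J Ψ v p Y - suTor G J Ψ v p Y * suTor G J Ψ v p X)
      * J p) = 2 * ctrace (uTor G J p X * uTor G J p Y * J p) :=
    trace_commutator_of_anticomm ((H.mem_perp_u_iff.mp (hS.isHermitianOn.uTor_mem hp X)).2)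
      ((H.mem_perp_u_iff.mp (hS.isHermitianOn.uTor_mem hp Y)).2) _ _
  have m1 := hS.fderiv_muForm hp hn hv X Y
  have m2 := hS.fderiv_muForm hp hn hv Y X
  rw [← hq, curvatureCLM]
  simp only [suConn_apply, hdB, add_apply] at m1 m2 hc
  rw [ctrace_curvature_algebra m1 m2 hc]
  ring

end IsSUOn

end Curvature

/-! ## The `*`-scalar curvature and a divergence -/

section StarScalar

variable {m : ℕ}

theorem curvatureCLM_antisymm (G : Eu m → Bil m) (p X Y : Eu m) :
    curvatureCLM G p X Y = -curvatureCLM G p Y X := by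
  simp only [curvatureCLM]; abel

theorem curvatureCLM_add_left (G : Eu m → Bil m) (p X X' Y : Eu m) :
    curvatureCLM G p (X + X') Y = curvatureCLM G p X Y + curvatureCLM G p X' Y := by
  simp only [curvatureCLM, map_add, add_apply, add_mul, mul_add]; abel

theorem curvatureCLM_smul_left (G : Eu m → Bil m) (p : Eu m) (c : ℝ) (X Y : Eu m) :
    curvatureCLM G p (c • X) Y = c • curvatureCLM G p X Y := by
  simp only [curvatureCLM, map_smul, smul_apply, smul_mul_assoc, mul_smul_comm]; module

/-- Torsion-freeness makes Γ and its derivative symmetric in the two vector arguments, and all terms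
cancel in pairs. -/
theorem IsMetricOn.bianchi {U : Set (Eu m)} {G : Eu m → Bil m} (hG : IsMetricOn U G) {p : Eu m}
    (hp : p ∈ U) (X Y Z : Eu m) :
    curvatureCLM G p X Y Z + curvatureCLM G p Y Z X + curvatureCLM G p Z X Y = 0 := by
  have hs : ∀ q ∈ U, ∀ v w, christoffelCLM G q v w = christoffelCLM G q w v :=
    fun q hq => hG.christoffel_symm hq
  have hd : ∀ x v w, fderiv ℝ (christoffelCLM G) p x v w = fderiv ℝ (christoffelCLM G) p x w v := by
    intro x v w
    have h : ∀ v w, HasFDerivAt (fun q => christoffelCLM G q v w)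
        (((fderiv ℝ (christoffelCLM G) p).flip v).flip w) p := fun v w => by
      simpa using ((hG.christoffel_differentiableAt hp).hasFDerivAt.clm_apply
        (hasFDerivAt_const v p)).clm_apply (hasFDerivAt_const w p)
    have e : (fun q => christoffelCLM G q v w) =ᶠ[nhds p] fun q => christoffelCLM G q w v := by
      filter_upwards [hG.isOpen.mem_nhds hp] with q hq using hs q hq v w
    exact DFunLike.congr_fun ((h v w).unique ((h w v).congr_of_eventuallyEq e)) x
  simp only [curvatureCLM, add_apply, sub_apply, mul_apply_eq_comp]
  rw [hs p hp Y Z, hs p hp X Z, hs p hp Y X, hd X Y Z, hd Y X Z, hd Z X Y]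
  abel

/-- Pair the Bianchi identity for e_i, Je_i, e_j with Je_j and sum. The first term is minus the
trace on the right; the other two are each s*, the second after replacing the frame e_i by Je_i. -/
theorem IsHermitianOn.starScalar_eq {U : Set (Eu m)} {G : Eu m → Bil m}
    {J : Eu m → Eu m →L[ℝ] Eu m} (hS : IsHermitianOn U G J) {p : Eu m} (hp : p ∈ U) :
    starScalar G J p = (1 / 2) * ∑ i, ctrace
      (curvatureCLM G p (frame (G p) i) (J p (frame (G p) i)) * J p) := by
  have hM := hS.isMetricOn
  have H := hS.herm p hp
  have hJ : ∀ v, J p (J p v) = -v := H.sq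
  set e := frame (G p)
  have he : IsOrthonormalFrame (G p) e := H.frame
  have hs : starScalar G J p = ∑ i, ∑ j, G p (curvatureCLM G p (e j) (e i) (J p (e i)))
      (J p (e j)) := by
    rw [Finset.sum_comm]
    simp only [starScalar, hM.curvatureCLM_apply hp, e]
  have h1 : ∀ i, ctrace (curvatureCLM G p (e i) (J p (e i)) * J p) =
      -∑ j, G p (curvatureCLM G p (e i) (J p (e i)) (e j)) (J p (e j)) := by
    intro i
    rw [ctrace_mul_comm, ctrace_apply, he.trace_eq, ← Finset.sum_neg_distrib]
    exact Finset.sum_congr rfl fun j _ => H.J_left _ _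
  have h2 : ∑ i, ∑ j, G p (curvatureCLM G p (J p (e i)) (e j) (e i)) (J p (e j)) =
      ∑ i, ∑ j, G p (curvatureCLM G p (e j) (e i) (J p (e i))) (J p (e j)) := by
    rw [Finset.sum_comm]
    conv_rhs => rw [Finset.sum_comm]
    refine Finset.sum_congr rfl fun j _ => ?_
    let β : Eu m →ₗ[ℝ] Eu m →ₗ[ℝ] ℝ := LinearMap.mk₂ ℝ
      (fun x y => G p (curvatureCLM G p (J p x) (e j) y) (J p (e j)))
      (by intros; simp only [map_add, curvatureCLM_add_left, add_apply])
      (by intros; simp only [map_smul, curvatureCLM_smul_left, smul_apply])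
      (by intros; simp only [map_add, add_apply])
      (by intros; simp only [map_smul, smul_apply])
    have h := he.sum_congr H.symm (H.J_frame he) β
    simp only [β, LinearMap.mk₂_apply] at h
    rw [← h]
    refine Finset.sum_congr rfl fun i _ => ?_
    simp only [ContinuousLinearMap.coe_coe]
    rw [hJ, curvatureCLM_antisymm, ← neg_one_smul ℝ (e i), curvatureCLM_antisymm,
      curvatureCLM_smul_left, curvatureCLM_antisymm _ _ (e i)]
    simp
  have h3 : ∀ i j, G p (curvatureCLM G p (e i) (J p (e i)) (e j)) (J p (e j))
      + G p (curvatureCLM G p (J p (e i)) (e j) (e i)) (J p (e j))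
      + G p (curvatureCLM G p (e j) (e i) (J p (e i))) (J p (e j)) = 0 := by
    intro i j
    have := congrArg (fun z => G p z (J p (e j))) (hM.bianchi hp (e i) (J p (e i)) (e j))
    simpa only [map_add, add_apply, map_zero, zero_apply] using this
  have h4 : ∑ i, ∑ j, (G p (curvatureCLM G p (e i) (J p (e i)) (e j)) (J p (e j))
      + G p (curvatureCLM G p (J p (e i)) (e j) (e i)) (J p (e j))
      + G p (curvatureCLM G p (e j) (e i) (J p (e i))) (J p (e j))) = 0 := by
    simp only [h3, Finset.sum_const_zero]
  simp only [Finset.sum_add_distrib, h2, ← hs] at h4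
  simp only [h1, Finset.sum_neg_distrib]
  linarith

/-- The divergence of a vector field `V` at `p`. -/
def divAt (G : Eu m → Bil m) (V : Eu m → Eu m) (p : Eu m) : ℝ :=
  ctrace (fderiv ℝ V p + (christoffelCLM G p).flip (V p))

/-- The vector field dual to the one-form `η` of a special almost Hermitian structure. -/
def etaField {n : ℕ} (G : Eu m → Bil m) (J : Eu m → Eu m →L[ℝ] Eu m)
    (Ψ : Eu m → Eu m [⋀^Fin n]→L[ℝ] ℂ) (p : Eu m) : Eu m :=
  ∑ k, etaForm (G p) (J p) (suTorsionAt G J Ψ p) (frame (G p) k) • frame (G p) k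

/-- The trace that expresses `|ξ¹²|² - |ξ³⁴|²`. -/
def quadTrace (G : Eu m → Bil m) (J : Eu m → Eu m →L[ℝ] Eu m) (p : Eu m) : ℝ :=
  ∑ i, ctrace (uTor G J p (frame (G p) i) * uTor G J p (J p (frame (G p) i)) * J p)

/-! ### The divergence of η♯ and the pointwise formula -/

namespace IsSUOn

variable {n : ℕ} {U : Set (Eu (2 * n))} {G : Eu (2 * n) → Bil (2 * n)}
    {J : Eu (2 * n) → Eu (2 * n) →L[ℝ] Eu (2 * n)}
    {Ψ : Eu (2 * n) → Eu (2 * n) [⋀^Fin n]→L[ℝ] ℂ} (hS : IsSUOn U G J Ψ)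
    {p : Eu (2 * n)} (hp : p ∈ U) {v : Fin n → Eu (2 * n)}
include hS hp

theorem etaForm_eq (hn : n ≠ 0) (hv : Ψ p v ≠ 0) (X : Eu (2 * n)) :
    etaForm (G p) (J p) (suTorsionAt G J Ψ p) X = -muForm G J Ψ v p (J p X) := by
  have h := hS.ctrace_suTor (v := v) hp (J p X)
  rw [ctrace_apply, (hS.isHermitianOn.herm p hp).frame.trace_eq] at h
  rw [etaForm, hS.suTorsionAt_eq hp hn hv]
  have hn' : (n : ℝ) ≠ 0 := by exact_mod_cast hn
  have h1 : ∑ i, G p (toTor (suTor G J Ψ v p) (-(J p : Module.End ℝ (Eu (2 * n))) X)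
      ((J p : Module.End ℝ (Eu (2 * n))) (frame (G p) i))) (frame (G p) i)
      = 2 * n * muForm G J Ψ v p (J p X) := by
    have h2 : -(2 * n) * muForm G J Ψ v p (J p X) = ∑ i, G p (suTor G J Ψ v p (J p X)
      (J p (frame (G p) i))) (frame (G p) i) := h.symm
    have h3 : 2 * n * muForm G J Ψ v p (J p X) = -(-(2 * n) * muForm G J Ψ v p (J p X)) := by ring
    rw [h3, h2, ← Finset.sum_neg_distrib]
    refine Finset.sum_congr rfl fun i _ => ?_
    simp
  rw [h1]
  push_cast
  field_simp

theorem etaField_spec (hn : n ≠ 0) (hv : Ψ p v ≠ 0) (Z : Eu (2 * n)) :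
    G p (etaField G J Ψ p) Z = -muForm G J Ψ v p (J p Z) := by
  have hM := hS.isHermitianOn.isMetricOn
  conv_rhs => rw [← (hM.frame hp).sum_smul Z]
  simp only [etaField, hS.etaForm_eq hp hn hv, map_sum, map_smul, sum_apply, smul_apply,
    smul_eq_mul, ← Finset.sum_neg_distrib, hM.symm p hp Z]
  exact Finset.sum_congr rfl fun k _ => by ring

/-- Near p the field is the metric dual of -μ ∘ J, where one tuple `v` serves for a whole
neighbourhood because Ψ(v) ≠ 0 is an open condition. -/
theorem contDiffAt_etaField (hn : n ≠ 0) : ContDiffAt ℝ ∞ (etaField G J Ψ) p := by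
  obtain ⟨v, hv⟩ := hS.exists_ne_zero hp
  have hM := hS.isHermitianOn.isMetricOn
  have h1 : ContDiffAt ℝ ∞ (fun q => (G q).inverse (-(muForm G J Ψ v q ∘L J q))) p :=
    (hM.contDiffOn_inverse.contDiffAt (hS.isOpen.mem_nhds hp)).clm_apply
      (((hS.contDiffAt_muForm hp hn hv).clm_comp
        (hS.isHermitianOn.smooth_J.contDiffAt (hS.isOpen.mem_nhds hp))).neg)
  refine h1.congr_of_eventuallyEq ?_
  filter_upwards [hS.eventually_ne hp hv] with q hq
  refine hM.ext hq.1 fun Z => ?_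
  rw [hS.etaField_spec hq.1 hn hq.2, bil_inverse_apply (hM.pos q hq.1)]
  rfl

/-- Differentiate g(η♯, Z) = -μ(JZ) and trace. The derivative may fall on μ or on J; the second kind
of term produces χ. -/
theorem divAt_etaField (hn : n ≠ 0) (hv : Ψ p v ≠ 0) :
    divAt G (etaField G J Ψ) p =
      -∑ i, fderiv ℝ (muForm G J Ψ v) p (frame (G p) i) (J p (frame (G p) i))
        - 2 * muForm G J Ψ v p (J p (chi (G p) (toTor (uTor G J p)))) := by
  have hM := hS.isHermitianOn.isMetricOn
  have H := hS.isHermitianOn.herm p hp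
  have hJ : ∀ v, J p (J p v) = -v := H.sq
  have hJd := (hS.isHermitianOn.J_differentiableAt hp).hasFDerivAt
  have hVd := ((hS.contDiffAt_etaField hp hn).differentiableAt (by simp)).hasFDerivAt
  have hμd := (hS.muForm_differentiableAt hp hn hv).hasFDerivAt
  set V := etaField G J Ψ with hV
  set μ := muForm G J Ψ v with hμ
  have h1 : ∀ X Z, G p (fderiv ℝ V p X + christoffel G p X (V p)) Z =
      -fderiv ℝ μ p X (J p Z) - μ p (fderiv ℝ J p X Z) + μ p (J p (christoffel G p X Z)) := by
    intro X Z
    have d1 := ((hM.differentiableAt hp).hasFDerivAt.clm_apply hVd).clm_apply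
      (hasFDerivAt_const Z p)
    have d2 := (hμd.clm_apply (hJd.clm_apply (hasFDerivAt_const Z p))).neg
    have e : (fun q => G q (V q) Z) =ᶠ[nhds p] -fun q => μ q (J q Z) := by
      filter_upwards [hS.eventually_ne hp hv] with q hq using hS.etaField_spec hq.1 hn hq.2 Z
    have h2 := DFunLike.congr_fun (d1.unique (d2.congr_of_eventuallyEq e)) X
    simp only [ContinuousLinearMap.comp_apply, add_apply, zero_apply, neg_apply,
      ContinuousLinearMap.flip_apply, map_zero, zero_add, hM.fderiv_eq hp] at h2
    have h3 := hS.etaField_spec hp hn hv (christoffel G p X Z)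
    rw [← hV, ← hμ] at h3
    rw [map_add, add_apply]
    linarith
  -- Γ is symmetric, whereas (X,Y) ↦ (X, JY) traced in the frame Je_i yields the negative of the
  -- same sum.
  have h2 : ∑ i, christoffel G p (frame (G p) i) (J p (frame (G p) i)) = 0 := by
    let β : Eu (2 * n) →ₗ[ℝ] Eu (2 * n) →ₗ[ℝ] Eu (2 * n) :=
      (toTor (christoffelCLM G p)).compl₁₂ LinearMap.id (J p : Module.End ℝ (Eu (2 * n)))
    have h := H.frame.sum_congr H.symm (H.J_frame H.frame) β
    have h' : ∑ i, christoffelCLM G p (J p (frame (G p) i)) (J p (J p (frame (G p) i))) =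
      ∑ i, christoffelCLM G p (frame (G p) i) (J p (frame (G p) i)) := h
    have h'' : ∑ i, christoffelCLM G p (J p (frame (G p) i)) (J p (J p (frame (G p) i))) =
      -∑ i, christoffelCLM G p (frame (G p) i) (J p (frame (G p) i)) := by
      rw [← Finset.sum_neg_distrib]
      refine Finset.sum_congr rfl fun i _ => ?_
      rw [hJ, map_neg]
      congr 1
      exact hM.christoffel_symm hp _ _
    rw [h''] at h'
    have h3 : (2 : ℝ) • ∑ i, christoffelCLM G p (frame (G p) i) (J p (frame (G p) i)) = 0 := by
      rw [two_smul]; nth_rewrite 1 [← h']; simp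
    exact (smul_eq_zero.mp h3).resolve_left two_ne_zero
  -- This is ∑ (∇_{e_i} J) e_i = 2Jχ, because ∇J = 2Jξ^{U(n)} and the remaining Christoffel term was
  -- just seen to vanish.
  have h3 : ∑ i, (fderiv ℝ J p (frame (G p) i) (frame (G p) i)
      - J p (christoffel G p (frame (G p) i) (frame (G p) i))) =
      (2 : ℝ) • J p (chi (G p) (toTor (uTor G J p))) := by
    have h4 : ∀ i, fderiv ℝ J p (frame (G p) i) (frame (G p) i)
      - J p (christoffel G p (frame (G p) i) (frame (G p) i)) =
      (2 : ℝ) • J p (uTor G J p (frame (G p) i) (frame (G p) i))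
        - christoffel G p (frame (G p) i) (J p (frame (G p) i)) := fun i => by
      rw [hS.isHermitianOn.two_smul_J_uTor hp, covJ]; abel
    rw [Finset.sum_congr rfl fun i _ => h4 i, Finset.sum_sub_distrib, h2, sub_zero,
      ← Finset.smul_sum, ← map_sum]
    rfl
  have h5 : divAt G V p = ∑ i, G p (fderiv ℝ V p (frame (G p) i)
      + christoffel G p (frame (G p) i) (V p)) (frame (G p) i) := by
    rw [divAt, ctrace_apply, H.frame.trace_eq]; rfl
  have h6 : ∑ i, (μ p (fderiv ℝ J p (frame (G p) i) (frame (G p) i))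
      - μ p (J p (christoffel G p (frame (G p) i) (frame (G p) i)))) =
      2 * μ p (J p (chi (G p) (toTor (uTor G J p)))) := by
    simp only [← map_sub, ← map_sum]
    rw [h3, map_smul, smul_eq_mul]
  rw [h5, ← h6, ← Finset.sum_neg_distrib, ← Finset.sum_sub_distrib]
  exact Finset.sum_congr rfl fun i _ => by rw [h1]; ring

/-- The pointwise formula for the `*`-scalar curvature. -/
theorem starScalar_eq (hn : n ≠ 0) : starScalar G J p = quadTrace G J p
    + 4 * n * etaForm (G p) (J p) (suTorsionAt G J Ψ p) (chi (G p) (uTorsionAt G J p))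
    - 2 * n * divAt G (etaField G J Ψ) p := by
  obtain ⟨v, hv⟩ := hS.exists_ne_zero hp
  have hM := hS.isHermitianOn.isMetricOn
  have H := hS.isHermitianOn.herm p hp
  have hJ : ∀ v, J p (J p v) = -v := H.sq
  -- Passing to the frame Je_i shows that the two halves of ∑ dμ(e_i, Je_i) contribute equally.
  have h1 : ∑ i, fderiv ℝ (muForm G J Ψ v) p (J p (frame (G p) i)) (frame (G p) i) =
      -∑ i, fderiv ℝ (muForm G J Ψ v) p (frame (G p) i) (J p (frame (G p) i)) := by
    let β : Eu (2 * n) →ₗ[ℝ] Eu (2 * n) →ₗ[ℝ] ℝ :=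
      (ContinuousLinearMap.coeLM ℝ ∘ₗ (fderiv ℝ (muForm G J Ψ v) p).toLinearMap).compl₁₂
        (J p : Module.End ℝ (Eu (2 * n))) LinearMap.id
    have h : ∑ i, fderiv ℝ (muForm G J Ψ v) p (J p (J p (frame (G p) i))) (J p (frame (G p) i)) =
      ∑ i, fderiv ℝ (muForm G J Ψ v) p (J p (frame (G p) i)) (frame (G p) i) :=
      H.frame.sum_congr H.symm (H.J_frame H.frame) β
    rw [← h, ← Finset.sum_neg_distrib]
    exact Finset.sum_congr rfl fun i _ => by rw [hJ, map_neg]; rfl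
  rw [hS.isHermitianOn.starScalar_eq hp, hS.divAt_etaField hp hn hv, hS.etaForm_eq hp hn hv,
    hS.isHermitianOn.uTorsionAt_eq hp, quadTrace]
  simp only [hS.ctrace_curvature hp hn hv, Finset.sum_add_distrib, ← Finset.mul_sum,
    Finset.sum_sub_distrib, h1]
  ring

end IsSUOn

end StarScalar

/-! ## Coordinate changes -/

section Transition

open Function

variable {m : ℕ}

/-- The map `Φ` is an isometry of `G` to `G'` near every point of `O`. -/
structure IsIsometryOn (O U U' : Set (Eu m)) (Φ : Eu m → Eu m) (G G' : Eu m → Bil m) : Prop where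
  isOpen : IsOpen O
  smooth : ContDiffOn ℝ ∞ Φ O
  subset : O ⊆ U
  mapsTo : ∀ q ∈ O, Φ q ∈ U'
  source : IsMetricOn U G
  target : IsMetricOn U' G'
  metric : ∀ q ∈ O, ∀ v w, G q v w = G' (Φ q) (fderiv ℝ Φ q v) (fderiv ℝ Φ q w)

namespace IsIsometryOn

variable {O U U' : Set (Eu m)} {Φ : Eu m → Eu m} {G G' : Eu m → Bil m}
  (hΦ : IsIsometryOn O U U' Φ G G') {p : Eu m} (hp : p ∈ O)
include hΦ hp

theorem hasFDerivAt : HasFDerivAt Φ (fderiv ℝ Φ p) p :=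
  ((hΦ.smooth.contDiffAt (hΦ.isOpen.mem_nhds hp)).differentiableAt (by simp)).hasFDerivAt

theorem hasFDerivAt_fderiv : HasFDerivAt (fderiv ℝ Φ) (fderiv ℝ (fderiv ℝ Φ) p) p :=
  (((hΦ.smooth.contDiffAt (hΦ.isOpen.mem_nhds hp)).fderiv_right (m := 1)
    (by norm_cast)).differentiableAt (by simp)).hasFDerivAt

theorem snd_symm (v w : Eu m) : fderiv ℝ (fderiv ℝ Φ) p v w = fderiv ℝ (fderiv ℝ Φ) p w v :=
  ((hΦ.smooth.contDiffAt (hΦ.isOpen.mem_nhds hp)).isSymmSndFDerivAt (by simp; norm_cast)).eq v w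

theorem injective : Injective (fderiv ℝ Φ p) := by
  intro v w h
  by_contra hvw
  have h1 := hΦ.source.pos p (hΦ.subset hp) (v - w) (sub_ne_zero.mpr hvw)
  rw [hΦ.metric p hp, map_sub, h, sub_self] at h1
  simp at h1

theorem surjective : Surjective (fderiv ℝ Φ p) :=
  LinearMap.injective_iff_surjective.mp
    (hΦ.injective hp : Injective (fderiv ℝ Φ p : Eu m →ₗ[ℝ] Eu m))

theorem frame {e : Fin m → Eu m} (he : IsOrthonormalFrame (G p) e) :
    IsOrthonormalFrame (G' (Φ p)) fun i => fderiv ℝ Φ p (e i) := fun i j => by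
  rw [← hΦ.metric p hp, he]

theorem ctrace_conj {A A' : Eu m →L[ℝ] Eu m} (h : ∀ v, fderiv ℝ Φ p (A v) = A' (fderiv ℝ Φ p v)) :
    ctrace A = ctrace A' := by
  have he := hΦ.source.frame (hΦ.subset hp)
  rw [ctrace_apply, ctrace_apply, he.trace_eq, (hΦ.frame hp he).trace_eq]
  refine Finset.sum_congr rfl fun i _ => ?_
  rw [ContinuousLinearMap.coe_coe, ContinuousLinearMap.coe_coe, ← h, hΦ.metric p hp]

theorem fderiv_metric (x v w : Eu m) : fderiv ℝ G p x v w =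
    fderiv ℝ G' (Φ p) (fderiv ℝ Φ p x) (fderiv ℝ Φ p v) (fderiv ℝ Φ p w)
      + G' (Φ p) (fderiv ℝ (fderiv ℝ Φ) p x v) (fderiv ℝ Φ p w)
      + G' (Φ p) (fderiv ℝ Φ p v) (fderiv ℝ (fderiv ℝ Φ) p x w) := by
  have h1 := ((hΦ.source.differentiableAt (hΦ.subset hp)).hasFDerivAt.clm_apply
    (hasFDerivAt_const v p)).clm_apply (hasFDerivAt_const w p)
  have d := hΦ.hasFDerivAt_fderiv hp
  have h2 := (((hΦ.target.differentiableAt (hΦ.mapsTo p hp)).hasFDerivAt.comp p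
    (hΦ.hasFDerivAt hp)).clm_apply (d.clm_apply (hasFDerivAt_const v p))).clm_apply
      (d.clm_apply (hasFDerivAt_const w p))
  have e : (fun q => G q v w) =ᶠ[nhds p]
      fun q => (G' ∘ Φ) q (fderiv ℝ Φ q v) (fderiv ℝ Φ q w) := by
    filter_upwards [hΦ.isOpen.mem_nhds hp] with q hq using hΦ.metric q hq v w
  have h3 := DFunLike.congr_fun (h1.unique (h2.congr_of_eventuallyEq e)) x
  simp only [ContinuousLinearMap.comp_apply, add_apply, zero_apply, comp_apply,
    ContinuousLinearMap.flip_apply, map_zero, zero_add] at h3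
  rw [h3]; ring

/-- The transformation law of Christoffel symbols: differentiating the isometry condition and
inserting it in the Koszul formula, the symmetric second derivatives of Φ collapse to one term. -/
theorem christoffel_eq (x v : Eu m) : fderiv ℝ Φ p (christoffel G p x v) =
    christoffel G' (Φ p) (fderiv ℝ Φ p x) (fderiv ℝ Φ p v) + fderiv ℝ (fderiv ℝ Φ) p x v := by
  refine hΦ.target.ext (hΦ.mapsTo p hp) fun z' => ?_
  obtain ⟨z, rfl⟩ := hΦ.surjective hp z'
  have hs := hΦ.target.symm _ (hΦ.mapsTo p hp)
  have h1 := hΦ.source.two_mul_christoffel (hΦ.subset hp) x v z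
  have h2 := hΦ.target.two_mul_christoffel (hΦ.mapsTo p hp) (fderiv ℝ Φ p x) (fderiv ℝ Φ p v)
    (fderiv ℝ Φ p z)
  rw [hΦ.fderiv_metric hp, hΦ.fderiv_metric hp, hΦ.fderiv_metric hp, hΦ.metric p hp,
    hΦ.snd_symm hp v x, hΦ.snd_symm hp z x, hΦ.snd_symm hp z v, hs (fderiv ℝ Φ p v),
    hs (fderiv ℝ Φ p x) (fderiv ℝ (fderiv ℝ Φ) p v z)] at h1
  rw [map_add, add_apply]
  linarith

/-- The divergence does not depend on the coordinates. -/
theorem divAt_eq {V V' : Eu m → Eu m} (hV : DifferentiableAt ℝ V p)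
    (hV' : DifferentiableAt ℝ V' (Φ p)) (h : ∀ᶠ q in nhds p, fderiv ℝ Φ q (V q) = V' (Φ q)) :
    divAt G V p = divAt G' V' (Φ p) := by
  refine hΦ.ctrace_conj hp fun x => ?_
  have h1 := (hΦ.hasFDerivAt_fderiv hp).clm_apply hV.hasFDerivAt
  have h2 := hV'.hasFDerivAt.comp p (hΦ.hasFDerivAt hp)
  have h3 := DFunLike.congr_fun (h1.unique (h2.congr_of_eventuallyEq h)) x
  simp only [ContinuousLinearMap.comp_apply, add_apply, ContinuousLinearMap.flip_apply] at h3
  have h4 := hΦ.christoffel_eq hp x (V p)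
  simp only [add_apply, ContinuousLinearMap.flip_apply, christoffelCLM_apply, map_add, h4,
    ← h3, ← h.self_of_nhds]
  abel

end IsIsometryOn

/-- The map `Φ` is an isomorphism of two special almost Hermitian structures near every point
of `O`. -/
structure IsSUIsometryOn {n : ℕ} (O U U' : Set (Eu (2 * n))) (Φ : Eu (2 * n) → Eu (2 * n))
    (G G' : Eu (2 * n) → Bil (2 * n)) (J J' : Eu (2 * n) → Eu (2 * n) →L[ℝ] Eu (2 * n))
    (Ψ Ψ' : Eu (2 * n) → Eu (2 * n) [⋀^Fin n]→L[ℝ] ℂ) : Prop where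
  toIsIsometryOn : IsIsometryOn O U U' Φ G G'
  su : IsSUOn U G J Ψ
  su' : IsSUOn U' G' J' Ψ'
  complex : ∀ q ∈ O, ∀ v, fderiv ℝ Φ q (J q v) = J' (Φ q) (fderiv ℝ Φ q v)
  form : ∀ q ∈ O, ∀ v : Fin n → Eu (2 * n), Ψ q v = Ψ' (Φ q) fun i => fderiv ℝ Φ q (v i)

/-! ### Naturality of the torsion, of η and of the quadratic term -/

namespace IsSUIsometryOn

variable {n : ℕ} {O U U' : Set (Eu (2 * n))} {Φ : Eu (2 * n) → Eu (2 * n)}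
    {G G' : Eu (2 * n) → Bil (2 * n)} {J J' : Eu (2 * n) → Eu (2 * n) →L[ℝ] Eu (2 * n)}
    {Ψ Ψ' : Eu (2 * n) → Eu (2 * n) [⋀^Fin n]→L[ℝ] ℂ}
    (hΦ : IsSUIsometryOn O U U' Φ G G' J J' Ψ Ψ') {p : Eu (2 * n)} (hp : p ∈ O)
include hΦ hp

theorem mem : p ∈ U := hΦ.toIsIsometryOn.subset hp

theorem mem' : Φ p ∈ U' := hΦ.toIsIsometryOn.mapsTo p hp

theorem covJ_eq (x w : Eu (2 * n)) : fderiv ℝ Φ p (covJ G J p x w) =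
    covJ G' J' (Φ p) (fderiv ℝ Φ p x) (fderiv ℝ Φ p w) := by
  have hI := hΦ.toIsIsometryOn
  have d := hI.hasFDerivAt_fderiv hp
  have h1 := d.clm_apply ((hΦ.su.isHermitianOn.J_differentiableAt (hΦ.mem hp)).hasFDerivAt.clm_apply
    (hasFDerivAt_const w p))
  have h2 := ((hΦ.su'.isHermitianOn.J_differentiableAt (hΦ.mem' hp)).hasFDerivAt.comp p
    (hI.hasFDerivAt hp)).clm_apply (d.clm_apply (hasFDerivAt_const w p))
  have e : (fun q => fderiv ℝ Φ q (J q w)) =ᶠ[nhds p] fun q => (J' ∘ Φ) q (fderiv ℝ Φ q w) := by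
    filter_upwards [hI.isOpen.mem_nhds hp] with q hq using hΦ.complex q hq w
  have h3 := DFunLike.congr_fun (h1.unique (h2.congr_of_eventuallyEq e)) x
  simp only [ContinuousLinearMap.comp_apply, add_apply, zero_apply, comp_apply,
    ContinuousLinearMap.flip_apply, map_zero, zero_add] at h3
  simp only [covJ, map_add, map_sub, hI.christoffel_eq hp, hΦ.complex p hp]
  linear_combination (norm := module) h3

theorem uTor_eq (x w : Eu (2 * n)) : fderiv ℝ Φ p (uTor G J p x w) =
    uTor G' J' (Φ p) (fderiv ℝ Φ p x) (fderiv ℝ Φ p w) := by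
  rw [uTor_apply, uTor_apply, map_smul, hΦ.complex p hp, hΦ.covJ_eq hp]

/-- The second derivatives of Φ from the chain rule cancel those from the transformation law of Γ.
-/
theorem uCovForm_eq (X : Eu (2 * n)) (v : Fin n → Eu (2 * n)) : uCovForm G J Ψ p X v =
    uCovForm G' J' Ψ' (Φ p) (fderiv ℝ Φ p X) fun i => fderiv ℝ Φ p (v i) := by
  have hI := hΦ.toIsIsometryOn
  have d := hI.hasFDerivAt_fderiv hp
  have h1 := (hΦ.su.differentiableAt (hΦ.mem hp)).hasFDerivAt.continuousAlternatingMap_apply_const v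
  have h2 := ((hΦ.su'.differentiableAt (hΦ.mem' hp)).hasFDerivAt.comp p
    (hI.hasFDerivAt hp)).continuousAlternatingMap_apply
      (g := fun i q => fderiv ℝ Φ q (v i)) fun i => d.clm_apply (hasFDerivAt_const (v i) p)
  have e : (fun q => Ψ q v) =ᶠ[nhds p] fun q => (Ψ' ∘ Φ) q fun i => fderiv ℝ Φ q (v i) := by
    filter_upwards [hI.isOpen.mem_nhds hp] with q hq using hΦ.form q hq v
  have h3 := DFunLike.congr_fun (h1.unique (h2.congr_of_eventuallyEq e)) X
  simp at h3
  have h4 : ∀ i, Ψ p (update v i (uConn G J p X (v i))) =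
      Ψ' (Φ p) (update (fun i => fderiv ℝ Φ p (v i)) i
        (uConn G' J' (Φ p) (fderiv ℝ Φ p X) (fderiv ℝ Φ p (v i))))
      + Ψ' (Φ p) (update (fun i => fderiv ℝ Φ p (v i)) i
        (fderiv ℝ (fderiv ℝ Φ) p X (v i))) := by
    intro i
    rw [hΦ.form p hp, ← ContinuousAlternatingMap.map_update_add]
    congr 1
    funext k
    by_cases hk : k = i
    · subst hk
      simp only [update_self, uConn_apply, map_add, hI.christoffel_eq hp, hΦ.uTor_eq hp]
      abel
    · simp only [update_of_ne hk]
  rw [uCovForm_apply, uCovForm_apply, Finset.sum_congr rfl fun i _ => h4 i,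
    Finset.sum_add_distrib, h3]
  ring

theorem muForm_eq (v : Fin n → Eu (2 * n)) (X : Eu (2 * n)) : muForm G J Ψ v p X =
    muForm G' J' Ψ' (fun i => fderiv ℝ Φ p (v i)) (Φ p) (fderiv ℝ Φ p X) := by
  rw [muForm_apply, muForm_apply, hΦ.uCovForm_eq hp, hΦ.form p hp]

theorem etaField_eq (hn : n ≠ 0) : fderiv ℝ Φ p (etaField G J Ψ p) = etaField G' J' Ψ' (Φ p) := by
  have hI := hΦ.toIsIsometryOn
  obtain ⟨v, hv⟩ := hΦ.su.exists_ne_zero (hΦ.mem hp)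
  have hv' := hv
  rw [hΦ.form p hp] at hv'
  refine hI.target.ext (hΦ.mem' hp) fun z' => ?_
  obtain ⟨z, rfl⟩ := hI.surjective hp z'
  rw [← hI.metric p hp, hΦ.su.etaField_spec (hΦ.mem hp) hn hv,
    hΦ.su'.etaField_spec (hΦ.mem' hp) hn hv', hΦ.muForm_eq hp, hΦ.complex p hp]

theorem chi_eq : fderiv ℝ Φ p (chi (G p) (toTor (uTor G J p))) =
    chi (G' (Φ p)) (toTor (uTor G' J' (Φ p))) := by
  have hI := hΦ.toIsIsometryOn
  have he := hI.source.frame (hΦ.mem hp)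
  have h := (hI.frame hp he).sum_congr (hI.target.symm _ (hΦ.mem' hp))
    (hI.target.frame (hΦ.mem' hp)) (toTor (uTor G' J' (Φ p)))
  rw [chi, chi, h, map_sum]
  exact Finset.sum_congr rfl fun i _ => hΦ.uTor_eq hp _ _

theorem etaForm_chi_eq (hn : n ≠ 0) :
    etaForm (G p) (J p) (suTorsionAt G J Ψ p) (chi (G p) (uTorsionAt G J p)) =
    etaForm (G' (Φ p)) (J' (Φ p)) (suTorsionAt G' J' Ψ' (Φ p))
      (chi (G' (Φ p)) (uTorsionAt G' J' (Φ p))) := by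
  obtain ⟨v, hv⟩ := hΦ.su.exists_ne_zero (hΦ.mem hp)
  have hv' := hv
  rw [hΦ.form p hp] at hv'
  rw [hΦ.su.etaForm_eq (hΦ.mem hp) hn hv, hΦ.su'.etaForm_eq (hΦ.mem' hp) hn hv',
    hΦ.su.isHermitianOn.uTorsionAt_eq (hΦ.mem hp), hΦ.su'.isHermitianOn.uTorsionAt_eq (hΦ.mem' hp),
    hΦ.muForm_eq hp, hΦ.complex p hp, hΦ.chi_eq hp]

theorem quadTrace_eq : quadTrace G J p = quadTrace G' J' (Φ p) := by
  have hI := hΦ.toIsIsometryOn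
  have he := hI.source.frame (hΦ.mem hp)
  let β : Eu (2 * n) →ₗ[ℝ] Eu (2 * n) →ₗ[ℝ] ℝ := LinearMap.mk₂ ℝ
      (fun x y => ctrace (uTor G' J' (Φ p) x * uTor G' J' (Φ p) (J' (Φ p) y) * J' (Φ p)))
      (by intros; simp only [map_add, add_mul])
      (by intros; simp only [map_smul, smul_mul_assoc])
      (by intros; simp only [map_add, add_mul, mul_add])
      (by intros; simp only [map_smul, smul_mul_assoc, mul_smul_comm])
  have h := (hI.frame hp he).sum_congr (hI.target.symm _ (hΦ.mem' hp))
    (hI.target.frame (hΦ.mem' hp)) β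
  simp only [β, LinearMap.mk₂_apply] at h
  rw [quadTrace, quadTrace, h]
  refine Finset.sum_congr rfl fun i _ => hI.ctrace_conj hp fun v => ?_
  simp only [mul_apply_eq_comp, hΦ.uTor_eq hp, hΦ.complex p hp]

end IsSUIsometryOn

end Transition

/-! ## Riemannian density and continuity -/

section Density

variable {m : ℕ}

theorem IsOrthonormalFrame.sum_eq_bilInv {V : Type*} [AddCommGroup V] [Module ℝ V] {b : Bil m}
    (hs : ∀ v w, b v w = b w v) (hp : ∀ v, v ≠ 0 → 0 < b v v) {e : Fin m → Eu m}
    (he : IsOrthonormalFrame b e) (β : Eu m →ₗ[ℝ] Eu m →ₗ[ℝ] V) :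
    ∑ i, β (e i) (e i) = ∑ k, ∑ l, bilInv b k l •
      β (EuclideanSpace.single k 1) (EuclideanSpace.single l 1) := by
  have h : ∀ i, e i = ∑ k, e i k • (EuclideanSpace.single k 1 : Eu m) := fun i => by
    have := (EuclideanSpace.basisFun (Fin m) ℝ).sum_repr (e i)
    simpa using this.symm
  have h1 : ∀ i, β (e i) (e i) = ∑ k, ∑ l, (e i k * e i l) •
      β (EuclideanSpace.single k 1) (EuclideanSpace.single l 1) := fun i => by
    conv_lhs => rw [h i]
    simp only [map_sum, map_smul, LinearMap.sum_apply, LinearMap.smul_apply, Finset.smul_sum,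
      mul_smul]
    rw [Finset.sum_comm]
    exact Finset.sum_congr rfl fun k _ => Finset.sum_congr rfl fun l _ => by rw [smul_comm]
  simp only [h1, bilInv_eq hs hp he, Finset.sum_smul]
  rw [Finset.sum_comm]
  exact Finset.sum_congr rfl fun k _ => by rw [Finset.sum_comm]

/-- The chosen frame may vary wildly with the point, but a trace over it depends only on the inverse
metric. -/
theorem IsMetricOn.continuousOn_sum_frame {V : Type*} [NormedAddCommGroup V] [NormedSpace ℝ V]
    {U : Set (Eu m)} {G : Eu m → Bil m} (hG : IsMetricOn U G)
    {β : Eu m → Eu m →ₗ[ℝ] Eu m →ₗ[ℝ] V} (hβ : ∀ v w, ContinuousOn (fun q => β q v w) U) :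
    ContinuousOn (fun q => ∑ i, β q (SUGeometry.frame (G q) i) (SUGeometry.frame (G q) i)) U := by
  have h : Set.EqOn (fun q => ∑ i, β q (SUGeometry.frame (G q) i) (SUGeometry.frame (G q) i))
      (fun q => ∑ k, ∑ l, bilInv (G q) k l •
        β q (EuclideanSpace.single k 1) (EuclideanSpace.single l 1)) U := fun q hq =>
    (hG.frame hq).sum_eq_bilInv (hG.symm q hq) (hG.pos q hq) (β q)
  refine ContinuousOn.congr ?_ h
  refine continuousOn_finsetSum _ fun k _ => continuousOn_finsetSum _ fun l _ => ?_
  refine ContinuousOn.smul ?_ (hβ _ _)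
  have h1 := (hG.contDiffOn_inverse.continuousOn.clm_apply
    (continuousOn_const (c := (EuclideanSpace.proj k : Eu m →L[ℝ] ℝ))))
  exact (EuclideanSpace.proj l : Eu m →L[ℝ] ℝ).continuous.comp_continuousOn h1

/-- The Gram matrix of the standard basis. -/
def gram (b : Bil m) : Matrix (Fin m) (Fin m) ℝ :=
  Matrix.of fun i j => b (EuclideanSpace.single i 1) (EuclideanSpace.single j 1)

/-- The Riemannian density in coordinates. -/
def density (G : Eu m → Bil m) (q : Eu m) : ℝ := Real.sqrt (gram (G q)).det

theorem density_nonneg (G : Eu m → Bil m) (q : Eu m) : 0 ≤ density G q := Real.sqrt_nonneg _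

theorem gram_det_comp {b c : Bil m} {A : Eu m →L[ℝ] Eu m} (h : ∀ v w, b v w = c (A v) (A w)) :
    (gram b).det = A.det ^ 2 * (gram c).det := by
  set T := LinearMap.toMatrix (EuclideanSpace.basisFun (Fin m) ℝ).toBasis
    (EuclideanSpace.basisFun (Fin m) ℝ).toBasis (A : Eu m →ₗ[ℝ] Eu m) with hT
  have hdet : A.det = T.det := by rw [hT, LinearMap.det_toMatrix]
  have hcol : ∀ i, A (EuclideanSpace.single i 1) =
      ∑ k, T k i • (EuclideanSpace.single k 1 : Eu m) := by
    intro i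
    have := (EuclideanSpace.basisFun (Fin m) ℝ).sum_repr (A (EuclideanSpace.single i 1))
    simp only [EuclideanSpace.basisFun_apply, EuclideanSpace.basisFun_repr] at this
    rw [← this]
    simp [hT, LinearMap.toMatrix_apply]
  have hm : gram b = T.transpose * gram c * T := by
    ext i j
    rw [gram, Matrix.of_apply, h, hcol, hcol]
    simp only [map_sum, map_smul, sum_apply, smul_apply, smul_eq_mul, Matrix.mul_apply,
      Matrix.transpose_apply, gram, Matrix.of_apply, Finset.sum_mul, Finset.mul_sum]
    refine Finset.sum_congr rfl fun k _ => Finset.sum_congr rfl fun l _ => ?_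
    ring
  rw [hm, Matrix.det_mul, Matrix.det_mul, Matrix.det_transpose, hdet]
  ring

theorem IsIsometryOn.density_eq {O U U' : Set (Eu m)} {Φ : Eu m → Eu m} {G G' : Eu m → Bil m}
    (hΦ : IsIsometryOn O U U' Φ G G') {q : Eu m} (hq : q ∈ O) :
    density G q = |(fderiv ℝ Φ q).det| * density G' (Φ q) := by
  rw [density, gram_det_comp (hΦ.metric q hq), Real.sqrt_mul (sq_nonneg _), Real.sqrt_sq_eq_abs,
    density]

/-- Pulling b back by the map sending the standard basis to the frame gives the identity matrix, so
1 = (det A)² det(gram b). -/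
theorem IsOrthonormalFrame.gram_det_pos {b : Bil m} {e : Fin m → Eu m}
    (he : IsOrthonormalFrame b e) : 0 < (gram b).det := by
  let A : Eu m →L[ℝ] Eu m := LinearMap.toContinuousLinearMap
    ((EuclideanSpace.basisFun (Fin m) ℝ).toBasis.constr ℝ e)
  have hA : ∀ i, A (EuclideanSpace.single i 1) = e i := fun i => by
    have := (EuclideanSpace.basisFun (Fin m) ℝ).toBasis.constr_basis ℝ e i
    rwa [OrthonormalBasis.coe_toBasis, EuclideanSpace.basisFun_apply] at this
  let c : Bil m := A.precomp ℝ ∘L b ∘L A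
  have h1 : gram c = 1 := by
    ext i j
    change b (A (EuclideanSpace.single i 1)) (A (EuclideanSpace.single j 1)) = _
    rw [hA, hA, he, Matrix.one_apply]
  have h2 : (gram c).det = A.det ^ 2 * (gram b).det := gram_det_comp fun v w => rfl
  rw [h1, Matrix.det_one] at h2
  by_contra h
  nlinarith [sq_nonneg A.det]

theorem gram_smul_deriv (A : Eu m →L[ℝ] Eu m) (b : Bil m) :
    HasDerivAt (fun t : ℝ =>
      (gram ((ContinuousLinearMap.id ℝ (Eu m) + t • A).precomp ℝ ∘L b ∘L
        (ContinuousLinearMap.id ℝ (Eu m) + t • A))).det) (2 * ctrace A * (gram b).det) 0 := by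
  have h0 : ∀ t : ℝ, (gram ((ContinuousLinearMap.id ℝ (Eu m) + t • A).precomp ℝ ∘L b ∘L
        (ContinuousLinearMap.id ℝ (Eu m) + t • A))).det =
      (ContinuousLinearMap.id ℝ (Eu m) + t • A).det ^ 2 * (gram b).det := fun t =>
    gram_det_comp fun v w => rfl
  simp only [h0]
  set T := LinearMap.toMatrix (EuclideanSpace.basisFun (Fin m) ℝ).toBasis
    (EuclideanSpace.basisFun (Fin m) ℝ).toBasis (A : Eu m →ₗ[ℝ] Eu m) with hT
  have h1 : ∀ t : ℝ, (ContinuousLinearMap.id ℝ (Eu m) + t • A).det = (1 + t • T).det := by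
    intro t
    rw [ContinuousLinearMap.det, ← LinearMap.det_toMatrix
      (EuclideanSpace.basisFun (Fin m) ℝ).toBasis]
    congr 1
    rw [hT, ← LinearMap.toMatrix_id (EuclideanSpace.basisFun (Fin m) ℝ).toBasis, ← map_smul,
      ← map_add]
    rfl
  have h2 : ctrace A = T.trace := by
    rw [ctrace_apply, LinearMap.trace_eq_matrix_trace ℝ (EuclideanSpace.basisFun (Fin m) ℝ).toBasis]
  have h3 : HasDerivAt (fun t : ℝ => (1 + t • T).det) T.trace 0 := by
    -- `Q` collects the terms of order at least two in det(1 + tT) = 1 + t tr T + t² Q(t).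
    set Q := (Matrix.det (1 + (Polynomial.X : Polynomial ℝ) • T.map Polynomial.C)).divX.divX with hQ
    have e := hasDerivAt_id (0 : ℝ)
    have p := ((e.const_mul T.trace).const_add 1).add ((Q.hasDerivAt (0 : ℝ)).mul (e.pow 2))
    refine (p.congr_deriv (by simp)).congr_of_eventuallyEq (Filter.Eventually.of_forall fun t => ?_)
    exact Matrix.det_one_add_smul t T
  simp only [h1, h2]
  have h4 := (h3.pow 2).mul_const (gram b).det
  exact h4.congr_deriv (by simp)

theorem contDiff_gram_det : ContDiff ℝ ∞ fun b : Bil m => (gram b).det := by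
  simp only [Matrix.det_apply', gram, Matrix.of_apply]
  refine ContDiff.sum fun σ _ => contDiff_const.mul (contDiff_prod fun i _ => ?_)
  exact (contDiff_id.clm_apply contDiff_const).clm_apply contDiff_const

namespace IsMetricOn

variable {U : Set (Eu m)} {G : Eu m → Bil m} (hG : IsMetricOn U G) {p : Eu m}
include hG

theorem contDiffOn_density : ContDiffOn ℝ ∞ (density G) U := fun q hq =>
  ((contDiff_gram_det.contDiffAt.comp q (hG.contDiffAt hq)).sqrt
    (hG.frame hq).gram_det_pos.ne').contDiffWithinAt

/-- The derivative of the density along v is the trace of Γ_v. This turns the covariant divergence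
into a flat one. -/
theorem fderiv_density (hp : p ∈ U) (v : Eu m) :
    fderiv ℝ (density G) p v = ctrace (christoffelCLM G p v) * density G p := by
  have hpos := (hG.frame hp).gram_det_pos
  have d : ∀ b : Bil m, HasFDerivAt (fun b : Bil m => (gram b).det)
      (fderiv ℝ (fun b : Bil m => (gram b).det) b) b := fun b =>
    (contDiff_gram_det.differentiable (by simp) b).hasFDerivAt
  have h0 : fderiv ℝ (fun b : Bil m => (gram b).det) (G p) (fderiv ℝ G p v) =
      2 * ctrace (christoffelCLM G p v) * (gram (G p)).det := by
    set A := christoffelCLM G p v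
    -- By metric compatibility, the pullback of the metric under 1 + tΓ_v has first-order term
    -- dG(v). Hence the derivative of the determinant in the direction dG(v) is that of det(1 +
    -- tΓ_v)² det(gram G) at t = 0.
    have h1 : ∀ t : ℝ, (ContinuousLinearMap.id ℝ (Eu m) + t • A).precomp ℝ ∘L G p ∘L
        (ContinuousLinearMap.id ℝ (Eu m) + t • A) =
        G p + t • fderiv ℝ G p v + t ^ 2 • (A.precomp ℝ ∘L G p ∘L A) := by
      intro t
      ext x y
      have := hG.fderiv_eq hp v x y
      change G p (x + t • A x) (y + t • A y) =
        G p x y + t * fderiv ℝ G p v x y + t ^ 2 * G p (A x) (A y)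
      rw [this]
      simp only [map_add, map_smul, add_apply, smul_apply, smul_eq_mul, A, christoffelCLM_apply]
      ring
    have h2 := gram_smul_deriv A (G p)
    simp only [h1] at h2
    have e := hasDerivAt_id (0 : ℝ)
    have h3 : HasDerivAt (fun t : ℝ =>
        G p + t • fderiv ℝ G p v + t ^ 2 • (A.precomp ℝ ∘L G p ∘L A)) (fderiv ℝ G p v) 0 :=
      HasDerivAt.congr_deriv (((e.smul_const (fderiv ℝ G p v)).const_add (G p)).add
        ((e.pow 2).smul_const (A.precomp ℝ ∘L G p ∘L A))) (by simp)
    have h4 := (d _).comp_hasDerivAt (0 : ℝ) h3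
    have h5 := h4.unique h2
    simpa using h5
  have h1 := ((d (G p)).comp p (hG.differentiableAt hp).hasFDerivAt).sqrt hpos.ne'
  have h2 : fderiv ℝ (density G) p = _ := HasFDerivAt.fderiv h1
  rw [h2, smul_apply, ContinuousLinearMap.comp_apply, h0, smul_eq_mul, density]
  have h3 := Real.mul_self_sqrt hpos.le
  have h4 := (Real.sqrt_pos.mpr hpos).ne'
  simp only [Function.comp_apply]
  field_simp
  rw [pow_two, h3, mul_comm]

theorem ctrace_fderiv_density_smul (hp : p ∈ U) {V : Eu m → Eu m} (hV : DifferentiableAt ℝ V p) :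
    ctrace (fderiv ℝ (fun q => density G q • V q) p) = divAt G V p * density G p := by
  have h1 := ((hG.contDiffOn_density.contDiffAt (hG.isOpen.mem_nhds hp)).differentiableAt
    (by simp)).hasFDerivAt.smul hV.hasFDerivAt
  have h0 : fderiv ℝ (fun q => density G q • V q) p = _ := HasFDerivAt.fderiv h1
  rw [h0, map_add, map_smul, divAt, map_add]
  have h2 : ctrace ((fderiv ℝ (density G) p).smulRight (V p)) = fderiv ℝ (density G) p (V p) := by
    rw [ctrace_apply]
    exact LinearMap.trace_smulRight _ _
  have h3 : (christoffelCLM G p).flip (V p) = christoffelCLM G p (V p) := by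
    ext w : 1
    exact hG.christoffel_symm hp _ _
  rw [h2, h3, hG.fderiv_density hp, smul_eq_mul]
  ring

theorem continuousOn_divAt {V : Eu m → Eu m} (hV : ContDiffOn ℝ ∞ V U) :
    ContinuousOn (divAt G V) U := by
  refine ctrace.continuous.comp_continuousOn (ContinuousOn.add ?_ ?_)
  · exact (hV.fderiv_of_isOpen (m := 0) hG.isOpen (by simp)).continuousOn
  · exact ((ContinuousLinearMap.flipₗᵢ ℝ (Eu m) (Eu m) (Eu m)).continuous.comp_continuousOn
      hG.contDiffOn_christoffel.continuousOn).clm_apply hV.continuousOn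

end IsMetricOn

theorem integral_ctrace_fderiv_eq_zero {Z : Eu m → Eu m} (hZ : ContDiff ℝ ∞ Z)
    (hc : HasCompactSupport Z) : ∫ q, ctrace (fderiv ℝ Z q) = 0 := by
  have hd : Continuous (fderiv ℝ Z) := hZ.continuous_fderiv (by simp)
  have h1 : ∀ k : Fin m, Integrable fun q => fderiv ℝ Z q (EuclideanSpace.single k 1) k := by
    intro k
    refine Continuous.integrable_of_hasCompactSupport ?_ ?_
    · exact (EuclideanSpace.proj k : Eu m →L[ℝ] ℝ).continuous.comp (hd.clm_apply continuous_const)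
    · exact (hc.fderiv ℝ).comp_left
        (g := fun A : Eu m →L[ℝ] Eu m => A (EuclideanSpace.single k 1) k) rfl
  have h2 : ∀ k : Fin m, ∫ q, fderiv ℝ Z q (EuclideanSpace.single k 1) k = 0 := by
    intro k
    have hk : ∀ q, HasFDerivAt (fun q => Z q k)
        ((EuclideanSpace.proj k : Eu m →L[ℝ] ℝ) ∘L fderiv ℝ Z q) q := fun q =>
      (EuclideanSpace.proj k : Eu m →L[ℝ] ℝ).hasFDerivAt.comp q
        (hZ.differentiable (by simp) q).hasFDerivAt
    have hi : Integrable fun q => Z q k := Continuous.integrable_of_hasCompactSupport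
      ((EuclideanSpace.proj k : Eu m →L[ℝ] ℝ).continuous.comp hZ.continuous)
      (hc.comp_left (g := fun v : Eu m => v k) rfl)
    -- Integration by parts against the constant function 1.
    have := integral_mul_fderiv_eq_neg_fderiv_mul_of_integrable (μ := volume)
      (f := fun _ : Eu m => (1 : ℝ)) (g := fun q => Z q k) (v := EuclideanSpace.single k 1)
      (by simp) (by simpa [(hk _).fderiv] using h1 k) (by simpa using hi)
      (fun x _ => by fun_prop) (fun x _ => (hk x).differentiableAt)
    simpa [(hk _).fderiv] using this
  have h3 : ∀ q, ctrace (fderiv ℝ Z q) = ∑ k, fderiv ℝ Z q (EuclideanSpace.single k 1) k := by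
    intro q
    rw [ctrace_apply, LinearMap.trace_eq_sum_inner _ (EuclideanSpace.basisFun (Fin m) ℝ)]
    refine Finset.sum_congr rfl fun k _ => ?_
    simp [EuclideanSpace.inner_single_left]
  simp only [h3]
  rw [integral_finsetSum _ fun k _ => h1 k]
  simp [h2]

theorem IsMetricOn.integral_divAt_mul_density {U : Set (Eu m)} {G : Eu m → Bil m}
    (hG : IsMetricOn U G) {V : Eu m → Eu m} (hV : ContDiffOn ℝ ∞ V U)
    (hc : HasCompactSupport V) (hs : tsupport V ⊆ U) :
    ∫ q in U, divAt G V q * density G q = 0 := by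
  -- The density is smooth only in U; outside U the product vanishes near each point because the
  -- support of V is closed and contained in U.
  have hZ : ContDiff ℝ ∞ fun q => density G q • V q := by
    rw [contDiff_iff_contDiffAt]
    intro q
    by_cases hq : q ∈ U
    · exact (hG.contDiffOn_density.smul hV).contDiffAt (hG.isOpen.mem_nhds hq)
    · have : (fun q => density G q • V q) =ᶠ[nhds q] fun _ => 0 := by
        filter_upwards [(isClosed_tsupport V).isOpen_compl.mem_nhds fun h => hq (hs h)] with y hy
        rw [image_eq_zero_of_notMem_tsupport hy, smul_zero]
      exact contDiffAt_const.congr_of_eventuallyEq this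
  have hsup : (Function.support fun q => density G q • V q) ⊆ Function.support V :=
    fun q hq h => hq (by simp [h])
  have hc' : HasCompactSupport fun q => density G q • V q := hc.mono hsup
  rw [setIntegral_congr_fun hG.isOpen.measurableSet fun q hq => (hG.ctrace_fderiv_density_smul hq
    ((hV.contDiffAt (hG.isOpen.mem_nhds hq)).differentiableAt (by simp))).symm,
    setIntegral_eq_integral_of_forall_compl_eq_zero, integral_ctrace_fderiv_eq_zero hZ hc']
  intro q hq
  have : q ∉ tsupport (fderiv ℝ fun q => density G q • V q) := fun h =>
    hq (hs (closure_mono hsup (tsupport_fderiv_subset ℝ h)))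
  rw [image_eq_zero_of_notMem_tsupport this, map_zero]

theorem IsHermitianOn.continuousOn_quadTrace {U : Set (Eu m)} {G : Eu m → Bil m}
    {J : Eu m → Eu m →L[ℝ] Eu m} (hS : IsHermitianOn U G J) :
    ContinuousOn (quadTrace G J) U := by
  let β : Eu m → Eu m →ₗ[ℝ] Eu m →ₗ[ℝ] ℝ := fun q => LinearMap.mk₂ ℝ
    (fun x y => ctrace (uTor G J q x * uTor G J q (J q y) * J q))
    (by intros; simp only [map_add, add_mul])
    (by intros; simp only [map_smul, smul_mul_assoc])
    (by intros; simp only [map_add, add_mul, mul_add])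
    (by intros; simp only [map_smul, smul_mul_assoc, mul_smul_comm])
  refine hS.isMetricOn.continuousOn_sum_frame (β := β) fun v w => ?_
  have hU := hS.contDiffOn_uTor.continuousOn
  have hJ := hS.smooth_J.continuousOn
  exact ctrace.continuous.comp_continuousOn (((hU.clm_apply continuousOn_const).mul
    (hU.clm_apply (hJ.clm_apply continuousOn_const))).mul hJ)

theorem IsHermitianOn.continuousOn_chi {U : Set (Eu m)} {G : Eu m → Bil m}
    {J : Eu m → Eu m →L[ℝ] Eu m} (hS : IsHermitianOn U G J) :
    ContinuousOn (fun q => chi (G q) (toTor (uTor G J q))) U :=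
  hS.isMetricOn.continuousOn_sum_frame (β := fun q => toTor (uTor G J q)) fun _ _ =>
    (hS.contDiffOn_uTor.continuousOn.clm_apply continuousOn_const).clm_apply continuousOn_const

theorem IsSUOn.continuousOn_etaForm_chi {n : ℕ} {U : Set (Eu (2 * n))}
    {G : Eu (2 * n) → Bil (2 * n)} {J : Eu (2 * n) → Eu (2 * n) →L[ℝ] Eu (2 * n)}
    {Ψ : Eu (2 * n) → Eu (2 * n) [⋀^Fin n]→L[ℝ] ℂ} (hS : IsSUOn U G J Ψ) (hn : n ≠ 0) :
    ContinuousOn (fun q => etaForm (G q) (J q) (suTorsionAt G J Ψ q)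
      (chi (G q) (uTorsionAt G J q))) U := by
  intro p hp
  obtain ⟨v, hv⟩ := hS.exists_ne_zero hp
  have hU := hS.isOpen.mem_nhds hp
  have h1 : ContinuousAt
      (fun q => -muForm G J Ψ v q (J q (chi (G q) (toTor (uTor G J q))))) p :=
    ((hS.contDiffAt_muForm hp hn hv).continuousAt.clm_apply
      ((hS.isHermitianOn.smooth_J.continuousOn.continuousAt hU).clm_apply
        (hS.isHermitianOn.continuousOn_chi.continuousAt hU))).neg
  refine (h1.congr ?_).continuousWithinAt
  filter_upwards [hS.eventually_ne hp hv] with q hq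
  rw [hS.etaForm_eq hq.1 hn hq.2, hS.isHermitianOn.uTorsionAt_eq hq.1]

end Density

/-! ## Coordinate expressions on a manifold -/

section Coordinates

variable {m : ℕ} {M : Type*} [TopologicalSpace M] [ChartedSpace (Eu m) M]
  [IsManifold 𝓘(ℝ, Eu m) ∞ M]

theorem mdifferentiableAt_chart {x z : M} (hz : z ∈ (extChartAt 𝓘(ℝ, Eu m) x).source) :
    MDifferentiableAt 𝓘(ℝ, Eu m) 𝓘(ℝ, Eu m) (extChartAt 𝓘(ℝ, Eu m) x) z :=
  haveI : IsManifold 𝓘(ℝ, Eu m) 1 M := IsManifold.of_le (n := ∞) (by simp)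
  mdifferentiableAt_extChartAt (by rwa [extChartAt_source] at hz)

theorem mdifferentiableAt_chart_symm {x : M} {y : Eu m}
    (hy : y ∈ (extChartAt 𝓘(ℝ, Eu m) x).target) :
    MDifferentiableAt 𝓘(ℝ, Eu m) 𝓘(ℝ, Eu m) (extChartAt 𝓘(ℝ, Eu m) x).symm y := by
  have : IsManifold 𝓘(ℝ, Eu m) 1 M := IsManifold.of_le (n := ∞) (by simp)
  have := mdifferentiableWithinAt_extChartAt_symm hy
  rwa [ModelWithCorners.range_eq_univ, mdifferentiableWithinAt_univ] at this

/-- The differential of a chart inverts that of the inverse of the chart. -/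
theorem dChart_dChartSymm {x : M} {y : Eu m} (hy : y ∈ (extChartAt 𝓘(ℝ, Eu m) x).target)
    (v : Eu m) : dChart x y (dChartSymm x y v) = v := by
  have : IsManifold 𝓘(ℝ, Eu m) 1 M := IsManifold.of_le (n := ∞) (by simp)
  have h := mfderiv_extChartAt_comp_mfderivWithin_extChartAt_symm (I := 𝓘(ℝ, Eu m)) hy
  rw [ModelWithCorners.range_eq_univ, mfderivWithin_univ] at h
  exact DFunLike.congr_fun h v

theorem dChartSymm_dChart {x : M} {y : Eu m} (hy : y ∈ (extChartAt 𝓘(ℝ, Eu m) x).target)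
    (v : TangentSpace 𝓘(ℝ, Eu m) ((extChartAt 𝓘(ℝ, Eu m) x).symm y)) :
    dChartSymm x y (dChart x y v) = v := by
  have : IsManifold 𝓘(ℝ, Eu m) 1 M := IsManifold.of_le (n := ∞) (by simp)
  have h := mfderivWithin_extChartAt_symm_comp_mfderiv_extChartAt (I := 𝓘(ℝ, Eu m)) hy
  rw [ModelWithCorners.range_eq_univ, mfderivWithin_univ] at h
  exact DFunLike.congr_fun h v

theorem contMDiffOn_dChartSymm (x : M) (v : Eu m) :
    ContMDiffOn 𝓘(ℝ, Eu m) 𝓘(ℝ, Eu m).tangent ∞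
      (fun y => (TotalSpace.mk' (Eu m) (E := fun z : M => TangentSpace 𝓘(ℝ, Eu m) z)
        ((extChartAt 𝓘(ℝ, Eu m) x).symm y) (dChartSymm x y v)))
      (extChartAt 𝓘(ℝ, Eu m) x).target := by
  have ho := isOpen_extChartAt_target (I := 𝓘(ℝ, Eu m)) x
  have h1 := (contMDiffOn_extChartAt_symm (I := 𝓘(ℝ, Eu m)) (n := ∞) x).contMDiffOn_tangentMapWithin
    (m := ∞) (by simp) ho.uniqueMDiffOn
  have h2 : ContMDiffOn 𝓘(ℝ, Eu m) 𝓘(ℝ, Eu m).tangent ∞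
      (fun y : Eu m => (TotalSpace.mk' (Eu m) (E := fun z : Eu m => TangentSpace 𝓘(ℝ, Eu m) z)
        y v)) (extChartAt 𝓘(ℝ, Eu m) x).target := by
    exact contMDiffOn_vectorSpace_iff_contDiffOn.mpr contDiffOn_const
  refine (h1.comp h2 fun y hy => hy).congr fun y hy => ?_
  simp only [Function.comp_apply, tangentMapWithin, mfderivWithin_of_isOpen ho hy]
  rfl

theorem coordMetric_apply (g : Metric m M) (x : M) (y v w : Eu m) :
    coordMetric g x y v w =
      g.inner ((extChartAt 𝓘(ℝ, Eu m) x).symm y) (dChartSymm x y v) (dChartSymm x y w) := rfl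

omit [IsManifold 𝓘(ℝ, Eu m) ∞ M] in
theorem coordEnd_apply (J : ∀ x : M, TangentSpace 𝓘(ℝ, Eu m) x →L[ℝ] TangentSpace 𝓘(ℝ, Eu m) x)
    (x : M) (y v : Eu m) : coordEnd J x y v =
      dChart x y (J ((extChartAt 𝓘(ℝ, Eu m) x).symm y) (dChartSymm x y v)) := rfl

theorem dChartSymm_coordEnd
    (J : ∀ x : M, TangentSpace 𝓘(ℝ, Eu m) x →L[ℝ] TangentSpace 𝓘(ℝ, Eu m) x)
    {x : M} {y : Eu m} (hy : y ∈ (extChartAt 𝓘(ℝ, Eu m) x).target) (v : Eu m) :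
    dChartSymm x y (coordEnd J x y v) =
      J ((extChartAt 𝓘(ℝ, Eu m) x).symm y) (dChartSymm x y v) :=
  dChartSymm_dChart hy _

theorem dChartSymm_ne_zero {x : M} {y : Eu m} (hy : y ∈ (extChartAt 𝓘(ℝ, Eu m) x).target)
    {v : Eu m} (hv : v ≠ 0) : dChartSymm x y v ≠ 0 := fun h => hv <| by
  rw [← dChart_dChartSymm hy v, h, map_zero]

theorem contDiffOn_metric_apply (g : Metric m M) (x : M)
    {V W : ∀ y : Eu m, TangentSpace 𝓘(ℝ, Eu m) ((extChartAt 𝓘(ℝ, Eu m) x).symm y)}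
    (hV : ContMDiffOn 𝓘(ℝ, Eu m) 𝓘(ℝ, Eu m).tangent ∞
      (fun y => (TotalSpace.mk' (Eu m) (E := fun z : M => TangentSpace 𝓘(ℝ, Eu m) z)
        ((extChartAt 𝓘(ℝ, Eu m) x).symm y) (V y))) (extChartAt 𝓘(ℝ, Eu m) x).target)
    (hW : ContMDiffOn 𝓘(ℝ, Eu m) 𝓘(ℝ, Eu m).tangent ∞
      (fun y => (TotalSpace.mk' (Eu m) (E := fun z : M => TangentSpace 𝓘(ℝ, Eu m) z)
        ((extChartAt 𝓘(ℝ, Eu m) x).symm y) (W y))) (extChartAt 𝓘(ℝ, Eu m) x).target) :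
    ContDiffOn ℝ ∞ (fun y => g.inner ((extChartAt 𝓘(ℝ, Eu m) x).symm y) (V y) (W y))
      (extChartAt 𝓘(ℝ, Eu m) x).target := by
  have h1 := g.contMDiff.comp_contMDiffOn (contMDiffOn_extChartAt_symm (I := 𝓘(ℝ, Eu m)) (n := ∞) x)
  have h2 := ContMDiffOn.clm_bundle_apply₂ (F₁ := Eu m) (F₂ := Eu m) (F₃ := ℝ)
    (E₁ := fun z : M => TangentSpace 𝓘(ℝ, Eu m) z) (E₂ := fun z : M => TangentSpace 𝓘(ℝ, Eu m) z)
    (E₃ := Bundle.Trivial M ℝ) h1 hV hW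
  intro y hy
  have h3 := h2 y hy
  simp only [contMDiffWithinAt_totalSpace] at h3
  exact h3.2.contDiffWithinAt

theorem isMetricOn_coordMetric (g : Metric m M) (x : M) :
    IsMetricOn (extChartAt 𝓘(ℝ, Eu m) x).target (coordMetric g x) where
  isOpen := isOpen_extChartAt_target x
  smooth := by
    rw [contDiffOn_clm_apply]
    intro v
    rw [contDiffOn_clm_apply]
    intro w
    exact contDiffOn_metric_apply g x (contMDiffOn_dChartSymm x v) (contMDiffOn_dChartSymm x w)
  symm p _ v w := g.symm _ _ _
  pos p hp v hv := g.pos _ _ (dChartSymm_ne_zero hp hv)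

theorem contDiffOn_coordEnd (g : Metric m M)
    {J : ∀ x : M, TangentSpace 𝓘(ℝ, Eu m) x →L[ℝ] TangentSpace 𝓘(ℝ, Eu m) x}
    (hJ : ContMDiff 𝓘(ℝ, Eu m) (𝓘(ℝ, Eu m).prod 𝓘(ℝ, Eu m →L[ℝ] Eu m)) ∞
      (fun x => TotalSpace.mk' (Eu m →L[ℝ] Eu m)
        (E := fun x : M => TangentSpace 𝓘(ℝ, Eu m) x →L[ℝ] TangentSpace 𝓘(ℝ, Eu m) x) x (J x)))
    (x : M) : ContDiffOn ℝ ∞ (coordEnd J x) (extChartAt 𝓘(ℝ, Eu m) x).target := by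
  have hG := isMetricOn_coordMetric g x
  have h1 := hJ.comp_contMDiffOn (contMDiffOn_extChartAt_symm (I := 𝓘(ℝ, Eu m)) (n := ∞) x)
  have h2 : ∀ v, ContMDiffOn 𝓘(ℝ, Eu m) 𝓘(ℝ, Eu m).tangent ∞
      (fun y => (TotalSpace.mk' (Eu m) (E := fun z : M => TangentSpace 𝓘(ℝ, Eu m) z)
        ((extChartAt 𝓘(ℝ, Eu m) x).symm y)
        (J ((extChartAt 𝓘(ℝ, Eu m) x).symm y) (dChartSymm x y v))))
      (extChartAt 𝓘(ℝ, Eu m) x).target := fun v =>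
    ContMDiffOn.clm_bundle_apply (F₁ := Eu m) (F₂ := Eu m)
      (E₁ := fun z : M => TangentSpace 𝓘(ℝ, Eu m) z) (E₂ := fun z : M => TangentSpace 𝓘(ℝ, Eu m) z)
      h1 (contMDiffOn_dChartSymm x v)
  -- Smoothness of the coordinate expression of J is read off from the bilinear form g(J·, ·), then
  -- recovered with the inverse metric; no regularity of the differential of the chart as a bundle
  -- map is needed.
  have h3 : ContDiffOn ℝ ∞ (fun y => coordMetric g x y ∘L coordEnd J x y)
      (extChartAt 𝓘(ℝ, Eu m) x).target := by
    rw [contDiffOn_clm_apply]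
    intro v
    rw [contDiffOn_clm_apply]
    intro w
    refine (contDiffOn_metric_apply g x (h2 v) (contMDiffOn_dChartSymm x w)).congr fun y hy => ?_
    rw [ContinuousLinearMap.comp_apply, coordMetric_apply, dChartSymm_coordEnd J hy]
  refine (hG.contDiffOn_inverse.clm_comp h3).congr fun y hy => ?_
  ext v : 1
  refine hG.ext hy fun z => ?_
  rw [ContinuousLinearMap.comp_apply, bil_inverse_apply (hG.pos y hy)]
  rfl

/-- The domain of the change of coordinates between the preferred charts at `x` and `x'`. -/
def overlap (x x' : M) : Set (Eu m) :=
  (extChartAt 𝓘(ℝ, Eu m) x).target ∩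
    (extChartAt 𝓘(ℝ, Eu m) x).symm ⁻¹' (extChartAt 𝓘(ℝ, Eu m) x').source

/-- The change of coordinates between the preferred charts at `x` and `x'`. -/
def transition (x x' : M) (y : Eu m) : Eu m :=
  extChartAt 𝓘(ℝ, Eu m) x' ((extChartAt 𝓘(ℝ, Eu m) x).symm y)

omit [IsManifold 𝓘(ℝ, Eu m) ∞ M] in
theorem isOpen_overlap (x x' : M) : IsOpen (overlap (m := m) x x') :=
  (continuousOn_extChartAt_symm x).isOpen_inter_preimage (isOpen_extChartAt_target x)
    (isOpen_extChartAt_source x')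

omit [IsManifold 𝓘(ℝ, Eu m) ∞ M] in
theorem transition_mem {x x' : M} {y : Eu m} (hy : y ∈ overlap x x') :
    transition x x' y ∈ (extChartAt 𝓘(ℝ, Eu m) x').target :=
  (extChartAt 𝓘(ℝ, Eu m) x').map_source hy.2

omit [IsManifold 𝓘(ℝ, Eu m) ∞ M] in
theorem chart_symm_transition {x x' : M} {y : Eu m} (hy : y ∈ overlap x x') :
    (extChartAt 𝓘(ℝ, Eu m) x').symm (transition x x' y) = (extChartAt 𝓘(ℝ, Eu m) x).symm y :=
  (extChartAt 𝓘(ℝ, Eu m) x').left_inv hy.2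

theorem contDiffOn_transition (x x' : M) :
    ContDiffOn ℝ ∞ (transition (m := m) x x') (overlap x x') := by
  rw [← contMDiffOn_iff_contDiffOn]
  exact (contMDiffOn_extChartAt (n := ∞)).comp
    ((contMDiffOn_extChartAt_symm x).mono Set.inter_subset_left) fun y hy => by
      simpa [extChartAt_source] using hy.2

theorem dChartSymm_transition {x x' : M} {y : Eu m} (hy : y ∈ overlap x x') (v : Eu m) :
    (dChartSymm x' (transition x x' y) (fderiv ℝ (transition x x') y v) : Eu m) =
      dChartSymm x y v := by
  have h1 : mfderiv 𝓘(ℝ, Eu m) 𝓘(ℝ, Eu m) (transition x x') y =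
      mfderiv 𝓘(ℝ, Eu m) 𝓘(ℝ, Eu m) (extChartAt 𝓘(ℝ, Eu m) x')
        ((extChartAt 𝓘(ℝ, Eu m) x).symm y) ∘L dChartSymm x y :=
    mfderiv_comp y (mdifferentiableAt_chart hy.2) (mdifferentiableAt_chart_symm hy.1)
  have : IsManifold 𝓘(ℝ, Eu m) 1 M := IsManifold.of_le (n := ∞) (by simp)
  have h2 := mfderivWithin_extChartAt_symm_comp_mfderiv_extChartAt' (I := 𝓘(ℝ, Eu m)) hy.2
  rw [ModelWithCorners.range_eq_univ, mfderivWithin_univ] at h2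
  rw [← mfderiv_eq_fderiv, h1]
  exact DFunLike.congr_fun h2 (dChartSymm x y v)

theorem isIsometryOn_transition (g : Metric m M) (x x' : M) :
    IsIsometryOn (overlap x x') (extChartAt 𝓘(ℝ, Eu m) x).target
      (extChartAt 𝓘(ℝ, Eu m) x').target (transition x x') (coordMetric g x)
      (coordMetric g x') where
  isOpen := isOpen_overlap x x'
  smooth := contDiffOn_transition x x'
  subset := Set.inter_subset_left
  mapsTo _ hq := transition_mem hq
  source := isMetricOn_coordMetric g x
  target := isMetricOn_coordMetric g x'
  metric q hq v w := by
    -- Tangent spaces at different points are all the model space. Forgetting the dependence of the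
    -- type on the point permits rewriting the base point.
    let b : M → Bil m := fun z => g.inner z
    have h : ∀ x y v w, coordMetric g x y v w =
      b ((extChartAt 𝓘(ℝ, Eu m) x).symm y) (dChartSymm x y v) (dChartSymm x y w) :=
      fun _ _ _ _ => rfl
    rw [h, h, dChartSymm_transition hq, dChartSymm_transition hq, chart_symm_transition hq]

end Coordinates

/-! ### Special almost Hermitian structures in charts -/

namespace SUStructure

variable {n : ℕ} {M : Type*} [TopologicalSpace M] [ChartedSpace (Eu (2 * n)) M]
  [IsManifold 𝓘(ℝ, Eu (2 * n)) ∞ M] (S : SUStructure n M)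

theorem isSUOn (x : M) : IsSUOn (extChartAt 𝓘(ℝ, Eu (2 * n)) x).target (coordMetric S.g x)
    (coordEnd S.J x) (coordForm S.Ψ x) where
  isHermitianOn :=
    { isMetricOn := isMetricOn_coordMetric S.g x
      smooth_J := contDiffOn_coordEnd S.g S.smooth_J x
      herm := fun p hp =>
        { symm := (isMetricOn_coordMetric S.g x).symm p hp
          pos := (isMetricOn_coordMetric S.g x).pos p hp
          sq := fun v => by
            simp only [ContinuousLinearMap.coe_coe]
            rw [coordEnd_apply, dChartSymm_coordEnd S.J hp, S.J_sq, map_neg, dChart_dChartSymm hp]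
          iso := fun v w => by
            simp only [ContinuousLinearMap.coe_coe]
            rw [coordMetric_apply, dChartSymm_coordEnd S.J hp, dChartSymm_coordEnd S.J hp,
              S.J_isometry, ← coordMetric_apply] } }
  smooth_Ψ := S.smooth_Ψ x
  type p hp v i := by
    have h := S.Ψ_type ((extChartAt 𝓘(ℝ, Eu (2 * n)) x).symm p) (fun k => dChartSymm x p (v k)) i
    rw [← dChartSymm_coordEnd S.J hp] at h
    refine Eq.trans ?_ h
    refine congrArg (S.Ψ _) (funext fun k => ?_)
    by_cases hk : k = i
    · subst hk; simp; rfl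
    · simp [hk]; rfl
  norm p hp e he := S.Ψ_norm _ (fun k => dChartSymm x p (e k)) he

theorem coordForm_eq {x x' : M} {y : Eu (2 * n)} (hy : y ∈ overlap x x')
    (v : Fin n → Eu (2 * n)) : coordForm S.Ψ x y v =
      coordForm S.Ψ x' (transition x x' y) fun i => fderiv ℝ (transition x x') y (v i) := by
  let ψ : M → Eu (2 * n) [⋀^Fin n]→L[ℝ] ℂ := fun z => S.Ψ z
  have h : ∀ (x : M) y v, coordForm S.Ψ x y v =
      ψ ((extChartAt 𝓘(ℝ, Eu (2 * n)) x).symm y) fun i => dChartSymm x y (v i) :=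
    fun _ _ _ => rfl
  rw [h, h, chart_symm_transition hy]
  congr 1
  funext i
  exact (dChartSymm_transition hy (v i)).symm

theorem coordEnd_eq {x x' : M} {y : Eu (2 * n)} (hy : y ∈ overlap x x') (v : Eu (2 * n)) :
    fderiv ℝ (transition x x') y (coordEnd S.J x y v) =
      coordEnd S.J x' (transition x x' y) (fderiv ℝ (transition x x') y v) := by
  let j : M → Eu (2 * n) →L[ℝ] Eu (2 * n) := fun z => S.J z
  have h : ∀ (x : M) {y} (_ : y ∈ (extChartAt 𝓘(ℝ, Eu (2 * n)) x).target) v,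
      (dChartSymm x y (coordEnd S.J x y v) : Eu (2 * n)) =
        j ((extChartAt 𝓘(ℝ, Eu (2 * n)) x).symm y) (dChartSymm x y v) :=
    fun x y hy v => dChartSymm_coordEnd S.J hy v
  have hy' := transition_mem hy
  have h1 : (dChartSymm x' (transition x x' y)
      (fderiv ℝ (transition x x') y (coordEnd S.J x y v)) : Eu (2 * n)) =
      dChartSymm x' (transition x x' y)
        (coordEnd S.J x' (transition x x' y) (fderiv ℝ (transition x x') y v)) := by
    rw [h x' hy', dChartSymm_transition hy, dChartSymm_transition hy, chart_symm_transition hy,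
      h x hy.1]
  have h2 := congrArg (dChart x' (transition x x' y)) h1
  rwa [dChart_dChartSymm hy', dChart_dChartSymm hy'] at h2

theorem isSUIsometryOn (x x' : M) :
    IsSUIsometryOn (overlap x x') (extChartAt 𝓘(ℝ, Eu (2 * n)) x).target
      (extChartAt 𝓘(ℝ, Eu (2 * n)) x').target (transition x x') (coordMetric S.g x)
      (coordMetric S.g x') (coordEnd S.J x) (coordEnd S.J x') (coordForm S.Ψ x)
      (coordForm S.Ψ x') where
  toIsIsometryOn := isIsometryOn_transition S.g x x'
  su := S.isSUOn x
  su' := S.isSUOn x'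
  complex _ hq := S.coordEnd_eq hq
  form _ hq := S.coordForm_eq hq

end SUStructure

/-! ## The Riemannian volume -/

section Volume

variable {m : ℕ} {M : Type*} [TopologicalSpace M] [ChartedSpace (Eu m) M]

theorem measurableSet_chart_preimage [MeasurableSpace M] [BorelSpace M] (x : M) {B : Set M}
    (hB : MeasurableSet B) :
    MeasurableSet ((extChartAt 𝓘(ℝ, Eu m) x).symm ⁻¹' B ∩ (extChartAt 𝓘(ℝ, Eu m) x).target) := by
  have h := (continuousOn_iff_continuous_domRestrict.mp
    (continuousOn_extChartAt_symm (I := 𝓘(ℝ, Eu m)) x)).measurable hB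
  obtain ⟨C, hC, he⟩ := h
  have : (extChartAt 𝓘(ℝ, Eu m) x).symm ⁻¹' B ∩ (extChartAt 𝓘(ℝ, Eu m) x).target =
      C ∩ (extChartAt 𝓘(ℝ, Eu m) x).target := by
    ext y
    exact and_congr_left fun hy => (Set.ext_iff.mp he ⟨y, hy⟩).symm
  rw [this]
  exact hC.inter (isOpen_extChartAt_target x).measurableSet

theorem measurableSet_chart_source [MeasurableSpace M] [BorelSpace M] (x : M) :
    MeasurableSet (extChartAt 𝓘(ℝ, Eu m) x).source :=
  (isOpen_extChartAt_source x).measurableSet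

variable [IsManifold 𝓘(ℝ, Eu m) ∞ M] [MeasurableSpace M] [BorelSpace M] (g : Metric m M)

omit [MeasurableSpace M] [BorelSpace M] in
theorem aemeasurable_density_target (x : M) :
    AEMeasurable (fun y => ENNReal.ofReal (density (coordMetric g x) y))
      (volume.restrict (extChartAt 𝓘(ℝ, Eu m) x).target) :=
  ((isMetricOn_coordMetric g x).contDiffOn_density.continuousOn.aemeasurable
    (isOpen_extChartAt_target x).measurableSet).ennreal_ofReal

theorem aemeasurable_chart_symm (x : M) : AEMeasurable (extChartAt 𝓘(ℝ, Eu m) x).symm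
    ((volume.restrict (extChartAt 𝓘(ℝ, Eu m) x).target).withDensity
      fun y => ENNReal.ofReal (density (coordMetric g x) y)) :=
  ((continuousOn_extChartAt_symm x).aemeasurable
    (isOpen_extChartAt_target x).measurableSet).mono_ac (withDensity_absolutelyContinuous _ _)

theorem chartVolume_apply (x : M) {B : Set M} (hB : MeasurableSet B) :
    chartVolume g x B =
      ∫⁻ y in (extChartAt 𝓘(ℝ, Eu m) x).symm ⁻¹' B ∩ (extChartAt 𝓘(ℝ, Eu m) x).target,
        ENNReal.ofReal (density (coordMetric g x) y) := by
  refine (Measure.map_apply_of_aemeasurable (aemeasurable_chart_symm g x) hB).trans ?_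
  rw [withDensity_apply', Measure.restrict_restrict' (isOpen_extChartAt_target x).measurableSet]

theorem chartVolume_inter_source (x : M) {B : Set M} (hB : MeasurableSet B) :
    chartVolume g x (B ∩ (extChartAt 𝓘(ℝ, Eu m) x).source) = chartVolume g x B := by
  rw [chartVolume_apply g x (hB.inter (measurableSet_chart_source x)), chartVolume_apply g x hB]
  congr 2
  ext y
  simp only [Set.mem_inter_iff, Set.mem_preimage]
  exact ⟨fun h => ⟨h.1.1, h.2⟩, fun h => ⟨⟨h.1, (extChartAt 𝓘(ℝ, Eu m) x).map_target h.2⟩, h.2⟩⟩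

/-- The change of variables formula, in which the Jacobian of the transition map matches the ratio
of the two densities. -/
theorem chartVolume_compatible (x x' : M) {B : Set M} (hB : MeasurableSet B)
    (h : B ⊆ (extChartAt 𝓘(ℝ, Eu m) x).source) (h' : B ⊆ (extChartAt 𝓘(ℝ, Eu m) x').source) :
    chartVolume g x B = chartVolume g x' B := by
  set A := (extChartAt 𝓘(ℝ, Eu m) x).symm ⁻¹' B ∩ (extChartAt 𝓘(ℝ, Eu m) x).target with hA
  have hI := isIsometryOn_transition g x x'
  have hsub : A ⊆ overlap x x' := fun y hy => ⟨hy.2, h' hy.1⟩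
  have himg : transition x x' '' A =
      (extChartAt 𝓘(ℝ, Eu m) x').symm ⁻¹' B ∩ (extChartAt 𝓘(ℝ, Eu m) x').target := by
    ext z
    constructor
    · rintro ⟨y, hy, rfl⟩
      refine ⟨?_, transition_mem (hsub hy)⟩
      rw [Set.mem_preimage, chart_symm_transition (hsub hy)]
      exact hy.1
    · rintro ⟨hz, hz'⟩
      have hz2 := h hz
      refine ⟨extChartAt 𝓘(ℝ, Eu m) x ((extChartAt 𝓘(ℝ, Eu m) x').symm z), ⟨?_, ?_⟩, ?_⟩
      · rw [Set.mem_preimage, (extChartAt 𝓘(ℝ, Eu m) x).left_inv hz2]; exact hz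
      · exact (extChartAt 𝓘(ℝ, Eu m) x).map_source hz2
      · rw [transition, (extChartAt 𝓘(ℝ, Eu m) x).left_inv hz2,
          (extChartAt 𝓘(ℝ, Eu m) x').right_inv hz']
  have hinj : Set.InjOn (transition x x') A := by
    intro y hy z hz hyz
    have h1 := chart_symm_transition (hsub hy)
    rw [hyz, chart_symm_transition (hsub hz)] at h1
    have h2 := congrArg (extChartAt 𝓘(ℝ, Eu m) x) h1
    rw [(extChartAt 𝓘(ℝ, Eu m) x).right_inv hy.2, (extChartAt 𝓘(ℝ, Eu m) x).right_inv hz.2] at h2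
    exact h2.symm
  rw [chartVolume_apply g x hB, chartVolume_apply g x' hB, ← himg,
    lintegral_image_eq_lintegral_abs_det_fderiv_mul volume (measurableSet_chart_preimage x hB)
      (fun y hy => (hI.hasFDerivAt (hsub hy)).hasFDerivWithinAt) hinj]
  refine setLIntegral_congr_fun (measurableSet_chart_preimage x hB) fun y hy => ?_
  rw [hI.density_eq (hsub hy), ENNReal.ofReal_mul (abs_nonneg _)]

theorem volumeMeasure_eq_chartVolume (x : M) {B : Set M} (hB : MeasurableSet B)
    (h : B ⊆ (extChartAt 𝓘(ℝ, Eu m) x).source) : volumeMeasure g B = chartVolume g x B := by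
  have hs := measurableSet_chart_source (m := m) x
  -- Every chart volume is bounded by the right side: inside the chart domain of x it is dominated
  -- by that of x by compatibility, outside by the supremum itself. Hence the supremum adds nothing
  -- inside this domain.
  have hle : volumeMeasure g ≤
      chartVolume g x + (volumeMeasure g).restrict (extChartAt 𝓘(ℝ, Eu m) x).sourceᶜ := by
    refine iSup_le fun x' => Measure.le_intro fun C hC _ => ?_
    rw [Measure.add_apply, Measure.restrict_apply hC, ← measure_inter_add_sdiff C hs]
    refine add_le_add ?_ (le_iSup (chartVolume g) x' _)
    rw [← chartVolume_inter_source g x' (hC.inter hs),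
      chartVolume_compatible g x' x ((hC.inter hs).inter (measurableSet_chart_source x'))
        Set.inter_subset_right (Set.inter_subset_left.trans Set.inter_subset_right)]
    exact measure_mono (Set.inter_subset_left.trans Set.inter_subset_left)
  refine le_antisymm ((hle B).trans ?_) (le_iSup (chartVolume g) x B)
  rw [Measure.add_apply, Measure.restrict_apply hB, (Set.disjoint_compl_right_iff_subset.mpr
    h).inter_eq, measure_empty, add_zero]

theorem volumeMeasure_restrict (x : M) :
    (volumeMeasure g).restrict (extChartAt 𝓘(ℝ, Eu m) x).source = chartVolume g x := by
  ext B hB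
  rw [Measure.restrict_apply hB, volumeMeasure_eq_chartVolume g x
    (hB.inter (measurableSet_chart_source x)) Set.inter_subset_right,
    chartVolume_inter_source g x hB]

/-- The integral of a function supported in a chart domain. -/
theorem integral_volumeMeasure (x : M) {f : M → ℝ} (hf : AEStronglyMeasurable f (chartVolume g x))
    (hs : ∀ z ∉ (extChartAt 𝓘(ℝ, Eu m) x).source, f z = 0) :
    ∫ z, f z ∂(volumeMeasure g) = ∫ y in (extChartAt 𝓘(ℝ, Eu m) x).target,
      f ((extChartAt 𝓘(ℝ, Eu m) x).symm y) * density (coordMetric g x) y := by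
  rw [← setIntegral_eq_integral_of_forall_compl_eq_zero hs, volumeMeasure_restrict]
  refine (integral_map (aemeasurable_chart_symm g x) hf).trans ?_
  rw [integral_withDensity_eq_integral_toReal_smul₀ (aemeasurable_density_target g x)
    (Filter.Eventually.of_forall fun _ => ENNReal.ofReal_lt_top)]
  refine integral_congr_ae (Filter.Eventually.of_forall fun y => ?_)
  simp only [smul_eq_mul]
  rw [ENNReal.toReal_ofReal (density_nonneg _ _), mul_comm]

instance : IsLocallyFiniteMeasure (volumeMeasure g) := by
  refine ⟨fun x => ?_⟩
  have hT := isOpen_extChartAt_target (I := 𝓘(ℝ, Eu m)) x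
  obtain ⟨r, hr, hball⟩ := Metric.nhds_basis_closedBall.mem_iff.mp
    (hT.mem_nhds (mem_extChartAt_target (I := 𝓘(ℝ, Eu m)) x))
  set K := Metric.closedBall (extChartAt 𝓘(ℝ, Eu m) x x) r
  have hN : (extChartAt 𝓘(ℝ, Eu m) x).source ∩ extChartAt 𝓘(ℝ, Eu m) x ⁻¹'
      Metric.ball (extChartAt 𝓘(ℝ, Eu m) x x) r ∈ nhds x :=
    Filter.inter_mem (extChartAt_source_mem_nhds x)
      (continuousAt_extChartAt x (Metric.ball_mem_nhds _ hr))
  have ho := (continuousOn_extChartAt (I := 𝓘(ℝ, Eu m)) x).isOpen_inter_preimage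
    (isOpen_extChartAt_source x) (Metric.isOpen_ball (x := extChartAt 𝓘(ℝ, Eu m) x x) (ε := r))
  refine ⟨_, hN, ?_⟩
  rw [volumeMeasure_eq_chartVolume g x ho.measurableSet Set.inter_subset_left,
    chartVolume_apply g x ho.measurableSet]
  -- The continuous density is integrable on a compact coordinate ball, which bounds the volume of
  -- its open interior.
  have hi : IntegrableOn (density (coordMetric g x)) K :=
    ((isMetricOn_coordMetric g x).contDiffOn_density.continuousOn.mono hball).integrableOn_compact
      (isCompact_closedBall _ _)
  refine lt_of_le_of_lt (lintegral_mono_set fun y hy => ?_) hi.lintegral_lt_top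
  have h1 := hy.1.2
  rw [Set.mem_preimage, (extChartAt 𝓘(ℝ, Eu m) x).right_inv hy.2] at h1
  exact Metric.ball_subset_closedBall h1

end Volume

/-! ## The divergence theorem -/

section Divergence

variable {m : ℕ}

theorem divAt_congr {G : Eu m → Bil m} {V W : Eu m → Eu m} {p : Eu m} (h : V =ᶠ[nhds p] W) :
    divAt G V p = divAt G W p := by
  rw [divAt, divAt, h.fderiv_eq, h.eq_of_nhds]

theorem divAt_sum {ι : Type*} (s : Finset ι) {G : Eu m → Bil m} {V : ι → Eu m → Eu m} {p : Eu m}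
    (h : ∀ i ∈ s, DifferentiableAt ℝ (V i) p) :
    divAt G (fun q => ∑ i ∈ s, V i q) p = ∑ i ∈ s, divAt G (V i) p := by
  simp only [divAt, fderiv_fun_sum h, map_sum, map_add, Finset.sum_add_distrib]

variable {M : Type*} [TopologicalSpace M] [ChartedSpace (Eu m) M]

theorem mem_overlap_self {x z : M} (hz : z ∈ (extChartAt 𝓘(ℝ, Eu m) x).source) :
    extChartAt 𝓘(ℝ, Eu m) z z ∈ overlap z x := by
  refine ⟨mem_extChartAt_target z, ?_⟩
  rwa [Set.mem_preimage, extChartAt_to_inv]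

theorem transition_self (x z : M) :
    transition z x (extChartAt 𝓘(ℝ, Eu m) z z) = extChartAt 𝓘(ℝ, Eu m) x z := by
  rw [transition, extChartAt_to_inv]

/-- Pointwise quantities are computed in the preferred chart of each point, which may jump from
point to point. Agreement with one expression in a fixed chart is what yields continuity. -/
theorem continuous_of_chart {f : M → ℝ} {F : M → Eu m → ℝ}
    (hF : ∀ x, ContinuousOn (F x) (extChartAt 𝓘(ℝ, Eu m) x).target)
    (h : ∀ x, ∀ z ∈ (extChartAt 𝓘(ℝ, Eu m) x).source, f z = F x (extChartAt 𝓘(ℝ, Eu m) x z)) :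
    Continuous f := by
  rw [continuous_iff_continuousAt]
  intro x
  have h1 : ContinuousAt (fun z => F x (extChartAt 𝓘(ℝ, Eu m) x z)) x :=
    ((hF x).continuousAt ((isOpen_extChartAt_target x).mem_nhds
      (mem_extChartAt_target x))).comp (continuousAt_extChartAt x)
  refine h1.congr ?_
  filter_upwards [extChartAt_source_mem_nhds (I := 𝓘(ℝ, Eu m)) x] with z hz using (h x z hz).symm

theorem contDiffOn_comp_chart_symm [IsManifold 𝓘(ℝ, Eu m) ∞ M] {ρ : M → ℝ}
    (hρ : ContMDiff 𝓘(ℝ, Eu m) 𝓘(ℝ, ℝ) ∞ ρ) (x : M) :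
    ContDiffOn ℝ ∞ (fun y => ρ ((extChartAt 𝓘(ℝ, Eu m) x).symm y))
      (extChartAt 𝓘(ℝ, Eu m) x).target := by
  rw [← contMDiffOn_iff_contDiffOn]
  exact hρ.comp_contMDiffOn (contMDiffOn_extChartAt_symm x)

end Divergence

namespace SUStructure

variable {n : ℕ} {M : Type*} [TopologicalSpace M] [ChartedSpace (Eu (2 * n)) M]
  [IsManifold 𝓘(ℝ, Eu (2 * n)) ∞ M] (S : SUStructure n M)

/-- The vector field `ρ η♯` in the preferred chart at `x`. -/
def coordField (ρ : M → ℝ) (x : M) (y : Eu (2 * n)) : Eu (2 * n) :=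
  ρ ((extChartAt 𝓘(ℝ, Eu (2 * n)) x).symm y) •
    etaField (coordMetric S.g x) (coordEnd S.J x) (coordForm S.Ψ x) y

/-- The divergence of the vector field `ρ η♯`. -/
def divField (ρ : M → ℝ) (x : M) : ℝ :=
  divAt (coordMetric S.g x) (S.coordField ρ x) (extChartAt 𝓘(ℝ, Eu (2 * n)) x x)

theorem contDiffOn_coordField (hn : n ≠ 0) {ρ : M → ℝ}
    (hρ : ContMDiff 𝓘(ℝ, Eu (2 * n)) 𝓘(ℝ, ℝ) ∞ ρ) (x : M) :
    ContDiffOn ℝ ∞ (S.coordField ρ x) (extChartAt 𝓘(ℝ, Eu (2 * n)) x).target :=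
  (contDiffOn_comp_chart_symm hρ x).smul fun _ hy =>
    ((S.isSUOn x).contDiffAt_etaField hy hn).contDiffWithinAt

theorem differentiableAt_coordField (hn : n ≠ 0) {ρ : M → ℝ}
    (hρ : ContMDiff 𝓘(ℝ, Eu (2 * n)) 𝓘(ℝ, ℝ) ∞ ρ) {x : M} {y : Eu (2 * n)}
    (hy : y ∈ (extChartAt 𝓘(ℝ, Eu (2 * n)) x).target) :
    DifferentiableAt ℝ (S.coordField ρ x) y :=
  ((S.contDiffOn_coordField hn hρ x).contDiffAt
    ((isOpen_extChartAt_target x).mem_nhds hy)).differentiableAt (by simp)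

/-- The transition map is an isometry carrying ρη♯ to ρη♯, and the divergence is natural. -/
theorem divField_eq (hn : n ≠ 0) {ρ : M → ℝ} (hρ : ContMDiff 𝓘(ℝ, Eu (2 * n)) 𝓘(ℝ, ℝ) ∞ ρ)
    (x : M) {z : M} (hz : z ∈ (extChartAt 𝓘(ℝ, Eu (2 * n)) x).source) :
    S.divField ρ z =
      divAt (coordMetric S.g x) (S.coordField ρ x) (extChartAt 𝓘(ℝ, Eu (2 * n)) x z) := by
  have hI := S.isSUIsometryOn z x
  have hp := mem_overlap_self hz
  rw [divField, ← transition_self x z]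
  refine hI.toIsIsometryOn.divAt_eq hp (S.differentiableAt_coordField hn hρ hp.1)
    (S.differentiableAt_coordField hn hρ (transition_mem hp)) ?_
  filter_upwards [(isOpen_overlap z x).mem_nhds hp] with q hq
  rw [coordField, coordField, map_smul, hI.etaField_eq hq hn, chart_symm_transition hq]

theorem continuous_divField (hn : n ≠ 0) {ρ : M → ℝ}
    (hρ : ContMDiff 𝓘(ℝ, Eu (2 * n)) 𝓘(ℝ, ℝ) ∞ ρ) : Continuous (S.divField ρ) :=
  continuous_of_chart
    (fun x => (isMetricOn_coordMetric S.g x).continuousOn_divAt (S.contDiffOn_coordField hn hρ x))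
    fun x _ hz => S.divField_eq hn hρ x hz

theorem divField_eq_zero {ρ : M → ℝ} {z : M} (hz : z ∉ tsupport ρ) : S.divField ρ z = 0 := by
  have h : S.coordField ρ z =ᶠ[nhds (extChartAt 𝓘(ℝ, Eu (2 * n)) z z)] fun _ => 0 := by
    have h1 : ∀ᶠ w in nhds z, ρ w = 0 := by
      filter_upwards [(isClosed_tsupport ρ).isOpen_compl.mem_nhds hz] with w hw
        using image_eq_zero_of_notMem_tsupport hw
    have h2 := continuousAt_extChartAt_symm (I := 𝓘(ℝ, Eu (2 * n))) z
    rw [ContinuousAt, extChartAt_to_inv] at h2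
    filter_upwards [h2.eventually h1] with y hy
    rw [coordField, hy, zero_smul]
  rw [divField, divAt_congr h, divAt]
  simp

variable [MeasurableSpace M] [BorelSpace M]

theorem integral_divField_of_tsupport_subset [CompactSpace M] (hn : n ≠ 0) {ρ : M → ℝ}
    (hρ : ContMDiff 𝓘(ℝ, Eu (2 * n)) 𝓘(ℝ, ℝ) ∞ ρ) (x : M)
    (hx : tsupport ρ ⊆ (extChartAt 𝓘(ℝ, Eu (2 * n)) x).source) :
    ∫ z, S.divField ρ z ∂(volumeMeasure S.g) = 0 := by
  set T := (extChartAt 𝓘(ℝ, Eu (2 * n)) x).target with hT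
  have ho : IsOpen T := isOpen_extChartAt_target x
  rw [integral_volumeMeasure S.g x (S.continuous_divField hn hρ).aestronglyMeasurable
    fun z hz => S.divField_eq_zero fun h => hz (hx h)]
  -- Outside the chart target the coordinate field has no meaning. Extending it by zero gives a
  -- field with compact support in the target.
  set V := T.indicator (S.coordField ρ x) with hV
  have hVT : ∀ y ∈ T, V =ᶠ[nhds y] S.coordField ρ x := fun y hy => by
    filter_upwards [ho.mem_nhds hy] with q hq using Set.indicator_of_mem hq _
  set K := extChartAt 𝓘(ℝ, Eu (2 * n)) x '' tsupport ρ with hK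
  have hKc : IsCompact K := (isClosed_tsupport ρ).isCompact.image_of_continuousOn
    ((continuousOn_extChartAt x).mono hx)
  have hsup : Function.support V ⊆ K := by
    intro y hy
    have hyT : y ∈ T := Set.mem_of_indicator_ne_zero hy
    refine ⟨(extChartAt 𝓘(ℝ, Eu (2 * n)) x).symm y, subset_tsupport _ fun h => hy ?_,
      (extChartAt 𝓘(ℝ, Eu (2 * n)) x).right_inv hyT⟩
    rw [hV, Set.indicator_of_mem hyT, coordField, h, zero_smul]
  have hts : tsupport V ⊆ K := closure_minimal hsup hKc.isClosed
  have h0 := (isMetricOn_coordMetric S.g x).integral_divAt_mul_density (V := V)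
    ((S.contDiffOn_coordField hn hρ x).congr fun y hy => Set.indicator_of_mem hy _)
    (hKc.of_isClosed_subset (isClosed_tsupport V) hts)
    (hts.trans (Set.image_subset_iff.mpr fun z hz =>
      (extChartAt 𝓘(ℝ, Eu (2 * n)) x).map_source (hx hz)))
  rw [← h0]
  refine setIntegral_congr_fun ho.measurableSet fun y hy => ?_
  rw [S.divField_eq hn hρ x ((extChartAt 𝓘(ℝ, Eu (2 * n)) x).map_target hy),
    (extChartAt 𝓘(ℝ, Eu (2 * n)) x).right_inv hy, divAt_congr (hVT y hy)]

theorem integrable_of_continuous [CompactSpace M] {f : M → ℝ} (hf : Continuous f) :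
    Integrable f (volumeMeasure S.g) :=
  hf.integrable_of_hasCompactSupport (HasCompactSupport.of_compactSpace f)

/-- The divergence theorem for `η♯`. -/
theorem integral_divField [T2Space M] [CompactSpace M] (hn : n ≠ 0) :
    ∫ z, S.divField (fun _ => 1) z ∂(volumeMeasure S.g) = 0 := by
  obtain ⟨t, ht⟩ := (isCompact_univ (X := M)).elim_nhds_subcover
    (fun x => (extChartAt 𝓘(ℝ, Eu (2 * n)) x).source) fun x _ => extChartAt_source_mem_nhds x
  obtain ⟨ρ, hρ⟩ := SmoothPartitionOfUnity.exists_isSubordinate 𝓘(ℝ, Eu (2 * n))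
    (isClosed_univ (X := M)) (fun x : t => (extChartAt 𝓘(ℝ, Eu (2 * n)) (x : M)).source)
    (fun x => isOpen_extChartAt_source _) (by
      intro z hz
      obtain ⟨x, hx, hzx⟩ := Set.mem_iUnion₂.mp (ht.2 hz)
      exact Set.mem_iUnion.mpr ⟨⟨x, hx⟩, hzx⟩)
  have hs : ∀ i, ContMDiff 𝓘(ℝ, Eu (2 * n)) 𝓘(ℝ, ℝ) ∞ (ρ i) := fun i => (ρ i).contMDiff
  -- The functions ρ_i sum to 1 and the divergence is additive, so the global statement reduces to
  -- fields supported in one chart domain.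
  have h1 : ∀ z, S.divField (fun _ => 1) z = ∑ i, S.divField (ρ i) z := by
    intro z
    simp only [divField]
    rw [← divAt_sum _ fun i _ => S.differentiableAt_coordField hn (hs i) (mem_extChartAt_target z)]
    congr 1
    funext y
    simp only [coordField, ← Finset.sum_smul]
    congr 1
    have := ρ.sum_eq_one (Set.mem_univ ((extChartAt 𝓘(ℝ, Eu (2 * n)) z).symm y))
    rw [finsum_eq_sum_of_fintype] at this
    exact this.symm
  simp only [h1]
  rw [integral_finsetSum _ fun i _ => S.integrable_of_continuous (S.continuous_divField hn (hs i))]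
  exact Finset.sum_eq_zero fun i _ => S.integral_divField_of_tsupport_subset hn (hs i) i (hρ i)

end SUStructure

/-! ## The integral formula -/

namespace SUStructure

variable {n : ℕ} {M : Type*} [TopologicalSpace M] [ChartedSpace (Eu (2 * n)) M]
  [IsManifold 𝓘(ℝ, Eu (2 * n)) ∞ M] (S : SUStructure n M)

theorem isAlmostHermitian (x : M) : IsAlmostHermitian (S.metricAt x) (S.complexAt x) :=
  (S.isSUOn x).isHermitianOn.herm _ (mem_extChartAt_target x)

theorem xiU_eq (x : M) : S.xiU x = toTor (uTor (coordMetric S.g x) (coordEnd S.J x)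
    (extChartAt 𝓘(ℝ, Eu (2 * n)) x x)) :=
  (S.isSUOn x).isHermitianOn.uTorsionAt_eq (mem_extChartAt_target x)

theorem xiU_mem (x : M) : S.xiU x ∈ uTorsionSpace (S.metricAt x) (S.complexAt x) := by
  rw [xiU_eq]
  exact (S.isSUOn x).isHermitianOn.uTor_mem (mem_extChartAt_target x)

theorem normSq12_sub_normSq34_eq (x : M) : S.normSq12 x - S.normSq34 x =
    quadTrace (coordMetric S.g x) (coordEnd S.J x) (extChartAt 𝓘(ℝ, Eu (2 * n)) x x) := by
  refine ((S.isAlmostHermitian x).normSq12_sub_normSq34 (S.xiU_mem x)).trans ?_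
  rw [xiU_eq]
  rfl

theorem sStar_eq (hn : n ≠ 0) (x : M) : S.sStar x = S.normSq12 x - S.normSq34 x
    + 4 * n * S.etaChi x - 2 * n * S.divField (fun _ => 1) x := by
  rw [normSq12_sub_normSq34_eq]
  have h : S.coordField (fun _ => 1) x =
      etaField (coordMetric S.g x) (coordEnd S.J x) (coordForm S.Ψ x) :=
    funext fun y => one_smul ℝ _
  rw [divField, h]
  exact (S.isSUOn x).starScalar_eq (mem_extChartAt_target x) hn

theorem continuous_normSq12_sub_normSq34 :
    Continuous fun x => S.normSq12 x - S.normSq34 x :=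
  continuous_of_chart (fun x => (S.isSUOn x).isHermitianOn.continuousOn_quadTrace) fun x z hz => by
    rw [normSq12_sub_normSq34_eq, (S.isSUIsometryOn z x).quadTrace_eq (mem_overlap_self hz),
      transition_self]

theorem continuous_etaChi (hn : n ≠ 0) : Continuous S.etaChi :=
  continuous_of_chart (fun x => (S.isSUOn x).continuousOn_etaForm_chi hn) fun x z hz => by
    refine ((S.isSUIsometryOn z x).etaForm_chi_eq (mem_overlap_self hz) hn).trans ?_
    rw [transition_self]

/-- ξ and ξ^{U(n)} differ by μ ⊗ J, which the W₅ summand absorbs. -/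
theorem xiU_mem_W123 (hn : n ≠ 0) (h : S.IsType1235) (x : M) :
    S.xiU x ∈ W1 (S.metricAt x) (S.complexAt x) ⊔ W2 (S.metricAt x) (S.complexAt x) ⊔
      W3 (S.metricAt x) (S.complexAt x) := by
  have hp := mem_extChartAt_target (I := 𝓘(ℝ, Eu (2 * n))) x
  obtain ⟨v, hv⟩ := (S.isSUOn x).exists_ne_zero hp
  refine (S.isAlmostHermitian x).mem_W123 (by positivity)
    (μ := (muForm (coordMetric S.g x) (coordEnd S.J x) (coordForm S.Ψ x) v
      (extChartAt 𝓘(ℝ, Eu (2 * n)) x x) : Eu (2 * n) →ₗ[ℝ] ℝ)) (S.xiU_mem x) (fun X => ?_) (h x)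
  rw [xi, (S.isSUOn x).suTorsionAt_eq hp hn hv, xiU_eq]
  rfl

theorem etaChi_eq_zero (hn : n ≠ 0) (h : S.IsType1235) (x : M) : S.etaChi x = 0 := by
  rw [etaChi, ((S.isAlmostHermitian x).normSq_of_mem_W123 (S.xiU_mem_W123 hn h x)).1]
  simp [etaForm]

theorem normSq_of_isType1235 (hn : n ≠ 0) (h : S.IsType1235) (x : M) :
    normSq (S.metricAt x) (S.xiComp 0 x) + normSq (S.metricAt x) (S.xiComp 1 x)
      - normSq (S.metricAt x) (S.xiComp 2 x) = S.normSq12 x - S.normSq34 x :=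
  ((S.isAlmostHermitian x).normSq_of_mem_W123 (S.xiU_mem_W123 hn h x)).2

variable [MeasurableSpace M] [BorelSpace M] [T2Space M] [CompactSpace M]

theorem integral_sStar (hn : n ≠ 0) : Integrable S.sStar (volumeMeasure S.g) ∧
    ∫ x, S.sStar x ∂(volumeMeasure S.g) =
      ∫ x, (S.normSq12 x - S.normSq34 x) ∂(volumeMeasure S.g)
        + 4 * n * ∫ x, S.etaChi x ∂(volumeMeasure S.g) := by
  have i1 := S.integrable_of_continuous S.continuous_normSq12_sub_normSq34
  have i2 := (S.integrable_of_continuous (S.continuous_etaChi hn)).const_mul (4 * (n : ℝ))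
  have i3 := (S.integrable_of_continuous
    (S.continuous_divField hn (ρ := fun _ => 1) contMDiff_const)).const_mul (2 * (n : ℝ))
  -- Integrability of s* is obtained from this formula, whose three terms are continuous on a
  -- compact manifold.
  have h : S.sStar = fun x => S.normSq12 x - S.normSq34 x
      + 4 * n * S.etaChi x - 2 * n * S.divField (fun _ => 1) x := funext (S.sStar_eq hn)
  rw [h]
  refine ⟨(i1.add i2).sub i3, ?_⟩
  refine (integral_sub (i1.add i2) i3).trans ?_
  rw [integral_const_mul, S.integral_divField hn, mul_zero, sub_zero]
  refine (integral_add i1 i2).trans ?_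
  rw [integral_const_mul]

end SUStructure

end SUGeometry

end

theorem mainTheorem6 {n : ℕ} (hn : 0 < n) {M : Type*} [TopologicalSpace M] [T2Space M]
    [CompactSpace M] [ChartedSpace (SUGeometry.Eu (2 * n)) M]
    [IsManifold 𝓘(ℝ, SUGeometry.Eu (2 * n)) ∞ M] [MeasurableSpace M] [BorelSpace M]
    (S : SUGeometry.SUStructure n M) :
    (Integrable S.sStar (SUGeometry.volumeMeasure S.g) ∧
      Integrable (fun x => S.normSq12 x - S.normSq34 x) (SUGeometry.volumeMeasure S.g) ∧
      Integrable S.etaChi (SUGeometry.volumeMeasure S.g) ∧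
      ∫ x, S.sStar x ∂(SUGeometry.volumeMeasure S.g) =
        ∫ x, (S.normSq12 x - S.normSq34 x) ∂(SUGeometry.volumeMeasure S.g)
          + 4 * n * ∫ x, S.etaChi x ∂(SUGeometry.volumeMeasure S.g)) ∧
    (S.IsType1235 →
      Integrable (fun x => SUGeometry.normSq (S.metricAt x) (S.xiComp 0 x)
        + SUGeometry.normSq (S.metricAt x) (S.xiComp 1 x)
        - SUGeometry.normSq (S.metricAt x) (S.xiComp 2 x)) (SUGeometry.volumeMeasure S.g) ∧
      ∫ x, S.sStar x ∂(SUGeometry.volumeMeasure S.g) =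
        ∫ x, (SUGeometry.normSq (S.metricAt x) (S.xiComp 0 x)
          + SUGeometry.normSq (S.metricAt x) (S.xiComp 1 x)
          - SUGeometry.normSq (S.metricAt x) (S.xiComp 2 x)) ∂(SUGeometry.volumeMeasure S.g)) := by
  have hn' := hn.ne'
  obtain ⟨h1, h2⟩ := S.integral_sStar hn'
  have h3 := S.integrable_of_continuous S.continuous_normSq12_sub_normSq34
  refine ⟨⟨h1, h3, S.integrable_of_continuous (S.continuous_etaChi hn'), h2⟩, fun h => ?_⟩
  simp only [S.normSq_of_isType1235 hn' h]
  refine ⟨h3, ?_⟩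
  rw [h2]
  simp [S.etaChi_eq_zero hn' h]
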